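/- Let $P_1,\dots,P_5$ be five points of the Euclidean plane, no three of them collinear. A conic is an ellipse (circles included), a parabola or a hyperbola, given by its focal definition; an axis of a conic is a line of symmetry; an asymptote is a line along which, in both directions, the distance of its points from the conic tends to $0$. Write $MN$ for the line through $M$ and $N$. **Conic and chords.** There is exactly one conic $\mathcal C$ through the five points. Let $l$ be a line through $P_1$. With $X=P_1P_2\cap P_4P_5$, $Y=P_3P_4\cap l$, $p=XY$, $Z=P_2P_3\cap p$, the Pascal construction gives the point $S=ZP_5\cap l$ (points and lines at infinity are admitted for $X,Y,Z,p$). For $l$ parallel to $P_2P_3$ this gives exactly one point $P_6$, and $l\cap\mathcal C=\{P_1,P_6\}$. The same construction applied to $(P_5,P_1,P_2,P_3,P_4)$ and to the parallel $m$ to $P_1P_2$ through $P_5$ gives exactly one point $Q_6$, and $m\cap\mathcal C=\{P_5,Q_6\}$. (A chord is allowed to degenerate to a point of tangency.) **Diameters.** Let $d_1$ be the line joining the midpoints of $P_1P_6$ and $P_2P_3$, and $d_2$ the line joining the midpoints of $P_5Q_6$ and $P_1P_2$. Then $d_1\ne d_2$, the line $d_1$ bisects all chords of $\mathcal C$ parallel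 to $P_2P_3$, and $d_2$ bisects all chords parallel to $P_1P_2$. The conic is a parabola if and only if $d_1\parallel d_2$. **Parabola.** Let $d_1\parallel d_2$. For the line $l$ through $P_1$ perpendicular to $d_1$ the Pascal construction gives exactly one point $R_6$, $l\cap\mathcal C=\{P_1,R_6\}$, and the only axis of $\mathcal C$ is the parallel $t$ to $d_1$ through the midpoint of $P_1R_6$ (the perpendicular bisector of $P_1R_6$ if $R_6\ne P_1$). There are $P,Q$ among the five points such that $P\notin t$ and $Q$ is not on the perpendicular $s$ to $t$ through $P$. For all such $P,Q$ and each $F'\in t$ the following construction can be carried out, and every way of carrying it out gives the focus $F$ and directrix $d$ of $\mathcal C$. Take a parabola $D'$ through $P$ with focus $F'$, directrix perpendicular to $t$, and vertex $V'\in t$; let $Q'$ be the point of $D'$ on the parallel to $t$ through $Q$, $\alpha$ the orthogonal affinity with axis $s$ and $\alpha(Q')=Q$, and $V=\alpha(V')$ (then $\alpha(D')=\mathcal C$ and $V\in\mathcal C$); let $R$ be the common point of the perpendicular to $t$ at $V$ and the middle parallel of $t$ and the parallel $p$ to $t$ through $P$; the mirror image of $p$ in $RP$ meets $t$ in $F$;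 $d$ is the perpendicular to $t$ at the mirror image of $F$ in $V$. **Central conics.** Let $d_1\nparallel d_2$. Then $d_1,d_2$ meet in exactly one point $O$, which is a centre of symmetry of $\mathcal C$. Let $d_1',d_2'$ be the parallels through $O$ to $P_2P_3$ and $P_1P_2$. Each line of the pair $d_i,d_i'$ bisects the chords parallel to the other (conjugate diameters). Suppose $O$ is not the midpoint of $P_1P_3$ (otherwise the two pairs coincide; interchange the names of $P_1$ and $P_2$). If a line not through $O$ meets $d_1,d_1',d_2,d_2'$ in $A,A',B,B'$, then $\mathcal C$ is an ellipse iff $A,A'$ and $B,B'$ separate each other, iff the cross-ratio $(AA';BB')$ is negative; $\mathcal C$ is a hyperbola iff they do not separate each other, iff the cross-ratio is positive. **Ellipse.** (a) Again suppose $O$ is not the midpoint of $P_1P_3$, and let $t$ be any line not through $O$. There is an affinity with axis $t$ (fixing $t$ pointwise) that sends both pairs $d_i,d_i'$ to perpendicular pairs. Let $\alpha$ be any such affinity and $K=\alpha(O)$. Then $\alpha(\mathcal C)$ is a circle with centre $K$. If a circle with centre on $t$ through $O$ and $K$ meets $t$ in $F\ne G$, then $OF$ and $OG$ are perpendicular axes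 of $\mathcal C$. Such a circle exists unless $\overrightarrow{OK}$ is orthogonal to $t$ (possibly zero), and in that case the parallel and the perpendicular to $t$ through $O$ are axes. (b) Let $t$ be an axis and $t'$ the perpendicular to it at $O$. There are different $P,Q$ among the five points with $PQ\nparallel t$ and midpoint $M$ of $PQ$ not on $t$. For all such $P,Q$: let $G=PQ\cap t$, let $F'$ be a common point of the perpendicular to $t$ through $M$ and the circle with diameter $OG$, and let $\alpha$ be the orthogonal affinity with axis $t$ sending $M$ to $F'$. This can be carried out, and always $|O\alpha(P)|=|O\alpha(Q)|=:a$, $\alpha(\mathcal C)$ is the circle around $O$ with radius $a$, and the points $V\in t$ with $|OV|=a$ and $W\in t'$ with $|O\alpha(W)|=a$ are, with their mirror images in $O$, the common points of $\mathcal C$ with $t$ and $t'$. If $|OW|\le|OV|$, there is a point $F$ of $t$ with $|FW|=|OV|$, and any such $F$ and its mirror image in $O$ are the foci of $\mathcal C$, with sum of focal distances $2|OV|$; if $|OV|\le|OW|$, the same holds with $t,V$ and $t',W$ interchanged. **Hyperbola.** (a) Among the five points there are three different points $P,Q,R$ such that $O$ is not the midpoint of $PQ$ or of $QR$, and $QR$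 is not parallel to $OF$, with $F$ the midpoint of $PQ$. For all such $P,Q,R$ the following can be carried out, and every way of carrying it out gives two different lines $OA$, $OB$ that are exactly the asymptotes of $\mathcal C$: take an affinity $\alpha$ with axis $OF$ such that $\alpha(P)\alpha(Q)\perp OF$; let the perpendicular bisector of $\alpha(Q)\alpha(R)$ meet $OF$ in $M$ and the perpendicular bisector of $OM$ in $N$; the circle around $N$ through $O$ meets the line $\alpha(Q)\alpha(R)$ in two points $\alpha(A),\alpha(B)$. (b) Let $L_1\neq L_2$ be the asymptotes and $P$ one of the five points. There are unit vectors $u,v$ parallel to $L_1,L_2$ and $x,y>0$ with $P=O+xu+yv$. Let $B=O+\sqrt{xy}\,(u+v)$, let the perpendicular to $OB$ at $B$ meet $L_1$ in $T$, and let $F\in OB$ with $|OF|=|OT|$. This can be carried out, and always the line $OB$ meets $\mathcal C$ exactly in $B$ and its mirror image in $O$; $OB$ and the perpendicular to it at $O$ are axes of $\mathcal C$; and $F$ and its mirror image in $O$ are the foci of $\mathcal C$, with absolute difference of focal distances $2|OB|$. -/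

import Mathlib

open Set Filter Topology
open scoped Affine RealInnerProductSpace

namespace FivePointConic

/-- The Euclidean plane. -/
abbrev Plane := EuclideanSpace ℝ (Fin 2)

/-- Affine subspaces of the plane; those satisfying `IsLine` are the lines. -/
abbrev Sub := AffineSubspace ℝ Plane

def IsLine (L : Sub) : Prop :=
  (L : Set Plane).Nonempty ∧ Module.finrank ℝ L.direction = 1

/-- The parallel to the line `L` through `X`. -/
noncomputable def parallelThrough (X : Plane) (L : Sub) : Sub := AffineSubspace.mk' X L.direction

/-- The perpendicular to the line `L` through `X`. -/
noncomputable def perpThrough (X : Plane) (L : Sub) : Sub := AffineSubspace.mk' X L.directionᗮ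

/-- The two lines are perpendicular. -/
def Perp (L M : Sub) : Prop := L.direction ⟂ M.direction

/-- The point of the plane symmetric to `X` with respect to the point `O`. -/
noncomputable def pointMirror (O X : Plane) : Plane := AffineEquiv.pointReflection ℝ O X

/-- `Y` is the mirror image of `X` in the line `L`. -/
def IsMirror (L : Sub) (X Y : Plane) : Prop :=
  midpoint ℝ X Y ∈ L ∧ Y - X ∈ L.directionᗮ

/-- The three lines have a common point in the projective closure of the plane: a common point of
the plane, or a common point at infinity. -/
def Concurrent (L₁ L₂ L₃ : Sub) : Prop :=
  (∃ X, X ∈ L₁ ∧ X ∈ L₂ ∧ X ∈ L₃) ∨ (L₁ ∥ L₂ ∧ L₁ ∥ L₃)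

/-! ### Conics -/

/-- Ellipse with foci `F₁`, `F₂` and sum of distances `s` (a circle if `F₁ = F₂`). -/
def IsEllipseWith (C : Set Plane) (F₁ F₂ : Plane) (s : ℝ) : Prop :=
  dist F₁ F₂ < s ∧ C = {X | dist X F₁ + dist X F₂ = s}

/-- Hyperbola with foci `F₁`, `F₂` and absolute difference of distances `s`. -/
def IsHyperbolaWith (C : Set Plane) (F₁ F₂ : Plane) (s : ℝ) : Prop :=
  0 < s ∧ s < dist F₁ F₂ ∧ C = {X | |dist X F₁ - dist X F₂| = s}

/-- Parabola with focus `F` and directrix `d`. -/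
def IsParabolaWith (C : Set Plane) (F : Plane) (d : Sub) : Prop :=
  IsLine d ∧ F ∉ d ∧ C = {X | dist X F = Metric.infDist X (d : Set Plane)}

def IsEllipse (C : Set Plane) : Prop := ∃ F₁ F₂ s, IsEllipseWith C F₁ F₂ s
def IsHyperbola (C : Set Plane) : Prop := ∃ F₁ F₂ s, IsHyperbolaWith C F₁ F₂ s
def IsParabola (C : Set Plane) : Prop := ∃ F d, IsParabolaWith C F d

def IsConic (C : Set Plane) : Prop := IsEllipse C ∨ IsParabola C ∨ IsHyperbola C

/-- `O` is a centre of symmetry of `C`. -/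
def IsCenter (C : Set Plane) (O : Plane) : Prop := ∀ X ∈ C, pointMirror O X ∈ C

/-- The line `L` is an axis of symmetry of `C`. -/
def IsAxis (C : Set Plane) (L : Sub) : Prop :=
  IsLine L ∧ ∀ X ∈ C, ∀ Y, IsMirror L X Y → Y ∈ C

/-- The line `d` bisects all the chords of `C` that are parallel to the line `L`: it is the diameter
of `C` conjugate to the direction of `L`. -/
def IsDiameterConj (C : Set Plane) (d L : Sub) : Prop :=
  IsLine d ∧ ∀ X ∈ C, ∀ Y ∈ C, X ≠ Y → Y - X ∈ L.direction → midpoint ℝ X Y ∈ d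

/-- Each of the two lines bisects the chords of `C` parallel to the other one. -/
def IsConjugatePair (C : Set Plane) (d d' : Sub) : Prop :=
  IsDiameterConj C d d' ∧ IsDiameterConj C d' d

/-- The line `L` is an asymptote of `C`: the distance from `C` of a point of `L` tends to `0` when
the point tends to infinity along `L` (in both directions). -/
def IsAsymptote (C : Set Plane) (L : Sub) : Prop :=
  IsLine L ∧ C.Nonempty ∧
    Tendsto (fun X => Metric.infDist X C) (cocompact Plane ⊓ 𝓟 (L : Set Plane)) (𝓝 0)

/-! ### Pascal's construction, separation, affinities -/

/-- Pascal's construction of a sixth point `S` on a line `l` through `A` from the five points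
`A, B, C, D, E`, with opposite sides `AB, DE` / `BC, ES` / `CD, SA` of the hexagon `ABCDES`, where
`SA = l`. The Pascal line `p` joins `X = AB ∩ DE` to `Y = CD ∩ l`, the line `q` joins `E` to
`Z = BC ∩ p`, and `S` lies on `q` and `l`. The points `X, Y, Z` may be points at infinity; the last
alternative is the case in which `X` and `Y` both are, so that `p` is the line at infinity. -/
def PascalSixth (A B C D E : Plane) (l : Sub) (S : Plane) : Prop :=
  ∃ q : Sub, IsLine q ∧ E ∈ q ∧ S ∈ q ∧ S ∈ l ∧
    ((∃ p : Sub, IsLine p ∧ Concurrent p line[ℝ, A, B] line[ℝ, D, E] ∧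
        Concurrent p line[ℝ, C, D] l ∧ Concurrent q line[ℝ, B, C] p) ∨
      (line[ℝ, A, B] ∥ line[ℝ, D, E] ∧ line[ℝ, C, D] ∥ l ∧ q ∥ line[ℝ, B, C]))

/-- The pairs `A, A'` and `B, B'` of points of a line separate (cross) each other: exactly one of
`B`, `B'` lies strictly between `A` and `A'`. -/
def Separate (A A' B B' : Plane) : Prop := Xor (Sbtw ℝ A B A') (Sbtw ℝ A B' A')

/-- The signed ratio `AX : XA'` for a point `X ≠ A'` of the line `AA'`. -/
noncomputable def signedRatio (A A' X : Plane) : ℝ := ⟪X - A, A' - X⟫ / ⟪A' - X, A' - X⟫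

/-- The cross-ratio `(A A'; B B')` of four different collinear points. -/
noncomputable def crossRatio (A A' B B' : Plane) : ℝ := signedRatio A A' B / signedRatio A A' B'

/-- `α` is an affinity with axis `t`, i.e. it fixes the points of `t`. -/
def IsAffinity (t : Sub) (α : Plane ≃ᵃ[ℝ] Plane) : Prop := ∀ X ∈ t, α X = X

/-- `α` is an orthogonal affinity with axis `t`. -/
def IsOrthAffinity (t : Sub) (α : Plane ≃ᵃ[ℝ] Plane) : Prop :=
  IsAffinity t α ∧ ∀ X, α X - X ∈ t.directionᗮ

/-! ### The constructions of the metric data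

Each of the following predicates lists the steps of one construction and nothing else. -/

/-- Parabola from its axis `t` and two of its points `P`, `Q`. `D'` is an auxiliary parabola through
`P` with focus `F'` on `t`, directrix `d'` perpendicular to `t`, and vertex `V'`; `Q'` is the point
of `D'` on the parallel to `t` through `Q`; `α` is the orthogonal affinity whose axis is the
perpendicular to `t` through `P` and which sends `Q'` to `Q`; `V = α V'`. The foot of `P` on `t`
is `T`, and `R` is the common point of the perpendicular to `t` at `V` and of the middle parallel of
`t` and of the parallel to `t` through `P`. The mirror image in `RP` of that parallel meets `t` in
`F`, and `d` is the perpendicular to `t` at the mirror image of `F` in `V`. -/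
structure ParabolaSteps (t : Sub) (P Q F' : Plane) (d' : Sub) (D' : Set Plane)
    (V' Q' : Plane) (α : Plane ≃ᵃ[ℝ] Plane) (V T R F : Plane) (d : Sub) : Prop where
  focus'_mem : F' ∈ t
  directrix'_perp : Perp d' t
  parabola' : IsParabolaWith D' F' d'
  point_mem : P ∈ D'
  vertex'_mem : V' ∈ D' ∧ V' ∈ t
  image_mem : Q' ∈ D' ∧ Q' ∈ parallelThrough Q t
  affinity : IsOrthAffinity (perpThrough P t) α
  affinity_apply : α Q' = Q
  vertex : V = α V'
  foot : T ∈ t ∧ T ∈ perpThrough P t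
  tangent_point : R ∈ perpThrough V t ∧ R ∈ parallelThrough (midpoint ℝ P T) t
  focus_mem : F ∈ t ∧ ∃ X ∈ parallelThrough P t, IsMirror line[ℝ, R, P] X F
  directrix : d = perpThrough (pointMirror V F) t

/-- Ellipse from its centre `O`, an axis `t` and two of its points `P`, `Q`. The line `PQ` meets `t`
in `G`; the perpendicular to `t` through the midpoint of `PQ` meets the circle with diameter `OG` in
`F'`; `α` is the orthogonal affinity with axis `t` that sends the midpoint of `PQ` to `F'`. The
points `V` of `t` and `W` of the perpendicular to `t` at `O` are such that `α V = V` and `α W` lie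
on the circle around `O` through `α P`. -/
structure EllipseSteps (O : Plane) (t : Sub) (P Q G F' : Plane) (α : Plane ≃ᵃ[ℝ] Plane)
    (V W : Plane) : Prop where
  meet : G ∈ t ∧ G ∈ line[ℝ, P, Q]
  perp : F' ∈ perpThrough (midpoint ℝ P Q) t
  circle : dist F' (midpoint ℝ O G) = dist O (midpoint ℝ O G)
  affinity : IsOrthAffinity t α
  affinity_apply : α (midpoint ℝ P Q) = F'
  vertex : V ∈ t ∧ dist O V = dist O (α P)
  covertex : W ∈ perpThrough O t ∧ dist O (α W) = dist O (α P)

/-- Asymptotes of a hyperbola from its centre `O` and three of its points `P`, `Q`, `R`. With `F`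
the midpoint of `PQ`, the affinity `α` with axis `OF` makes `PQ` perpendicular to `OF`. The
perpendicular to the line `α Q α R` at the midpoint of this segment meets `OF` in `M` and
the perpendicular bisector of `OM` in `N`. The circle around `N` through `O` meets the line
`α Q α R` in the two points `α A` and `α B`. -/
structure AsymptoteSteps (O P Q R : Plane) (α : Plane ≃ᵃ[ℝ] Plane) (M N A B : Plane) : Prop where
  affinity : IsAffinity line[ℝ, O, midpoint ℝ P Q] α
  affinity_perp : Perp line[ℝ, α P, α Q] line[ℝ, O, midpoint ℝ P Q]
  bisector_meet : M ∈ line[ℝ, O, midpoint ℝ P Q] ∧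
    M ∈ perpThrough (midpoint ℝ (α Q) (α R)) line[ℝ, α Q, α R]
  circle_center : dist N O = dist N M ∧
    N ∈ perpThrough (midpoint ℝ (α Q) (α R)) line[ℝ, α Q, α R]
  ne : A ≠ B
  left : α A ∈ line[ℝ, α Q, α R] ∧ dist N (α A) = dist N O
  right : α B ∈ line[ℝ, α Q, α R] ∧ dist N (α B) = dist N O

/-- Hyperbola from its centre `O`, its asymptotes `L₁`, `L₂` and one of its points `P`. The affine
distances of `P` from the asymptotes are `x` and `y`, measured along the unit vectors `u`, `v` that
point into the angular domain of `P`. The point `B` of the bisector of this domain has both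
affine distances equal to the geometric mean of `x` and `y`. The perpendicular to `OB` at `B` meets
`L₁` in `T`, and `F` is a common point of the line `OB` and of the circle around `O`
through `T`. -/
structure HyperbolaSteps (O : Plane) (L₁ L₂ : Sub) (P u v : Plane) (x y : ℝ) (B T F : Plane) :
    Prop where
  unit_left : u ∈ L₁.direction ∧ ‖u‖ = 1
  unit_right : v ∈ L₂.direction ∧ ‖v‖ = 1
  pos : 0 < x ∧ 0 < y
  point : P = O + x • u + y • v
  vertex : B = O + √(x * y) • u + √(x * y) • v
  tangent_meet : T ∈ L₁ ∧ T ∈ perpThrough B line[ℝ, O, B]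
  focus : F ∈ line[ℝ, O, B] ∧ dist O F = dist O T

end FivePointConic

open FivePointConic

/-!
The proof is analytic. A conic is described by a polynomial of degree two (`Quadric`) with
nonvanishing determinant, and every part of the theorem becomes a statement on the value, the
derivative and the bilinear form of this polynomial.

*From foci to equations and back.* Squaring the focal equation of an ellipse, a hyperbola or a
parabola gives a nondegenerate quadric without losing the conic (`focal_ellipse`,
`focal_hyperbola`, `IsConic.exists_quadric`). Conversely, in an orthonormal frame of eigenvectors of
the form (`Quadric.exists_principal_frame`) a nondegenerate quadric with a real point takes a normal
form, whose foci are explicit (`Quadric.isConic_zeros`). The sign of the discriminant decides the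
type. A quadric through five points, no three of them collinear, is nondegenerate or zero, and it is
unique up to a factor (`Quadric.det_ne_zero`, `Quadric.exists_smul`): hence there is exactly one
conic through the points.

*Pascal's construction.* In homogeneous coordinates, with joins and meets as cross products, the
condition that a point `A + t v` results from the construction is a polynomial identity away from
the equation of the conic (`pascal_identity`). Points at infinity need no separate treatment, and
the construction gives exactly the second common point of the line and the conic
(`pascalSixth_iff`).

*Diameters.* The midpoint of a chord of direction `v` satisfies the linear equation that the
derivative in the direction `v` vanishes there (`Quadric.lin_midpoint`). Its solutions are a line
whose direction is conjugate to `v` (`Quadric.conj`). Two such lines are parallel exactly if the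
discriminant vanishes, i.e. for a parabola; otherwise they meet in the zero of the derivative, the
centre (`Quadric.exists_isCtr`). With respect to two pairs of conjugate directions the form is
determined up to a factor (`Quadric.exists_form_eq_smul`), and its discriminant is positive exactly
if the pairs separate each other (`Quadric.separation_part`).

*Metric constructions.* In a frame adapted to the given axis every step of a construction is an
equation between coordinates. The steps for the parabola force the affinity to have the ratio of the
parameters of the two parabolas (`Frame.parabola_of_steps`), and the steps for the ellipse force it
to have the ratio `a / b` of the semi-axes (`Frame.ellipse_of_steps`). An affinity that makes two
pairs of conjugate diameters orthogonal turns the form into a multiple of the inner product, so it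
sends the ellipse to a circle, and conjugate directions that are also orthogonal are axes
(`Quadric.ellipse_axes_part`).

*Hyperbolas.* A line along which the distance from the conic tends to zero has an isotropic
direction and passes through the centre, and conversely
(`Quadric.form_eq_zero_of_isAsymptote`, `Quadric.IsCtr.isAsymptote_iff`). An affinity that makes the
chord `P Q` perpendicular to its conjugate diameter makes the form diagonal, and on the line `Q R`
the points of the circle and of the asymptotes satisfy the same quadratic equation
(`Frame.asymptote_points`). For isotropic unit vectors `u, v` the vectors `u + v`, `u - v` are at
once orthogonal and conjugate; they give the axes, the vertices and the foci
(`Quadric.IsCtr.exists_frame_of_isotropic`, `Quadric.hyperbola_foci_part`).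
-/

namespace FivePointConic

/-! ### Coordinates, vectors and lines -/

/-- The cross product (signed area) of two vectors of the plane. -/
def crs (v w : Plane) : ℝ := v 0 * w 1 - v 1 * w 0

/-- The inner product of two vectors of the plane, in coordinates. -/
def dotp (v w : Plane) : ℝ := v 0 * w 0 + v 1 * w 1

/-- Rotation by a right angle. -/
noncomputable def rot (v : Plane) : Plane := !₂[-v 1, v 0]

@[simp] lemma rot_zero (v : Plane) : rot v 0 = -v 1 := by simp [rot]
@[simp] lemma rot_one (v : Plane) : rot v 1 = v 0 := by simp [rot]

lemma plane_ext {X Y : Plane} (h0 : X 0 = Y 0) (h1 : X 1 = Y 1) : X = Y := by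
  ext i; fin_cases i <;> assumption

lemma plane_ext_iff {X Y : Plane} : X = Y ↔ X 0 = Y 0 ∧ X 1 = Y 1 :=
  ⟨by rintro rfl; exact ⟨rfl, rfl⟩, fun h => plane_ext h.1 h.2⟩

lemma inner_eq_dotp (v w : Plane) : ⟪v, w⟫ = dotp v w := by
  simp [PiLp.inner_apply, dotp, Fin.sum_univ_two]; ring

lemma norm_sq_eq_dotp (v : Plane) : ‖v‖ ^ 2 = dotp v v := by
  rw [← real_inner_self_eq_norm_sq, inner_eq_dotp]

lemma dist_sq_eq (X Y : Plane) : dist X Y ^ 2 = dotp (X - Y) (X - Y) := by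
  rw [dist_eq_norm, norm_sq_eq_dotp]

@[simp] lemma midpoint_zero (X Y : Plane) : midpoint ℝ X Y 0 = (X 0 + Y 0) / 2 := by
  rw [midpoint_eq_smul_add]; simp; ring
@[simp] lemma midpoint_one (X Y : Plane) : midpoint ℝ X Y 1 = (X 1 + Y 1) / 2 := by
  rw [midpoint_eq_smul_add]; simp; ring

lemma pointMirror_eq (O X : Plane) : pointMirror O X = O + O - X := by
  rw [pointMirror, AffineEquiv.pointReflection_apply, vsub_eq_sub, vadd_eq_add]; abel

@[simp] lemma pointMirror_zero (O X : Plane) : pointMirror O X 0 = 2 * O 0 - X 0 := by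
  rw [pointMirror_eq]; simp; ring
@[simp] lemma pointMirror_one (O X : Plane) : pointMirror O X 1 = 2 * O 1 - X 1 := by
  rw [pointMirror_eq]; simp; ring

lemma dotp_self_pos {v : Plane} (hv : v ≠ 0) : 0 < dotp v v := by
  rw [← norm_sq_eq_dotp]; positivity

lemma rot_ne_zero {v : Plane} (hv : v ≠ 0) : rot v ≠ 0 := by
  intro h; apply hv
  have h0 := congrArg (fun x : Plane => x 0) h
  have h1 := congrArg (fun x : Plane => x 1) h
  simp at h0 h1
  exact plane_ext (by simpa using h1) (by simpa using h0)

lemma crs_eq_zero_iff {v w : Plane} (hv : v ≠ 0) : crs v w = 0 ↔ ∃ r : ℝ, w = r • v := by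
  constructor
  · intro h
    have hd := dotp_self_pos hv
    refine ⟨dotp v w / dotp v v, ?_⟩
    have hd' := hd.ne'
    apply plane_ext <;> simp only [PiLp.smul_apply, smul_eq_mul]
    · rw [div_mul_eq_mul_div, eq_div_iff hd']
      simp only [crs, dotp] at *
      linear_combination (-v 1) * h
    · rw [div_mul_eq_mul_div, eq_div_iff hd']
      simp only [crs, dotp] at *
      linear_combination (v 0) * h
  · rintro ⟨r, rfl⟩
    simp [crs]; ring

lemma dotp_eq_zero_iff {v w : Plane} (hv : v ≠ 0) : dotp v w = 0 ↔ ∃ r : ℝ, w = r • rot v := by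
  rw [← crs_eq_zero_iff (rot_ne_zero hv)]
  simp only [crs, dotp, rot_zero, rot_one]
  constructor <;> intro h <;> linarith

/-- Expansion of a vector in a basis of the plane. -/
lemma eq_basis {v w : Plane} (h : crs v w ≠ 0) (z : Plane) :
    z = (crs z w / crs v w) • v + (crs v z / crs v w) • w := by
  apply plane_ext <;> simp only [PiLp.smul_apply, PiLp.add_apply, smul_eq_mul, div_mul_eq_mul_div,
    ← add_div] <;> rw [eq_div_iff h] <;> simp only [crs] <;> ring

lemma eq_zero_of_crs {v w z : Plane} (h : crs v w ≠ 0) (h1 : crs v z = 0) (h2 : crs w z = 0) :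
    z = 0 := by
  have h2' : crs z w = 0 := by simp only [crs] at *; linarith
  rw [eq_basis h z, h1, h2']; simp

/-- The line through `A` with direction vector `v`. -/
noncomputable def ln (A v : Plane) : Sub := AffineSubspace.mk' A (ℝ ∙ v)

@[simp] lemma direction_ln (A v : Plane) : (ln A v).direction = ℝ ∙ v := by simp [ln]

lemma self_mem_ln (A v : Plane) : A ∈ ln A v := AffineSubspace.self_mem_mk' _ _

lemma mem_ln_iff {A v X : Plane} : X ∈ ln A v ↔ ∃ r : ℝ, X = A + r • v := by
  rw [ln, AffineSubspace.mem_mk', Submodule.mem_span_singleton]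
  simp only [vsub_eq_sub]
  constructor
  · rintro ⟨r, h⟩; exact ⟨r, by rw [h]; abel⟩
  · rintro ⟨r, h⟩; exact ⟨r, by rw [h]; abel⟩

lemma mem_span_iff {v w : Plane} (hv : v ≠ 0) : w ∈ (ℝ ∙ v) ↔ crs v w = 0 := by
  rw [crs_eq_zero_iff hv, Submodule.mem_span_singleton]
  constructor <;> rintro ⟨r, h⟩ <;> exact ⟨r, h.symm⟩

lemma mem_span_orthogonal_iff {v w : Plane} : w ∈ (ℝ ∙ v)ᗮ ↔ dotp v w = 0 := by
  rw [Submodule.mem_orthogonal_singleton_iff_inner_right, inner_eq_dotp]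

lemma mem_ln {A v X : Plane} (hv : v ≠ 0) : X ∈ ln A v ↔ crs v (X - A) = 0 := by
  rw [ln, AffineSubspace.mem_mk', mem_span_iff hv, vsub_eq_sub]

lemma span_orthogonal {v : Plane} (hv : v ≠ 0) : (ℝ ∙ v)ᗮ = ℝ ∙ rot v := by
  ext w
  rw [mem_span_orthogonal_iff, dotp_eq_zero_iff hv, Submodule.mem_span_singleton]
  constructor <;> rintro ⟨r, h⟩ <;> exact ⟨r, h.symm⟩

lemma isLine_ln (A : Plane) {v : Plane} (hv : v ≠ 0) : IsLine (ln A v) :=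
  ⟨⟨A, self_mem_ln A v⟩, by rw [direction_ln]; exact finrank_span_singleton hv⟩

/-- A line can be written with any of its points as base point. -/
lemma IsLine.exists_ln {L : Sub} (hL : IsLine L) {A : Plane} (hA : A ∈ L) :
    ∃ v, v ≠ 0 ∧ L = ln A v := by
  obtain ⟨v, hv0, hv⟩ := finrank_eq_one_iff'.1 hL.2
  refine ⟨v, by simpa using hv0, ?_⟩
  suffices h : L.direction = ℝ ∙ (v : Plane) by rw [ln, ← h, AffineSubspace.mk'_eq hA]
  apply le_antisymm
  · intro w hw
    obtain ⟨c, hc⟩ := hv ⟨w, hw⟩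
    exact Submodule.mem_span_singleton.2 ⟨c, congrArg Subtype.val hc⟩
  · rw [Submodule.span_singleton_le_iff_mem]; exact v.2

lemma IsLine.exists_eq {L : Sub} (hL : IsLine L) : ∃ A v, v ≠ 0 ∧ L = ln A v := by
  obtain ⟨A, hA⟩ := hL.1
  exact ⟨A, hL.exists_ln hA⟩

lemma line_eq_ln (A B : Plane) : line[ℝ, A, B] = ln A (B - A) := by
  rw [ln, ← AffineSubspace.mk'_eq (left_mem_affineSpan_pair ℝ A B), direction_affineSpan,
    vectorSpan_pair_rev]
  simp

lemma isLine_line {A B : Plane} (h : A ≠ B) : IsLine line[ℝ, A, B] := by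
  rw [line_eq_ln]; exact isLine_ln _ (sub_ne_zero.2 h.symm)

lemma mem_line_iff {A B X : Plane} (h : A ≠ B) : X ∈ line[ℝ, A, B] ↔ crs (B - A) (X - A) = 0 := by
  rw [line_eq_ln, mem_ln (sub_ne_zero.2 h.symm)]

lemma parallelThrough_ln (X A v : Plane) : parallelThrough X (ln A v) = ln X v := by
  simp [parallelThrough, ln]

lemma perpThrough_ln (X A : Plane) {v : Plane} (hv : v ≠ 0) :
    perpThrough X (ln A v) = ln X (rot v) := by
  simp [perpThrough, ln, span_orthogonal hv]

lemma parallelThrough_line (X A B : Plane) :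
    parallelThrough X line[ℝ, A, B] = ln X (B - A) := by
  rw [line_eq_ln, parallelThrough_ln]

lemma mem_perpThrough_ln {X A v Y : Plane} : Y ∈ perpThrough X (ln A v) ↔ dotp v (Y - X) = 0 := by
  rw [perpThrough, AffineSubspace.mem_mk', direction_ln, mem_span_orthogonal_iff, vsub_eq_sub]

lemma perp_ln_iff (A B v w : Plane) : Perp (ln A v) (ln B w) ↔ dotp v w = 0 := by
  rw [Perp, direction_ln, direction_ln, Submodule.isOrtho_span]
  simp [inner_eq_dotp]

lemma ln_eq_ln_iff {A B v w : Plane} (hv : v ≠ 0) (hw : w ≠ 0) :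
    ln A v = ln B w ↔ crs v w = 0 ∧ crs v (B - A) = 0 := by
  constructor
  · intro h
    refine ⟨?_, ?_⟩
    · rw [← mem_span_iff hv, ← direction_ln A v, h, direction_ln]
      exact Submodule.mem_span_singleton_self w
    · rw [← mem_ln hv, h]; exact self_mem_ln _ _
  · rintro ⟨h1, h2⟩
    obtain ⟨r, rfl⟩ := (crs_eq_zero_iff hv).1 h1
    have hr : r ≠ 0 := by rintro rfl; simp at hw
    have : (ℝ ∙ v) = ℝ ∙ (r • v) := (Submodule.span_singleton_smul_eq (IsUnit.mk0 r hr) v).symm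
    rw [← AffineSubspace.mk'_eq ((mem_ln hv).2 h2), direction_ln, this]; rfl

lemma parallel_ln_iff {A B v w : Plane} (hv : v ≠ 0) (hw : w ≠ 0) :
    ln A v ∥ ln B w ↔ crs v w = 0 := by
  rw [AffineSubspace.parallel_iff_direction_eq_and_eq_bot_iff_eq_bot]
  constructor
  · rintro ⟨h, -⟩
    rw [direction_ln, direction_ln] at h
    rw [← mem_span_iff hv, h]; exact Submodule.mem_span_singleton_self w
  · intro h
    obtain ⟨r, rfl⟩ := (crs_eq_zero_iff hv).1 h
    have hr : r ≠ 0 := by rintro rfl; simp at hw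
    refine ⟨by simpa using (Submodule.span_singleton_smul_eq (IsUnit.mk0 r hr) v).symm, ?_⟩
    have h1 : ln A v ≠ ⊥ := fun h => AffineSubspace.notMem_bot ℝ Plane A (h ▸ self_mem_ln A v)
    have h2 : ln B (r • v) ≠ ⊥ := fun h => AffineSubspace.notMem_bot ℝ Plane B (h ▸ self_mem_ln _ _)
    simp [h1, h2]

lemma map_ln (α : Plane ≃ᵃ[ℝ] Plane) (A v : Plane) :
    (ln A v).map (α : Plane →ᵃ[ℝ] Plane) = ln (α A) (α.linear v) := by
  rw [ln, AffineSubspace.map_mk', ln, Submodule.map_span]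
  simp

lemma affinity_apply_add (α : Plane ≃ᵃ[ℝ] Plane) (A v : Plane) :
    α (A + v) = α A + α.linear v := by
  have := α.map_vadd A v
  simpa [add_comm] using this

lemma affinity_linear_sub (α : Plane ≃ᵃ[ℝ] Plane) (A B : Plane) :
    α.linear (A - B) = α A - α B := by
  have := affinity_apply_add α B (A - B)
  rw [add_sub_cancel] at this
  rw [this]; abel

lemma isMirror_ln {A v X Y : Plane} (hv : v ≠ 0) :
    IsMirror (ln A v) X Y ↔ crs v (midpoint ℝ X Y - A) = 0 ∧ dotp v (Y - X) = 0 := by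
  rw [IsMirror, mem_ln hv, direction_ln, mem_span_orthogonal_iff]

/-- Three points span a triangle of nonzero area if they are not collinear. -/
lemma crs_ne_zero_of_not_collinear {A B C : Plane} (h : ¬ Collinear ℝ {A, B, C}) :
    crs (B - A) (C - A) ≠ 0 := by
  intro h0
  apply h
  by_cases hAB : B - A = 0
  · rw [sub_eq_zero] at hAB
    subst hAB
    simp [collinear_pair]
  · obtain ⟨r, hr⟩ := (crs_eq_zero_iff hAB).1 h0
    rw [collinear_iff_of_mem (p₀ := A) (by simp)]
    refine ⟨B - A, ?_⟩
    intro p hp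
    simp only [mem_insert_iff, mem_singleton_iff] at hp
    rcases hp with rfl | rfl | rfl
    · exact ⟨0, by simp⟩
    · exact ⟨1, by simp⟩
    · exact ⟨r, by rw [← hr]; simp⟩


/-! ### Quadrics -/

/-- A polynomial `a x² + 2 b x y + c y² + 2 d x + 2 e y + f` of degree at most two in the two
coordinates of the plane. -/
@[ext] structure Quadric where
  (a b c d e f : ℝ)

namespace Quadric

/-- The value of the polynomial at a point. -/
def eval (Q : Quadric) (X : Plane) : ℝ :=
  Q.a * X 0 ^ 2 + 2 * Q.b * X 0 * X 1 + Q.c * X 1 ^ 2 + 2 * Q.d * X 0 + 2 * Q.e * X 1 + Q.f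

/-- The symmetric bilinear form given by the homogeneous part of degree two. -/
def form (Q : Quadric) (v w : Plane) : ℝ :=
  Q.a * v 0 * w 0 + Q.b * (v 0 * w 1 + v 1 * w 0) + Q.c * v 1 * w 1

/-- Half the derivative at `X` in the direction `v`. -/
def lin (Q : Quadric) (X v : Plane) : ℝ := Q.form X v + Q.d * v 0 + Q.e * v 1

/-- The determinant of the part of degree two: positive for ellipses, zero for parabolas and
negative for hyperbolas. -/
def disc (Q : Quadric) : ℝ := Q.a * Q.c - Q.b ^ 2

/-- The determinant of the symmetric `3 × 3` matrix of the quadric. -/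
def det (Q : Quadric) : ℝ :=
  Q.a * (Q.c * Q.f - Q.e ^ 2) - Q.b * (Q.b * Q.f - Q.e * Q.d) + Q.d * (Q.b * Q.e - Q.c * Q.d)

/-- The linear combination `s Q + t R`. -/
def comb (s t : ℝ) (Q R : Quadric) : Quadric :=
  ⟨s * Q.a + t * R.a, s * Q.b + t * R.b, s * Q.c + t * R.c, s * Q.d + t * R.d,
    s * Q.e + t * R.e, s * Q.f + t * R.f⟩

/-- The multiple `s Q`. -/
def smul (s : ℝ) (Q : Quadric) : Quadric :=
  ⟨s * Q.a, s * Q.b, s * Q.c, s * Q.d, s * Q.e, s * Q.f⟩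

/-- The product of the equations of the lines through `A` along `u` and through `B` along `w`. -/
noncomputable def pair (A u B w : Plane) : Quadric where
  a := u 1 * w 1
  b := -(u 1 * w 0 + u 0 * w 1) / 2
  c := u 0 * w 0
  d := -(u 1 * (w 1 * B 0 - w 0 * B 1) + w 1 * (u 1 * A 0 - u 0 * A 1)) / 2
  e := (u 0 * (w 1 * B 0 - w 0 * B 1) + w 0 * (u 1 * A 0 - u 0 * A 1)) / 2
  f := (u 1 * A 0 - u 0 * A 1) * (w 1 * B 0 - w 0 * B 1)

variable (Q R : Quadric)

lemma eval_pair (A u B w X : Plane) : (pair A u B w).eval X = crs u (X - A) * crs w (X - B) := by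
  simp only [eval, pair, crs, PiLp.sub_apply]; ring

lemma eval_comb (s t : ℝ) (X : Plane) : (comb s t Q R).eval X = s * Q.eval X + t * R.eval X := by
  simp only [eval, comb]; ring

lemma form_comb (s t : ℝ) (v w : Plane) :
    (comb s t Q R).form v w = s * Q.form v w + t * R.form v w := by
  simp only [form, comb]; ring

lemma eval_smul (s : ℝ) (X : Plane) : (smul s Q).eval X = s * Q.eval X := by
  simp only [eval, smul]; ring

lemma form_smul (s : ℝ) (v w : Plane) : (smul s Q).form v w = s * Q.form v w := by
  simp only [form, smul]; ring

lemma lin_smul (s : ℝ) (v w : Plane) : (smul s Q).lin v w = s * Q.lin v w := by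
  simp only [form, smul, lin]; ring

lemma disc_smul (s : ℝ) : (smul s Q).disc = s ^ 2 * Q.disc := by
  simp only [disc, smul]; ring

lemma det_smul (s : ℝ) : (smul s Q).det = s ^ 3 * Q.det := by
  simp only [det, smul]; ring

lemma eval_add (X v : Plane) : Q.eval (X + v) = Q.eval X + 2 * Q.lin X v + Q.form v v := by
  simp only [eval, lin, form, PiLp.add_apply]; ring

lemma eval_eq (X Y : Plane) :
    Q.eval Y = Q.eval X + 2 * Q.lin X (Y - X) + Q.form (Y - X) (Y - X) := by
  rw [← eval_add, add_sub_cancel]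

lemma lin_add (X v w : Plane) : Q.lin (X + v) w = Q.lin X w + Q.form v w := by
  simp only [lin, form, PiLp.add_apply]; ring

lemma lin_eq (X Y w : Plane) : Q.lin Y w = Q.lin X w + Q.form (Y - X) w := by
  rw [← lin_add, add_sub_cancel]

lemma lin_add_right (X v w : Plane) : Q.lin X (v + w) = Q.lin X v + Q.lin X w := by
  simp only [lin, form, PiLp.add_apply]; ring

lemma lin_smul_right (X v : Plane) (r : ℝ) : Q.lin X (r • v) = r * Q.lin X v := by
  simp only [lin, form, PiLp.smul_apply, smul_eq_mul]; ring

lemma form_comm (v w : Plane) : Q.form v w = Q.form w v := by simp only [form]; ring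

lemma form_add_left (v v' w : Plane) : Q.form (v + v') w = Q.form v w + Q.form v' w := by
  simp only [form, PiLp.add_apply]; ring

lemma form_add_right (v w w' : Plane) : Q.form v (w + w') = Q.form v w + Q.form v w' := by
  simp only [form, PiLp.add_apply]; ring

lemma form_sub_left (v v' w : Plane) : Q.form (v - v') w = Q.form v w - Q.form v' w := by
  simp only [form, PiLp.sub_apply]; ring

lemma form_sub_right (v w w' : Plane) : Q.form v (w - w') = Q.form v w - Q.form v w' := by
  simp only [form, PiLp.sub_apply]; ring

lemma form_smul_left (r : ℝ) (v w : Plane) : Q.form (r • v) w = r * Q.form v w := by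
  simp only [form, PiLp.smul_apply, smul_eq_mul]; ring

lemma form_smul_right (r : ℝ) (v w : Plane) : Q.form v (r • w) = r * Q.form v w := by
  simp only [form, PiLp.smul_apply, smul_eq_mul]; ring

/-- The sign of the discriminant can be read off in any basis. -/
lemma disc_basis (v w : Plane) :
    Q.form v v * Q.form w w - Q.form v w ^ 2 = crs v w ^ 2 * Q.disc := by
  simp only [form, crs, disc]; ring

/-- The determinant of the quadric in the affine coordinates with origin `O` and basis `v, w`. -/
lemma det_basis (O v w : Plane) :
    Q.form v v * (Q.form w w * Q.eval O - Q.lin O w ^ 2)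
      - Q.form v w * (Q.form v w * Q.eval O - Q.lin O w * Q.lin O v)
      + Q.lin O v * (Q.form v w * Q.lin O w - Q.form w w * Q.lin O v) = crs v w ^ 2 * Q.det := by
  simp only [form, lin, eval, crs, det]; ring

variable {Q R}

lemma eq_zero_of_basis {O v w : Plane} (h : crs v w ≠ 0) (h1 : Q.form v v = 0)
    (h2 : Q.form v w = 0) (h3 : Q.form w w = 0) (h4 : Q.lin O v = 0) (h5 : Q.lin O w = 0)
    (h6 : Q.eval O = 0) : Q = ⟨0, 0, 0, 0, 0, 0⟩ := by
  have h' : crs v w ^ 2 ≠ 0 := pow_ne_zero 2 h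
  have ha : Q.a = 0 := by
    apply (mul_eq_zero.1 (_ : crs v w ^ 2 * Q.a = 0)).resolve_left h'
    have : crs v w ^ 2 * Q.a = w 1 ^ 2 * Q.form v v - 2 * w 1 * v 1 * Q.form v w
      + v 1 ^ 2 * Q.form w w := by simp only [crs, form]; ring
    rw [this, h1, h2, h3]; ring
  have hb : Q.b = 0 := by
    apply (mul_eq_zero.1 (_ : crs v w ^ 2 * Q.b = 0)).resolve_left h'
    have : crs v w ^ 2 * Q.b = -w 1 * w 0 * Q.form v v + (w 1 * v 0 + v 1 * w 0) * Q.form v w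
      - v 1 * v 0 * Q.form w w := by simp only [crs, form]; ring
    rw [this, h1, h2, h3]; ring
  have hc : Q.c = 0 := by
    apply (mul_eq_zero.1 (_ : crs v w ^ 2 * Q.c = 0)).resolve_left h'
    have : crs v w ^ 2 * Q.c = w 0 ^ 2 * Q.form v v - 2 * w 0 * v 0 * Q.form v w
      + v 0 ^ 2 * Q.form w w := by simp only [crs, form]; ring
    rw [this, h1, h2, h3]; ring
  simp only [lin, form, ha, hb, hc] at h4 h5
  have hd : Q.d = 0 := by
    apply (mul_eq_zero.1 (_ : crs v w * Q.d = 0)).resolve_left h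
    simp only [crs]; linear_combination w 1 * h4 - v 1 * h5
  have he : Q.e = 0 := by
    apply (mul_eq_zero.1 (_ : crs v w * Q.e = 0)).resolve_left h
    simp only [crs]; linear_combination v 0 * h5 - w 0 * h4
  have hf : Q.f = 0 := by simpa [eval, ha, hb, hc, hd, he] using h6
  ext <;> assumption

/-- A nondegenerate quadric contains no line. -/
lemma form_ne_zero_or_lin_ne_zero (hQ : Q.det ≠ 0) {X v : Plane} (hv : v ≠ 0)
    (hX : Q.eval X = 0) (h : Q.form v v = 0) : Q.lin X v ≠ 0 := by
  intro hl
  have := Q.det_basis X v (rot v)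
  rw [h, hl, hX] at this
  have h2 : crs v (rot v) = dotp v v := by simp [crs, dotp]
  rw [h2] at this
  apply mul_ne_zero (pow_ne_zero 2 (dotp_self_pos hv).ne') hQ
  rw [← this]; ring

/-- The direction of a chord is not isotropic. -/
lemma form_chord_ne_zero (hQ : Q.det ≠ 0) {X Y : Plane} (h : X ≠ Y)
    (hX : Q.eval X = 0) (hY : Q.eval Y = 0) : Q.form (Y - X) (Y - X) ≠ 0 := by
  intro h0
  apply form_ne_zero_or_lin_ne_zero hQ (sub_ne_zero.2 h.symm) hX h0
  rw [Q.eval_eq X Y, hX, h0] at hY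
  linarith

/-- A quadric through `A, B, C, D, E` that contains the line `AB` vanishes: the other factor would
be the equation of a line through `C`, `D` and `E`. -/
lemma eq_zero_of_line {A B C D E : Plane} (hC : crs (B - A) (C - A) ≠ 0)
    (hD : crs (B - A) (D - A) ≠ 0) (hE : crs (B - A) (E - A) ≠ 0)
    (hCDE : crs (D - C) (E - C) ≠ 0) (qA : Q.eval A = 0) (qB : Q.eval B = 0) (qC : Q.eval C = 0)
    (qD : Q.eval D = 0) (qE : Q.eval E = 0) (h : Q.form (B - A) (B - A) = 0) :
    Q = ⟨0, 0, 0, 0, 0, 0⟩ := by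
  have hl : Q.lin A (B - A) = 0 := by
    rw [Q.eval_eq A B, qA, h] at qB; linarith
  rw [Q.eval_eq A C, qA] at qC
  have key : ∀ X : Plane, crs (B - A) (X - A) ≠ 0 → Q.eval X = 0 → ∃ s r : ℝ,
      X - A = s • (B - A) + r • (C - A) ∧ Q.lin A (C - A) * 2 + s * (2 * Q.form (B - A) (C - A))
        + r * Q.form (C - A) (C - A) = 0 := by
    intro X hX qX
    refine ⟨_, _, eq_basis hC (X - A), ?_⟩
    have hr : crs (B - A) (X - A) / crs (B - A) (C - A) ≠ 0 := div_ne_zero hX hC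
    generalize hr' : crs (B - A) (X - A) / crs (B - A) (C - A) = r at *
    have hb := eq_basis hC (X - A)
    rw [hr'] at hb
    generalize crs (X - A) (C - A) / crs (B - A) (C - A) = s at *
    rw [Q.eval_eq A X, qA, hb] at qX
    simp only [lin_add_right, lin_smul_right, form_add_left, form_add_right, form_smul_left,
      form_smul_right, hl, h, Q.form_comm (C - A) (B - A)] at qX
    apply (mul_eq_zero.1 (_ : r * _ = 0)).resolve_left hr
    linear_combination qX
  obtain ⟨s, r, h1, h2⟩ := key D hD qD
  obtain ⟨s', r', h1', h2'⟩ := key E hE qE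
  have hdet : s * (r' - 1) - s' * (r - 1) ≠ 0 := by
    intro h0
    apply hCDE
    have e1 : D - C = s • (B - A) + (r - 1) • (C - A) := by
      rw [sub_smul, one_smul, ← add_sub_assoc, ← h1]; abel
    have e2 : E - C = s' • (B - A) + (r' - 1) • (C - A) := by
      rw [sub_smul, one_smul, ← add_sub_assoc, ← h1']; abel
    rw [e1, e2]
    have : crs (s • (B - A) + (r - 1) • (C - A)) (s' • (B - A) + (r' - 1) • (C - A))
      = (s * (r' - 1) - s' * (r - 1)) * crs (B - A) (C - A) := by
      simp only [crs, PiLp.add_apply, PiLp.smul_apply, smul_eq_mul]; ring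
    rw [this, h0, zero_mul]
  have hn : Q.form (C - A) (C - A) = 0 := by
    apply (mul_eq_zero.1 (_ : (s * (r' - 1) - s' * (r - 1)) * _ = 0)).resolve_left hdet
    linear_combination s * h2' - s' * h2 - (s - s') * qC
  have hm : Q.form (B - A) (C - A) = 0 := by
    apply (mul_eq_zero.1 (_ : (s * (r' - 1) - s' * (r - 1)) * _ = 0)).resolve_left hdet
    linear_combination (r' - 1) / 2 * h2 - (r - 1) / 2 * h2' - (r' - r) / 2 * qC
  exact eq_zero_of_basis hC h hm hn hl (by rw [hn] at qC; linarith) qA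

end Quadric

/-- No three of the points are collinear, in terms of signed areas. -/
def General (P : Fin 5 → Plane) : Prop :=
  ∀ i j k, i ≠ j → i ≠ k → j ≠ k → crs (P j - P i) (P k - P i) ≠ 0

lemma General.ne {P : Fin 5 → Plane} (hP : General P) {i j : Fin 5} (h : i ≠ j) : P i ≠ P j := by
  obtain ⟨k, hk⟩ : ∃ k : Fin 5, i ≠ k ∧ j ≠ k := by revert i j; decide
  intro he
  apply hP i j k h hk.1 hk.2
  rw [he]; simp [crs]

lemma General.comp {P : Fin 5 → Plane} (hP : General P) {σ : Fin 5 → Fin 5}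
    (hσ : Function.Injective σ) : General (P ∘ σ) :=
  fun _ _ _ h1 h2 h3 => hP _ _ _ (hσ.ne h1) (hσ.ne h2) (hσ.ne h3)

namespace Quadric

variable {P : Fin 5 → Plane} {Q R : Quadric}

/-- A nonzero quadric through five points, no three of them collinear, is nondegenerate. -/
lemma det_ne_zero (hP : General P) (hQ : ∀ i, Q.eval (P i) = 0)
    (h0 : Q ≠ ⟨0, 0, 0, 0, 0, 0⟩) : Q.det ≠ 0 := by
  -- the directions of the sides of the triangle `P 0 P 1 P 2` are not isotropic
  have n1 : Q.form (P 1 - P 0) (P 1 - P 0) ≠ 0 := fun h => h0 <|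
    eq_zero_of_line (hP 0 1 2 (by decide) (by decide) (by decide))
      (hP 0 1 3 (by decide) (by decide) (by decide)) (hP 0 1 4 (by decide) (by decide) (by decide))
      (hP 2 3 4 (by decide) (by decide) (by decide)) (hQ 0) (hQ 1) (hQ 2) (hQ 3) (hQ 4) h
  have n2 : Q.form (P 2 - P 0) (P 2 - P 0) ≠ 0 := fun h => h0 <|
    eq_zero_of_line (hP 0 2 1 (by decide) (by decide) (by decide))
      (hP 0 2 3 (by decide) (by decide) (by decide)) (hP 0 2 4 (by decide) (by decide) (by decide))
      (hP 1 3 4 (by decide) (by decide) (by decide)) (hQ 0) (hQ 2) (hQ 1) (hQ 3) (hQ 4) h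
  have n3 : Q.form (P 2 - P 1) (P 2 - P 1) ≠ 0 := fun h => h0 <|
    eq_zero_of_line (hP 1 2 0 (by decide) (by decide) (by decide))
      (hP 1 2 3 (by decide) (by decide) (by decide)) (hP 1 2 4 (by decide) (by decide) (by decide))
      (hP 0 3 4 (by decide) (by decide) (by decide)) (hQ 1) (hQ 2) (hQ 0) (hQ 3) (hQ 4) h
  intro hd
  -- in the affine basis given by the triangle, `-4` times the determinant is the product of the
  -- values of the form on the three sides
  have h := Q.det_basis (P 0) (P 1 - P 0) (P 2 - P 0)
  have e1 := Q.eval_eq (P 0) (P 1)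
  have e2 := Q.eval_eq (P 0) (P 2)
  rw [hQ, hQ] at e1 e2
  have e3 : Q.form (P 2 - P 1) (P 2 - P 1) = Q.form (P 1 - P 0) (P 1 - P 0)
      - 2 * Q.form (P 1 - P 0) (P 2 - P 0) + Q.form (P 2 - P 0) (P 2 - P 0) := by
    simp only [form, PiLp.sub_apply]; ring
  rw [hQ, hd] at h
  apply mul_ne_zero (mul_ne_zero n1 n2) n3
  rw [e3]
  rw [show Q.lin (P 0) (P 1 - P 0) = -Q.form (P 1 - P 0) (P 1 - P 0) / 2 by linarith,
    show Q.lin (P 0) (P 2 - P 0) = -Q.form (P 2 - P 0) (P 2 - P 0) / 2 by linarith] at h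
  linear_combination -4 * h

/-- A quadric through five points, no three of them collinear, is unique up to a factor. -/
lemma exists_smul (hP : General P) (hQ : ∀ i, Q.eval (P i) = 0) (hR : ∀ i, R.eval (P i) = 0)
    (hd : Q.det ≠ 0) : ∃ s, R = smul s Q := by
  have n1 := form_chord_ne_zero hd (hP.ne (by decide : (0 : Fin 5) ≠ 1)) (hQ 0) (hQ 1)
  -- the member of the pencil of `Q` and `R` that contains the line `P 0 P 1` vanishes
  set s := R.form (P 1 - P 0) (P 1 - P 0) / Q.form (P 1 - P 0) (P 1 - P 0) with hs
  have hv : ∀ i, (comb 1 (-s) R Q).eval (P i) = 0 := fun i => by rw [eval_comb, hQ, hR]; ring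
  have h := eq_zero_of_line (Q := comb 1 (-s) R Q) (hP 0 1 2 (by decide) (by decide) (by decide))
      (hP 0 1 3 (by decide) (by decide) (by decide)) (hP 0 1 4 (by decide) (by decide) (by decide))
      (hP 2 3 4 (by decide) (by decide) (by decide)) (hv 0) (hv 1) (hv 2) (hv 3) (hv 4)
      (by rw [form_comb, hs]; field_simp; ring)
  refine ⟨s, ?_⟩
  simp only [comb, Quadric.mk.injEq] at h
  obtain ⟨h1, h2, h3, h4, h5, h6⟩ := h
  ext <;> simp only [smul] <;> linarith

lemma exists_smul_ne (hP : General P) (hQ : ∀ i, Q.eval (P i) = 0) (hR : ∀ i, R.eval (P i) = 0)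
    (hd : Q.det ≠ 0) (hd' : R.det ≠ 0) : ∃ s, s ≠ 0 ∧ R = smul s Q := by
  obtain ⟨s, rfl⟩ := exists_smul hP hQ hR hd
  refine ⟨s, ?_, rfl⟩
  rintro rfl
  rw [det_smul] at hd'
  simp at hd'

end Quadric

/-! ### Pascal's construction -/

/-- Homogeneous coordinates of a point. -/
def homog (X : Plane) : Fin 3 → ℝ := ![X 0, X 1, 1]

/-- Homogeneous coordinates of the line through `A` with direction vector `v`. -/
def covec (A v : Plane) : Fin 3 → ℝ := ![-v 1, v 0, v 1 * A 0 - v 0 * A 1]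

open Matrix in
lemma covec_dot (A v X : Plane) : covec A v ⬝ᵥ homog X = crs v (X - A) := by
  simp [covec, homog, crs]; ring

open Matrix in
/-- Two vectors orthogonal to `p` have a cross product parallel to `p`: there is only one line
through two different points. -/
lemma cross_eq_smul {p x y : Fin 3 → ℝ} (hp : p ≠ 0) (hx : p ⬝ᵥ x = 0) (hy : p ⬝ᵥ y = 0) :
    ∃ r : ℝ, x ⨯₃ y = r • p := by
  have hpp : p ⬝ᵥ p ≠ 0 := fun h => hp (dotProduct_self_eq_zero.1 h)
  refine ⟨(x ⨯₃ y) ⬝ᵥ p / p ⬝ᵥ p, ?_⟩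
  simp only [vec3_dotProduct, cross_apply] at *
  ext i
  fin_cases i <;> (simp; rw [div_mul_eq_mul_div, eq_div_iff hpp])
  · linear_combination (p 1 * y 2 - p 2 * y 1) * hx - (p 1 * x 2 - p 2 * x 1) * hy
  · linear_combination (p 2 * y 0 - p 0 * y 2) * hx - (p 2 * x 0 - p 0 * x 2) * hy
  · linear_combination (p 0 * y 1 - p 1 * y 0) * hx - (p 0 * x 1 - p 1 * x 0) * hy

open Matrix in
/-- All homogeneous line coordinates but those of the line at infinity are given by a line of the
plane. -/
lemma exists_covec {p : Fin 3 → ℝ} (hp : p 0 ≠ 0 ∨ p 1 ≠ 0) : ∃ A v, v ≠ 0 ∧ covec A v = p := by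
  have hd : p 0 ^ 2 + p 1 ^ 2 ≠ 0 := by
    rcases hp with h | h <;> positivity
  refine ⟨!₂[-p 2 * p 0 / (p 0 ^ 2 + p 1 ^ 2), -p 2 * p 1 / (p 0 ^ 2 + p 1 ^ 2)],
    !₂[p 1, -p 0], ?_, ?_⟩
  · intro h
    rw [plane_ext_iff] at h
    simp at h
    rcases hp with h' | h'
    · exact h' h.2
    · exact h' h.1
  · ext i
    fin_cases i <;> simp [covec]
    field_simp
    ring

/-- Two lines that are not parallel meet. -/
lemma exists_mem_mem {A v B w : Plane} (h : crs v w ≠ 0) : ∃ X, X ∈ ln A v ∧ X ∈ ln B w := by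
  refine ⟨A + (crs (B - A) w / crs v w) • v, mem_ln_iff.2 ⟨_, rfl⟩,
    mem_ln_iff.2 ⟨-(crs v (B - A) / crs v w), ?_⟩⟩
  have := eq_basis h (B - A)
  rw [neg_smul, ← sub_eq_add_neg, eq_sub_iff_add_eq, add_assoc, ← this]; abel

lemma ne_zero_left_of_crs {v w : Plane} (h : crs v w ≠ 0) : v ≠ 0 := by
  rintro rfl; simp [crs] at h

lemma ne_zero_right_of_crs {v w : Plane} (h : crs v w ≠ 0) : w ≠ 0 := by
  rintro rfl; simp [crs] at h

open Matrix in
/-- Concurrency in the projective plane is the vanishing of the determinant of the line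
coordinates. -/
lemma concurrent_iff {A B C u v w : Plane} (hu : u ≠ 0) (hv : v ≠ 0) (hw : w ≠ 0) :
    Concurrent (ln A u) (ln B v) (ln C w) ↔ covec A u ⬝ᵥ (covec B v ⨯₃ covec C w) = 0 := by
  constructor
  · rintro (⟨X, h1, h2, h3⟩ | ⟨h1, h2⟩)
    · rw [mem_ln hu] at h1
      rw [mem_ln hv] at h2
      rw [mem_ln hw] at h3
      simp only [covec, cross_apply, vec3_dotProduct, crs, PiLp.sub_apply] at *
      simp
      linear_combination (v 0 * w 1 - v 1 * w 0) * h1 + (w 0 * u 1 - w 1 * u 0) * h2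
        + (u 0 * v 1 - u 1 * v 0) * h3
    · rw [parallel_ln_iff hu hv, crs_eq_zero_iff hu] at h1
      rw [parallel_ln_iff hu hw, crs_eq_zero_iff hu] at h2
      obtain ⟨r, rfl⟩ := h1
      obtain ⟨s, rfl⟩ := h2
      simp [covec, cross_apply]
      ring
  · intro h
    by_cases h1 : crs u v = 0
    · by_cases h2 : crs u w = 0
      · exact Or.inr ⟨(parallel_ln_iff hu hv).2 h1, (parallel_ln_iff hu hw).2 h2⟩
      · left
        obtain ⟨X, hX1, hX2⟩ := exists_mem_mem (A := A) (B := C) h2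
        refine ⟨X, hX1, ?_, hX2⟩
        rw [mem_ln hu] at hX1
        rw [mem_ln hw] at hX2
        rw [mem_ln hv]
        apply (mul_eq_zero.1 (_ : crs u w * _ = 0)).resolve_left h2
        simp only [covec, cross_apply, vec3_dotProduct, crs, PiLp.sub_apply] at *
        simp at h
        linear_combination (v 0 * w 1 - v 1 * w 0) * hX1 - h + (u 0 * v 1 - u 1 * v 0) * hX2
    · left
      obtain ⟨X, hX1, hX2⟩ := exists_mem_mem (A := A) (B := B) h1
      refine ⟨X, hX1, hX2, ?_⟩
      rw [mem_ln hu] at hX1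
      rw [mem_ln hv] at hX2
      rw [mem_ln hw]
      apply (mul_eq_zero.1 (_ : crs u v * _ = 0)).resolve_left h1
      simp only [covec, cross_apply, vec3_dotProduct, crs, PiLp.sub_apply] at *
      simp at h
      linear_combination h - (v 0 * w 1 - v 1 * w 0) * hX1 - (w 0 * u 1 - w 1 * u 0) * hX2

/-- The point `X` of Pascal's construction, in homogeneous coordinates. -/
def pascalX (A B D E : Plane) : Fin 3 → ℝ :=
  crossProduct (covec A (B - A)) (covec D (E - D))

/-- The point `Y` of Pascal's construction on the line through `A` along `v`, in homogeneous
coordinates. -/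
def pascalY (A C D v : Plane) : Fin 3 → ℝ := crossProduct (covec C (D - C)) (covec A v)

/-- The Pascal line, in homogeneous coordinates. -/
def pascalP (A B C D E v : Plane) : Fin 3 → ℝ :=
  crossProduct (pascalX A B D E) (pascalY A C D v)

/-- The point `Z` of Pascal's construction, in homogeneous coordinates. -/
def pascalZ (A B C D E v : Plane) : Fin 3 → ℝ :=
  crossProduct (covec B (C - B)) (pascalP A B C D E v)

/-- The conic through five points. -/
noncomputable def pascalConic (A B C D E : Plane) : Quadric :=
  Quadric.comb (crs (D - C) (A - C) * crs (D - B) (E - B))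
    (crs (B - A) (D - A) * crs (D - C) (E - C))
    (Quadric.pair A (B - A) C (E - C)) (Quadric.pair B (E - B) C (A - C))

open Matrix in
lemma pascalX_eq (A B D E : Plane) : pascalX A B D E =
    crs (B - A) (E - A) • homog D - crs (B - A) (D - A) • homog E := by
  ext i
  fin_cases i <;> simp [pascalX, covec, homog, cross_apply, crs] <;> ring

open Matrix in
lemma pascalY_eq (A C D v : Plane) : pascalY A C D v =
    crs (D - C) v • homog A - crs (D - C) (A - C) • ![v 0, v 1, 0] := by
  ext i
  fin_cases i <;> simp [pascalY, covec, homog, cross_apply, crs] <;> ring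

open Matrix in
lemma homog_B_dot_pascalP (A B C D E v : Plane) : homog B ⬝ᵥ pascalP A B C D E v =
    -(crs (D - C) (A - C) * crs (D - B) (E - B) * crs (B - A) v) := by
  rw [pascalP, pascalX_eq, pascalY_eq]
  simp [homog, cross_apply, crs]
  ring

open Matrix in
lemma homog_C_dot_pascalP (A B C D E v : Plane) : homog C ⬝ᵥ pascalP A B C D E v =
    crs (B - A) (D - A) * crs (D - C) (E - C) * crs (A - C) v := by
  rw [pascalP, pascalX_eq, pascalY_eq]
  simp [homog, cross_apply, crs]
  ring

open Matrix in
lemma pascalZ_eq (A B C D E v : Plane) : pascalZ A B C D E v =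
    (homog B ⬝ᵥ pascalP A B C D E v) • homog C - (homog C ⬝ᵥ pascalP A B C D E v) • homog B := by
  have e1 : covec B (C - B) = homog B ⨯₃ homog C := by
    ext i; fin_cases i <;> simp [covec, homog, cross_apply] <;> ring
  rw [pascalZ, e1]
  generalize pascalP A B C D E v = p
  ext i; fin_cases i <;> simp only [Pi.sub_apply, Pi.smul_apply, cross_apply, vec3_dotProduct,
    homog] <;> simp <;> ring

open Matrix in
/-- Pascal's theorem as a polynomial identity. -/
lemma pascal_identity (A B C D E v : Plane) (t : ℝ) :
    (crossProduct (pascalZ A B C D E v) (homog E)) ⬝ᵥ homog (A + t • v) =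
      -(2 * (pascalConic A B C D E).lin A v + t * (pascalConic A B C D E).form v v) := by
  rw [pascalZ_eq, homog_B_dot_pascalP, homog_C_dot_pascalP, pascalConic]
  generalize crs (D - C) (A - C) * crs (D - B) (E - B) = k
  generalize crs (B - A) (D - A) * crs (D - C) (E - C) = l
  simp [homog, cross_apply, Quadric.lin, Quadric.form, Quadric.comb, Quadric.pair, crs]
  ring

lemma pascalConic_eval {A B C D E : Plane} :
    (pascalConic A B C D E).eval A = 0 ∧ (pascalConic A B C D E).eval B = 0 ∧
    (pascalConic A B C D E).eval C = 0 ∧ (pascalConic A B C D E).eval D = 0 ∧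
    (pascalConic A B C D E).eval E = 0 := by
  simp only [pascalConic, Quadric.eval_comb, Quadric.eval_pair, crs, PiLp.sub_apply]
  refine ⟨?_, ?_, ?_, ?_, ?_⟩ <;> ring

lemma crs_midpoint (u A B Y : Plane) :
    crs u (midpoint ℝ A B - Y) = (crs u (A - Y) + crs u (B - Y)) / 2 := by
  simp [crs]; ring

lemma pascalConic_ne_zero {A B C D E : Plane} (h1 : crs (B - A) (D - A) ≠ 0)
    (h2 : crs (D - C) (E - C) ≠ 0) (h3 : crs (B - A) (E - A) ≠ 0) (h4 : crs (B - A) (C - A) ≠ 0) :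
    pascalConic A B C D E ≠ ⟨0, 0, 0, 0, 0, 0⟩ := by
  intro h
  have h0 : (pascalConic A B C D E).eval (midpoint ℝ A B) = 0 := by rw [h]; simp [Quadric.eval]
  apply mul_ne_zero (mul_ne_zero h1 h2) (mul_ne_zero h3 h4)
  have : (pascalConic A B C D E).eval (midpoint ℝ A B) =
    crs (B - A) (D - A) * crs (D - C) (E - C) *
      (crs (E - B) (A - B) / 2 * (crs (A - C) (B - C) / 2)) := by
    simp only [pascalConic, Quadric.eval_comb, Quadric.eval_pair, crs_midpoint]
    simp [crs]; ring
  rw [this] at h0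
  have e1 : crs (E - B) (A - B) = -crs (B - A) (E - A) * -1 := by simp [crs]; ring
  have e2 : crs (A - C) (B - C) = crs (B - A) (C - A) := by simp [crs]; ring
  rw [e1, e2] at h0
  linarith

open Matrix in
/-- Pascal's construction on the line through `A` along `v` gives exactly the second common point
`A + t v` of this line and of the conic through the five points. -/
lemma pascalSixth_iff {A B C D E v S : Plane} (hv : v ≠ 0) (hABC : crs (B - A) (C - A) ≠ 0)
    (hABD : crs (B - A) (D - A) ≠ 0) (hACD : crs (D - C) (A - C) ≠ 0)
    (hBCE : crs (C - B) (E - B) ≠ 0)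
    (hBDE : crs (E - D) (B - D) ≠ 0) (hCDE : crs (D - C) (E - C) ≠ 0) :
    PascalSixth A B C D E (ln A v) S ↔ ∃ t : ℝ, S = A + t • v ∧
      2 * (pascalConic A B C D E).lin A v + t * (pascalConic A B C D E).form v v = 0 := by
  have hAB : B - A ≠ 0 := ne_zero_left_of_crs hABC
  have hDC : D - C ≠ 0 := ne_zero_left_of_crs hCDE
  have hED : E - D ≠ 0 := ne_zero_left_of_crs hBDE
  have hCB : C - B ≠ 0 := ne_zero_left_of_crs hBCE
  simp only [PascalSixth, line_eq_ln]
  constructor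
  · rintro ⟨q, hq, hE, hS, hSl, h⟩
    obtain ⟨t, rfl⟩ := mem_ln_iff.1 hSl
    refine ⟨t, rfl, ?_⟩
    obtain ⟨u, hu, rfl⟩ := hq.exists_ln hE
    rw [← neg_eq_zero, ← pascal_identity]
    have hq0 : covec E u ≠ 0 := by
      intro h0
      have a := congrFun h0 0
      have b := congrFun h0 1
      simp [covec] at a b
      exact hu (plane_ext (by simpa using b) (by simpa using a))
    -- homogeneous coordinates of the Pascal line, which may be the line at infinity `![0, 0, 1]`
    obtain ⟨p, hp0, h1, h2, h3⟩ : ∃ p : Fin 3 → ℝ, p ≠ 0 ∧ p ⬝ᵥ pascalX A B D E = 0 ∧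
        p ⬝ᵥ pascalY A C D v = 0 ∧ covec E u ⬝ᵥ (covec B (C - B) ⨯₃ p) = 0 := by
      rcases h with ⟨p, hp, h1, h2, h3⟩ | ⟨h1, h2, h3⟩
      · obtain ⟨G, g, hg, rfl⟩ := hp.exists_eq
        rw [concurrent_iff hg hAB hED] at h1
        rw [concurrent_iff hg hDC hv] at h2
        rw [concurrent_iff hu hCB hg] at h3
        refine ⟨covec G g, ?_, h1, h2, h3⟩
        intro h0
        have a := congrFun h0 0
        have b := congrFun h0 1
        simp [covec] at a b
        exact hg (plane_ext (by simpa using b) (by simpa using a))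
      · rw [parallel_ln_iff hAB hED] at h1
        rw [parallel_ln_iff hDC hv] at h2
        rw [parallel_ln_iff hu hCB] at h3
        refine ⟨![0, 0, 1], ?_, ?_, ?_, ?_⟩
        · intro h0
          have := congrFun h0 2
          simp at this
        · simp [pascalX, covec, cross_apply]
          simp [crs] at h1
          linarith
        · simp [pascalY, covec, cross_apply]
          simp [crs] at h2
          linarith
        · simp [covec, cross_apply]
          simp [crs] at h3
          linarith
    obtain ⟨k, hk⟩ := cross_eq_smul hp0 h1 h2
    have hZ : covec E u ⬝ᵥ pascalZ A B C D E v = 0 := by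
      rw [pascalZ, pascalP, hk, LinearMap.map_smul, dotProduct_smul, h3, smul_zero]
    have hE' : covec E u ⬝ᵥ homog E = 0 := by rw [covec_dot]; simp [crs]
    obtain ⟨l, hl⟩ := cross_eq_smul hq0 hZ hE'
    rw [hl, smul_dotProduct, covec_dot, (mem_ln hu).1 hS, smul_zero]
  · rintro ⟨t, rfl, h⟩
    rw [← neg_eq_zero, ← pascal_identity] at h
    have hXC : covec C (D - C) ⬝ᵥ pascalX A B D E =
        -(crs (B - A) (D - A) * crs (D - C) (E - C)) := by
      rw [pascalX_eq, dotProduct_sub, dotProduct_smul, dotProduct_smul, covec_dot, covec_dot]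
      simp only [smul_eq_mul, crs, PiLp.sub_apply]; ring
    have hYC : covec C (D - C) ⬝ᵥ pascalY A C D v = 0 := dot_self_cross _ _
    -- `X ≠ Y` as `Y` is on the line `C D` and `X` is not
    have hp0 : pascalP A B C D E v ≠ 0 := by
      intro h0
      have hY0 : pascalY A C D v ≠ 0 := by
        intro hy
        rw [pascalY_eq] at hy
        have a := congrFun hy 0
        have b := congrFun hy 1
        have c := congrFun hy 2
        simp [homog] at a b c
        rw [c] at a b
        simp [hACD] at a b
        exact hv (plane_ext (by simpa using a) (by simpa using b))
      have hx : pascalY A C D v ⨯₃ (pascalX A B D E ⨯₃ pascalY A C D v) = 0 := by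
        rw [← pascalP, h0]; simp
      obtain ⟨r, hr⟩ : ∃ r : ℝ, pascalX A B D E = r • pascalY A C D v := by
        have hyy : pascalY A C D v ⬝ᵥ pascalY A C D v ≠ 0 := fun h =>
          hY0 (dotProduct_self_eq_zero.1 h)
        refine ⟨pascalX A B D E ⬝ᵥ pascalY A C D v / pascalY A C D v ⬝ᵥ pascalY A C D v, ?_⟩
        generalize pascalX A B D E = x at *
        generalize pascalY A C D v = y at *
        have a := congrFun hx 0
        have b := congrFun hx 1
        have c := congrFun hx 2
        simp [cross_apply] at a b c
        rw [vec3_dotProduct] at hyy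
        ext i
        fin_cases i <;> simp [vec3_dotProduct] <;> rw [div_mul_eq_mul_div, eq_div_iff hyy]
        · linear_combination a
        · linear_combination b
        · linear_combination c
      rw [hr, dotProduct_smul, hYC, smul_zero] at hXC
      exact mul_ne_zero hABD hCDE (by linarith)
    have hXB : covec B (C - B) ⬝ᵥ pascalX A B D E =
        -(crs (B - A) (C - A) * crs (E - D) (B - D)) := by
      simp [pascalX, covec, cross_apply, crs]
      ring
    have hEB : covec B (C - B) ⬝ᵥ homog E = crs (C - B) (E - B) := covec_dot _ _ _
    have hXp : pascalX A B D E ⬝ᵥ pascalP A B C D E v = 0 := dot_self_cross _ _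
    have hYp : pascalY A C D v ⬝ᵥ pascalP A B C D E v = 0 := dot_cross_self _ _
    -- the Pascal line is not the line `B C`, which does not contain `X`
    have hZ0 : pascalZ A B C D E v ≠ 0 := by
      intro h0
      have e : pascalX A B D E ⨯₃ pascalZ A B C D E v =
        -(covec B (C - B) ⬝ᵥ pascalX A B D E) • pascalP A B C D E v := by
        have : pascalX A B D E ⨯₃ pascalZ A B C D E v = (pascalX A B D E ⬝ᵥ pascalP A B C D E v) •
          covec B (C - B) - (covec B (C - B) ⬝ᵥ pascalX A B D E) • pascalP A B C D E v := by
          rw [pascalZ]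
          generalize pascalX A B D E = x
          generalize pascalP A B C D E v = p
          generalize covec B (C - B) = m
          ext i
          fin_cases i <;> simp [cross_apply, vec3_dotProduct] <;> ring
        rw [this, hXp, zero_smul, zero_sub, neg_smul]
      rw [h0, map_zero, hXB, neg_neg, eq_comm, smul_eq_zero] at e
      exact e.elim (mul_ne_zero hABC hBDE) hp0
    have hBZ : covec B (C - B) ⬝ᵥ pascalZ A B C D E v = 0 := dot_self_cross _ _
    -- `Z ≠ E` as `E` is not on the line `B C`
    have hq0 : pascalZ A B C D E v ⨯₃ homog E ≠ 0 := by
      intro h0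
      have e : covec B (C - B) ⨯₃ (pascalZ A B C D E v ⨯₃ homog E) =
        (covec B (C - B) ⬝ᵥ homog E) • pascalZ A B C D E v -
          (covec B (C - B) ⬝ᵥ pascalZ A B C D E v) • homog E := by
        generalize covec B (C - B) = m
        generalize pascalZ A B C D E v = z
        generalize homog E = x
        ext i
        fin_cases i <;> simp [cross_apply, vec3_dotProduct] <;> ring
      rw [h0, map_zero, hBZ, hEB, zero_smul, sub_zero, eq_comm, smul_eq_zero] at e
      exact e.elim hBCE hZ0
    have hqE : (pascalZ A B C D E v ⨯₃ homog E) ⬝ᵥ homog E = 0 := by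
      rw [dotProduct_comm]; exact dot_cross_self _ _
    have hqZ : pascalZ A B C D E v ⬝ᵥ (pascalZ A B C D E v ⨯₃ homog E) = 0 := dot_self_cross _ _
    obtain ⟨G, g, hg, hGg⟩ : ∃ G g, g ≠ 0 ∧ covec G g = pascalZ A B C D E v ⨯₃ homog E := by
      apply exists_covec
      by_contra! hc
      apply hq0
      generalize pascalZ A B C D E v ⨯₃ homog E = q at *
      rw [vec3_dotProduct, hc.1, hc.2] at hqE
      simp [homog] at hqE
      ext i; fin_cases i
      · exact hc.1
      · exact hc.2
      · exact hqE
    rw [← hGg] at hqE h hqZ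
    refine ⟨ln G g, isLine_ln G hg, (mem_ln hg).2 (by rwa [covec_dot] at hqE),
      (mem_ln hg).2 (by rwa [covec_dot] at h), mem_ln_iff.2 ⟨t, rfl⟩, ?_⟩
    by_cases hp : pascalP A B C D E v 0 ≠ 0 ∨ pascalP A B C D E v 1 ≠ 0
    · left
      obtain ⟨K, k, hk, hKk⟩ := exists_covec hp
      refine ⟨ln K k, isLine_ln K hk, ?_, ?_, ?_⟩
      · rw [concurrent_iff hk hAB hED, hKk, dotProduct_comm]; exact hXp
      · rw [concurrent_iff hk hDC hv, hKk, dotProduct_comm]; exact hYp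
      · rw [concurrent_iff hg hCB hk, hKk, dotProduct_comm]; exact hqZ
    · right
      push Not at hp
      have hp2 : pascalP A B C D E v 2 ≠ 0 := by
        intro h2; apply hp0; ext i; fin_cases i
        · exact hp.1
        · exact hp.2
        · exact h2
      rw [vec3_dotProduct, hp.1, hp.2] at hXp hYp
      rw [vec3_dotProduct, pascalZ, cross_apply, hp.1, hp.2] at hqZ
      simp [hp2] at hXp hYp
      rw [parallel_ln_iff hAB hED, parallel_ln_iff hDC hv, parallel_ln_iff hg hCB]
      refine ⟨?_, ?_, ?_⟩
      · simp [pascalX, cross_apply, covec] at hXp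
        simp [crs]; linarith
      · simp [pascalY, cross_apply, covec] at hYp
        simp [crs]; linarith
      · apply (mul_eq_zero.1 (_ : pascalP A B C D E v 2 * _ = 0)).resolve_left hp2
        simp [covec] at hqZ
        simp only [crs, PiLp.sub_apply]
        linear_combination hqZ

/-! ### Orthonormal frames -/

/-- An orthonormal coordinate frame: an origin and the unit vector of the first coordinate axis;
the second axis is obtained from the first by `rot`. -/
structure Frame where
  (O u : Plane)
  unit : u 0 * u 0 + u 1 * u 1 = 1

namespace Frame

variable (F : Frame)

/-- The first coordinate. -/
def x (X : Plane) : ℝ := F.u 0 * (X 0 - F.O 0) + F.u 1 * (X 1 - F.O 1)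

/-- The second coordinate. -/
def y (X : Plane) : ℝ := F.u 0 * (X 1 - F.O 1) - F.u 1 * (X 0 - F.O 0)

/-- The point with given coordinates. -/
noncomputable def pt (r s : ℝ) : Plane := F.O + r • F.u + s • rot F.u

/-- The axis of the first coordinate. -/
noncomputable def axis : Sub := ln F.O F.u

/-- The frame turned by a right angle. -/
noncomputable def turn : Frame where
  O := F.O
  u := rot F.u
  unit := by have := F.unit; simp; linarith

lemma u_ne_zero : F.u ≠ 0 := by
  intro h; have := F.unit; rw [h] at this; simp at this

@[simp] lemma pt_zero (r s : ℝ) : F.pt r s 0 = F.O 0 + r * F.u 0 - s * F.u 1 := by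
  simp [pt]; ring

@[simp] lemma pt_one (r s : ℝ) : F.pt r s 1 = F.O 1 + r * F.u 1 + s * F.u 0 := by
  simp [pt]

@[simp] lemma x_pt (r s : ℝ) : F.x (F.pt r s) = r := by
  simp only [x, pt_zero, pt_one]; linear_combination r * F.unit

@[simp] lemma y_pt (r s : ℝ) : F.y (F.pt r s) = s := by
  simp only [y, pt_zero, pt_one]; linear_combination s * F.unit

@[simp] lemma pt_x_y (X : Plane) : F.pt (F.x X) (F.y X) = X := by
  apply plane_ext
  · simp only [x, y, pt_zero]; linear_combination (X 0 - F.O 0) * F.unit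
  · simp only [x, y, pt_one]; linear_combination (X 1 - F.O 1) * F.unit

lemma ext_xy {X Y : Plane} (hx : F.x X = F.x Y) (hy : F.y X = F.y Y) : X = Y := by
  rw [← F.pt_x_y X, ← F.pt_x_y Y, hx, hy]

lemma eq_iff {X Y : Plane} : X = Y ↔ F.x X = F.x Y ∧ F.y X = F.y Y :=
  ⟨by rintro rfl; exact ⟨rfl, rfl⟩, fun h => F.ext_xy h.1 h.2⟩

@[simp] lemma x_O : F.x F.O = 0 := by simp [x]
@[simp] lemma y_O : F.y F.O = 0 := by simp [y]

@[simp] lemma x_turn (X : Plane) : F.turn.x X = F.y X := by simp [x, y, turn]; ring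
@[simp] lemma y_turn (X : Plane) : F.turn.y X = -F.x X := by simp [x, y, turn]; ring

@[simp] lemma x_midpoint (X Y : Plane) : F.x (midpoint ℝ X Y) = (F.x X + F.x Y) / 2 := by
  simp only [x, midpoint_zero, midpoint_one]; ring
@[simp] lemma y_midpoint (X Y : Plane) : F.y (midpoint ℝ X Y) = (F.y X + F.y Y) / 2 := by
  simp only [y, midpoint_zero, midpoint_one]; ring

@[simp] lemma x_pointMirror (A X : Plane) : F.x (pointMirror A X) = 2 * F.x A - F.x X := by
  simp only [x, pointMirror_zero, pointMirror_one]; ring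
@[simp] lemma y_pointMirror (A X : Plane) : F.y (pointMirror A X) = 2 * F.y A - F.y X := by
  simp only [y, pointMirror_zero, pointMirror_one]; ring

lemma dist_sq (X Y : Plane) : dist X Y ^ 2 = (F.x X - F.x Y) ^ 2 + (F.y X - F.y Y) ^ 2 := by
  rw [dist_sq_eq]
  simp only [dotp, x, y, PiLp.sub_apply]
  linear_combination (-(X 0 - Y 0) ^ 2 - (X 1 - Y 1) ^ 2) * F.unit

lemma dist_eq_iff {X Y Z W : Plane} : dist X Y = dist Z W ↔
    (F.x X - F.x Y) ^ 2 + (F.y X - F.y Y) ^ 2 = (F.x Z - F.x W) ^ 2 + (F.y Z - F.y W) ^ 2 := by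
  rw [← F.dist_sq, ← F.dist_sq, sq_eq_sq₀ dist_nonneg dist_nonneg]

lemma dist_eq_abs_iff {X Y : Plane} {r : ℝ} (hr : 0 ≤ r) : dist X Y = r ↔
    (F.x X - F.x Y) ^ 2 + (F.y X - F.y Y) ^ 2 = r ^ 2 := by
  rw [← F.dist_sq, sq_eq_sq₀ dist_nonneg hr]

lemma crs_sub (X Y Z W : Plane) : crs (X - Y) (Z - W) =
    (F.x X - F.x Y) * (F.y Z - F.y W) - (F.y X - F.y Y) * (F.x Z - F.x W) := by
  simp only [crs, x, y, PiLp.sub_apply]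
  linear_combination (-((X 0 - Y 0) * (Z 1 - W 1) - (X 1 - Y 1) * (Z 0 - W 0))) * F.unit

lemma dotp_sub (X Y Z W : Plane) : dotp (X - Y) (Z - W) =
    (F.x X - F.x Y) * (F.x Z - F.x W) + (F.y X - F.y Y) * (F.y Z - F.y W) := by
  simp only [dotp, x, y, PiLp.sub_apply]
  linear_combination (-((X 0 - Y 0) * (Z 0 - W 0) + (X 1 - Y 1) * (Z 1 - W 1))) * F.unit

lemma crs_u (X Y : Plane) : crs F.u (X - Y) = F.y X - F.y Y := by
  simp only [crs, y, PiLp.sub_apply]; ring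

lemma dotp_u (X Y : Plane) : dotp F.u (X - Y) = F.x X - F.x Y := by
  simp only [dotp, x, PiLp.sub_apply]; ring

lemma isLine_axis : IsLine F.axis := isLine_ln _ F.u_ne_zero

lemma mem_axis {X : Plane} : X ∈ F.axis ↔ F.y X = 0 := by
  rw [axis, mem_ln F.u_ne_zero, F.crs_u, y_O, sub_zero]

lemma mem_parallelThrough {X Y : Plane} : Y ∈ parallelThrough X F.axis ↔ F.y Y = F.y X := by
  rw [axis, parallelThrough_ln, mem_ln F.u_ne_zero, F.crs_u, sub_eq_zero]

lemma mem_perpThrough {X Y : Plane} : Y ∈ perpThrough X F.axis ↔ F.x Y = F.x X := by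
  rw [axis, mem_perpThrough_ln, F.dotp_u, sub_eq_zero]

lemma perpThrough_O : perpThrough F.O F.axis = F.turn.axis := by
  rw [axis, perpThrough_ln _ _ F.u_ne_zero, axis]; rfl

lemma mem_line {A B X : Plane} (h : A ≠ B) : X ∈ line[ℝ, A, B] ↔
    (F.x B - F.x A) * (F.y X - F.y A) - (F.y B - F.y A) * (F.x X - F.x A) = 0 := by
  rw [mem_line_iff h, F.crs_sub]

lemma isMirror_axis {X Y : Plane} : IsMirror F.axis X Y ↔ F.x Y = F.x X ∧ F.y Y = -F.y X := by
  rw [axis, isMirror_ln F.u_ne_zero, F.crs_u, F.dotp_u, y_midpoint, y_O, sub_eq_zero, and_comm]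
  constructor <;> rintro ⟨h1, h2⟩ <;> exact ⟨by linarith, by linarith⟩

end Frame

lemma exists_unit {v : Plane} (hv : v ≠ 0) :
    ∃ u : Plane, u 0 * u 0 + u 1 * u 1 = 1 ∧ ∃ r : ℝ, 0 < r ∧ v = r • u := by
  have h := dotp_self_pos hv
  have hs : 0 < √(dotp v v) := Real.sqrt_pos.2 h
  have hq : √(dotp v v) * √(dotp v v) = dotp v v := Real.mul_self_sqrt h.le
  refine ⟨(√(dotp v v))⁻¹ • v, ?_, √(dotp v v), hs, ?_⟩
  · simp only [PiLp.smul_apply, smul_eq_mul]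
    have : (√(dotp v v))⁻¹ * (√(dotp v v))⁻¹ * dotp v v = 1 := by
      rw [← mul_inv, hq, inv_mul_cancel₀ h.ne']
    rw [← this]
    nth_rw 7 [dotp]
    ring
  · rw [smul_smul, mul_inv_cancel₀ hs.ne', one_smul]

/-- Every line is the first axis of a frame, with any of its points as the origin. -/
lemma IsLine.exists_frame {L : Sub} (hL : IsLine L) {A : Plane} (hA : A ∈ L) :
    ∃ F : Frame, F.O = A ∧ L = F.axis := by
  obtain ⟨v, hv, rfl⟩ := hL.exists_ln hA
  obtain ⟨u, hu, r, hr, rfl⟩ := exists_unit hv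
  refine ⟨⟨A, u, hu⟩, rfl, ?_⟩
  have hu0 : u ≠ 0 := by rintro rfl; simp at hv
  rw [Frame.axis, ln_eq_ln_iff hv hu0]
  simp [crs]; ring

lemma exists_frame_ln (A : Plane) {v : Plane} (hv : v ≠ 0) :
    ∃ F : Frame, F.O = A ∧ ln A v = F.axis :=
  (isLine_ln A hv).exists_frame (self_mem_ln A v)

/-- The distance of a point from a line. -/
lemma Frame.infDist_axis (F : Frame) (X : Plane) :
    Metric.infDist X (F.axis : Set Plane) = |F.y X| := by
  apply le_antisymm
  · have hm : F.pt (F.x X) 0 ∈ F.axis := by rw [F.mem_axis, F.y_pt]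
    refine (Metric.infDist_le_dist_of_mem hm).trans (le_of_eq ?_)
    rw [F.dist_eq_abs_iff (abs_nonneg _), sq_abs]; simp
  · rw [Metric.le_infDist ⟨F.O, by rw [SetLike.mem_coe, F.mem_axis, F.y_O]⟩]
    intro Y hY
    rw [SetLike.mem_coe, F.mem_axis] at hY
    apply abs_le_of_sq_le_sq _ dist_nonneg
    rw [F.dist_sq, hY]
    nlinarith [sq_nonneg (F.x X - F.x Y)]

/-! ### The focal definitions and quadratic equations -/

/-- The relation between the focal distances `d₁, d₂` of a point and the focal equation, where `N`
is the squared distance of the point from the centre, `C` the squared linear eccentricity and `p`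
the inner product of the position vectors of the point and of a focus. -/
lemma focal_ellipse {d₁ d₂ N C p a : ℝ} (h₁ : 0 ≤ d₁) (h₂ : 0 ≤ d₂) (e₁ : d₁ ^ 2 = N - 2 * p + C)
    (e₂ : d₂ ^ 2 = N + 2 * p + C) (hp : p ^ 2 ≤ N * C) (ha : 0 < a) (hC : C < a ^ 2) :
    d₁ + d₂ = 2 * a ↔ a ^ 2 * N - p ^ 2 = a ^ 2 * (a ^ 2 - C) := by
  constructor
  · intro h
    have h3 : a * d₁ = a ^ 2 - p := by
      have : d₂ = 2 * a - d₁ := by linarith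
      rw [this] at e₂
      nlinarith
    have h4 : (a * d₁) ^ 2 = (a ^ 2 - p) ^ 2 := by rw [h3]
    linear_combination h4 - a ^ 2 * e₁
  · intro h
    have hC0 : 0 ≤ N + C := by nlinarith [sq_nonneg d₁, sq_nonneg d₂]
    have hp2 : p ^ 2 < (a ^ 2) ^ 2 := by
      have h5 : (a ^ 2 - C) * p ^ 2 ≤ (a ^ 2 - C) * (a ^ 2 * C) := by
        nlinarith [mul_le_mul_of_nonneg_left hp (sq_nonneg a)]
      have h6 := le_of_mul_le_mul_left h5 (by linarith)
      have : a ^ 2 * C < a ^ 2 * a ^ 2 := by apply mul_lt_mul_of_pos_left hC; positivity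
      nlinarith
    have hpa := abs_lt.1 (abs_lt_of_sq_lt_sq hp2 (by positivity))
    have h6 : a * d₁ = a ^ 2 - p := by
      rw [← sq_eq_sq₀ (by positivity) (by linarith)]
      linear_combination a ^ 2 * e₁ + h
    have h7 : a * d₂ = a ^ 2 + p := by
      rw [← sq_eq_sq₀ (by positivity) (by linarith)]
      linear_combination a ^ 2 * e₂ + h
    have : a * (d₁ + d₂) = a * (2 * a) := by linarith
    exact mul_left_cancel₀ ha.ne' this

/-- The counterpart of `focal_ellipse` for the difference of the focal distances. -/
lemma focal_hyperbola {d₁ d₂ N C p a : ℝ} (h₁ : 0 ≤ d₁) (h₂ : 0 ≤ d₂) (e₁ : d₁ ^ 2 = N - 2 * p + C)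
    (e₂ : d₂ ^ 2 = N + 2 * p + C) (hp : p ^ 2 ≤ N * C) (ha : 0 < a) (hC : a ^ 2 < C) :
    |d₁ - d₂| = 2 * a ↔ a ^ 2 * N - p ^ 2 = a ^ 2 * (a ^ 2 - C) := by
  constructor
  · intro h
    have h0 : (d₁ - d₂) ^ 2 = 4 * a ^ 2 := by rw [← sq_abs, h]; ring
    have h1 : (d₁ - d₂) * (d₁ + d₂) = -4 * p := by linear_combination e₁ - e₂
    have h2 : (d₁ - d₂) ^ 2 * (d₁ + d₂) ^ 2 = 16 * p ^ 2 := by rw [← mul_pow, h1]; ring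
    have h3 : (d₁ - d₂) ^ 2 + (d₁ + d₂) ^ 2 = 4 * N + 4 * C := by linear_combination 2 * e₁ + 2 * e₂
    rw [h0] at h2 h3
    have h4 : (d₁ + d₂) ^ 2 = 4 * N + 4 * C - 4 * a ^ 2 := by linarith
    rw [h4] at h2
    linarith
  · intro h
    have hp2 : (a ^ 2) ^ 2 < p ^ 2 := by
      have h5 : (C - a ^ 2) * (a ^ 2 * C) ≤ (C - a ^ 2) * p ^ 2 := by
        nlinarith [mul_le_mul_of_nonneg_left hp (sq_nonneg a)]
      have h6 := le_of_mul_le_mul_left h5 (by linarith)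
      have : a ^ 2 * a ^ 2 < a ^ 2 * C := by apply mul_lt_mul_of_pos_left hC; positivity
      nlinarith
    have h1 : (a * d₁) ^ 2 = (a ^ 2 - p) ^ 2 := by linear_combination a ^ 2 * e₁ + h
    have h2 : (a * d₂) ^ 2 = (a ^ 2 + p) ^ 2 := by linear_combination a ^ 2 * e₂ + h
    have hd1 : a * d₁ = |a ^ 2 - p| := by
      rw [← abs_of_nonneg (by positivity : 0 ≤ a * d₁)]; exact (sq_eq_sq_iff_abs_eq_abs _ _).1 h1
    have hd2 : a * d₂ = |a ^ 2 + p| := by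
      rw [← abs_of_nonneg (by positivity : 0 ≤ a * d₂)]; exact (sq_eq_sq_iff_abs_eq_abs _ _).1 h2
    have hk : a * |d₁ - d₂| = a * (2 * a) := by
      rw [← abs_of_pos ha, ← abs_mul, abs_of_pos ha, mul_sub, hd1, hd2]
      have hpp : a ^ 2 < |p| := by
        rw [← abs_of_nonneg (sq_nonneg a)]; exact sq_lt_sq.1 hp2
      rcases lt_abs.1 hpp with h5 | h5
      · rw [abs_of_neg (by linarith : a ^ 2 - p < 0),
          abs_of_pos (by nlinarith [sq_nonneg a] : 0 < a ^ 2 + p), abs_of_neg (by nlinarith)]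
        ring
      · rw [abs_of_neg (by linarith : a ^ 2 + p < 0),
          abs_of_pos (by nlinarith [sq_nonneg a] : 0 < a ^ 2 - p), abs_of_pos (by nlinarith)]
        ring
    exact mul_left_cancel₀ ha.ne' hk

/-- The zero set of a quadric. -/
def Quadric.zeros (Q : Quadric) : Set Plane := {X | Q.eval X = 0}

/-- The quadric with centre `M` whose foci are `M ± c` and whose semi-axis through the foci is
`a`. -/
def focalQuadric (M c : Plane) (a : ℝ) : Quadric where
  a := a ^ 2 - c 0 ^ 2
  b := -(c 0 * c 1)
  c := a ^ 2 - c 1 ^ 2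
  d := -((a ^ 2 - c 0 ^ 2) * M 0 - c 0 * c 1 * M 1)
  e := -(-(c 0 * c 1 * M 0) + (a ^ 2 - c 1 ^ 2) * M 1)
  f := (a ^ 2 - c 0 ^ 2) * M 0 ^ 2 - 2 * c 0 * c 1 * M 0 * M 1 + (a ^ 2 - c 1 ^ 2) * M 1 ^ 2
    - a ^ 2 * (a ^ 2 - dotp c c)

lemma focalQuadric_disc (M c : Plane) (a : ℝ) :
    (focalQuadric M c a).disc = a ^ 2 * (a ^ 2 - dotp c c) := by
  simp only [Quadric.disc, focalQuadric, dotp]; ring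

lemma focalQuadric_det (M c : Plane) (a : ℝ) :
    (focalQuadric M c a).det = -(a ^ 2 * (a ^ 2 - dotp c c)) ^ 2 := by
  simp only [Quadric.det, focalQuadric, dotp]; ring

lemma focalQuadric_eval (M c X : Plane) (a : ℝ) : (focalQuadric M c a).eval X =
    a ^ 2 * dotp (X - M) (X - M) - dotp (X - M) c ^ 2 - a ^ 2 * (a ^ 2 - dotp c c) := by
  simp only [Quadric.eval, focalQuadric, dotp, PiLp.sub_apply]; ring

lemma dotp_sq_le (v w : Plane) : dotp v w ^ 2 ≤ dotp v v * dotp w w := by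
  have : dotp v v * dotp w w = crs v w ^ 2 + dotp v w ^ 2 := by simp only [crs, dotp]; ring
  rw [this]; nlinarith [sq_nonneg (crs v w)]

lemma dist_sq_add (M c X : Plane) :
    dist X (M + c) ^ 2 = dotp (X - M) (X - M) - 2 * dotp (X - M) c + dotp c c := by
  rw [dist_sq_eq]; simp only [dotp, PiLp.sub_apply, PiLp.add_apply]; ring

lemma dist_sq_sub (M c X : Plane) :
    dist X (M - c) ^ 2 = dotp (X - M) (X - M) + 2 * dotp (X - M) c + dotp c c := by
  rw [dist_sq_eq]; simp only [dotp, PiLp.sub_apply]; ring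

/-- The ellipses with foci `M ± c` are the zero sets of the focal quadrics with `|c| < a`. -/
lemma isEllipseWith_iff {C : Set Plane} {M c : Plane} {a : ℝ} (ha : 0 < a) :
    IsEllipseWith C (M + c) (M - c) (2 * a) ↔
      dotp c c < a ^ 2 ∧ C = (focalQuadric M c a).zeros := by
  have hd : dist (M + c) (M - c) < 2 * a ↔ dotp c c < a ^ 2 := by
    rw [← sq_lt_sq₀ dist_nonneg (by positivity), dist_sq_sub]
    have : dotp (M + c - M) (M + c - M) + 2 * dotp (M + c - M) c + dotp c c = 4 * dotp c c := by
      rw [add_sub_cancel_left]; ring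
    rw [this]; constructor <;> intro h <;> linarith
  rw [IsEllipseWith, hd]
  refine and_congr_right fun h => ?_
  have : {X | dist X (M + c) + dist X (M - c) = 2 * a} = (focalQuadric M c a).zeros := by
    ext X
    simp only [mem_ofPred_eq, Quadric.zeros, focalQuadric_eval]
    rw [focal_ellipse dist_nonneg dist_nonneg (dist_sq_add M c X) (dist_sq_sub M c X)
      (dotp_sq_le _ _) ha h, sub_eq_zero]
  rw [this]

/-- The hyperbolas with foci `M ± c` are the zero sets of the focal quadrics with `a < |c|`. -/
lemma isHyperbolaWith_iff {C : Set Plane} {M c : Plane} {a : ℝ} (ha : 0 < a) :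
    IsHyperbolaWith C (M + c) (M - c) (2 * a) ↔
      a ^ 2 < dotp c c ∧ C = (focalQuadric M c a).zeros := by
  have hd : 2 * a < dist (M + c) (M - c) ↔ a ^ 2 < dotp c c := by
    rw [← sq_lt_sq₀ (by positivity) dist_nonneg, dist_sq_sub]
    have : dotp (M + c - M) (M + c - M) + 2 * dotp (M + c - M) c + dotp c c = 4 * dotp c c := by
      rw [add_sub_cancel_left]; ring
    rw [this]; constructor <;> intro h <;> linarith
  rw [IsHyperbolaWith, hd]
  refine (and_iff_right (by positivity)).trans (and_congr_right fun h => ?_)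
  have : {X | |dist X (M + c) - dist X (M - c)| = 2 * a} = (focalQuadric M c a).zeros := by
    ext X
    simp only [mem_ofPred_eq, Quadric.zeros, focalQuadric_eval]
    rw [focal_hyperbola dist_nonneg dist_nonneg (dist_sq_add M c X) (dist_sq_sub M c X)
      (dotp_sq_le _ _) ha h, sub_eq_zero]
  rw [this]

lemma exists_center_add (F₁ F₂ : Plane) : ∃ M c : Plane, F₁ = M + c ∧ F₂ = M - c :=
  ⟨midpoint ℝ F₁ F₂, F₁ - midpoint ℝ F₁ F₂, by abel, by
    apply plane_ext <;> simp <;> ring⟩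

lemma IsEllipse.exists_quadric {C : Set Plane} (h : IsEllipse C) :
    ∃ Q : Quadric, Q.det ≠ 0 ∧ 0 < Q.disc ∧ C = Q.zeros := by
  obtain ⟨F₁, F₂, s, h⟩ := h
  obtain ⟨M, c, rfl, rfl⟩ := exists_center_add F₁ F₂
  have hs : 0 < s / 2 := by have := dist_nonneg.trans_lt h.1; linarith
  rw [show s = 2 * (s / 2) by ring, isEllipseWith_iff hs] at h
  have h1 : 0 < (s / 2) ^ 2 * ((s / 2) ^ 2 - dotp c c) :=
    mul_pos (by positivity) (by linarith [h.1])
  refine ⟨_, ?_, ?_, h.2⟩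
  · rw [focalQuadric_det]; exact neg_ne_zero.2 (pow_ne_zero 2 h1.ne')
  · rw [focalQuadric_disc]; exact h1

lemma IsHyperbola.exists_quadric {C : Set Plane} (h : IsHyperbola C) :
    ∃ Q : Quadric, Q.det ≠ 0 ∧ Q.disc < 0 ∧ C = Q.zeros := by
  obtain ⟨F₁, F₂, s, h⟩ := h
  obtain ⟨M, c, rfl, rfl⟩ := exists_center_add F₁ F₂
  have hs : 0 < s / 2 := by linarith [h.1]
  rw [show s = 2 * (s / 2) by ring, isHyperbolaWith_iff hs] at h
  have h1 : (s / 2) ^ 2 * ((s / 2) ^ 2 - dotp c c) < 0 :=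
    mul_neg_of_pos_of_neg (by positivity) (by linarith [h.1])
  refine ⟨_, ?_, ?_, h.2⟩
  · rw [focalQuadric_det]; exact neg_ne_zero.2 (pow_ne_zero 2 h1.ne)
  · rw [focalQuadric_disc]; exact h1

/-- The equation of a parabola in a frame whose first axis is the directrix. -/
lemma Frame.isParabolaWith_iff (G : Frame) {C : Set Plane} {F : Plane} :
    IsParabolaWith C F G.axis ↔
      G.y F ≠ 0 ∧ ∀ X, X ∈ C ↔ (G.x X - G.x F) ^ 2 + (G.y X - G.y F) ^ 2 = G.y X ^ 2 := by
  rw [IsParabolaWith, G.mem_axis]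
  simp only [G.isLine_axis, true_and, G.infDist_axis]
  refine and_congr_right fun _ => ?_
  rw [Set.ext_iff]
  refine forall_congr' fun X => ?_
  rw [mem_ofPred_eq, G.dist_eq_abs_iff (abs_nonneg _), sq_abs]

lemma IsParabola.exists_quadric {C : Set Plane} (h : IsParabola C) :
    ∃ Q : Quadric, Q.det ≠ 0 ∧ Q.disc = 0 ∧ C = Q.zeros := by
  obtain ⟨F, d, h⟩ := h
  obtain ⟨A, hA⟩ := h.1.1
  obtain ⟨G, -, rfl⟩ := h.1.exists_frame hA
  rw [G.isParabolaWith_iff] at h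
  obtain ⟨h1, h2⟩ := h
  have hu := G.unit
  refine ⟨⟨G.u 0 ^ 2, G.u 0 * G.u 1, G.u 1 ^ 2,
    -F 0 - G.u 1 * (G.u 0 * G.O 1 - G.u 1 * G.O 0),
      -F 1 + G.u 0 * (G.u 0 * G.O 1 - G.u 1 * G.O 0),
    F 0 ^ 2 + F 1 ^ 2 - (G.u 0 * G.O 1 - G.u 1 * G.O 0) ^ 2⟩, ?_, ?_, ?_⟩
  · have : Quadric.det ⟨G.u 0 ^ 2, G.u 0 * G.u 1, G.u 1 ^ 2,
      -F 0 - G.u 1 * (G.u 0 * G.O 1 - G.u 1 * G.O 0),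
      -F 1 + G.u 0 * (G.u 0 * G.O 1 - G.u 1 * G.O 0),
      F 0 ^ 2 + F 1 ^ 2 - (G.u 0 * G.O 1 - G.u 1 * G.O 0) ^ 2⟩ =
        -(G.y F + (G.u 0 * G.u 0 + G.u 1 * G.u 1 - 1) * -(G.u 0 * G.O 1 - G.u 1 * G.O 0)) ^ 2 := by
      simp only [Quadric.det, Frame.y]; ring
    rw [this, hu, sub_self, zero_mul, add_zero]
    exact neg_ne_zero.2 (pow_ne_zero 2 h1)
  · simp only [Quadric.disc]; ring
  · ext X
    rw [h2, Quadric.zeros, mem_ofPred_eq, ← sub_eq_zero, ← G.dist_sq, dist_sq_eq]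
    have : dotp (X - F) (X - F) - G.y X ^ 2 = Quadric.eval ⟨G.u 0 ^ 2, G.u 0 * G.u 1, G.u 1 ^ 2,
      -F 0 - G.u 1 * (G.u 0 * G.O 1 - G.u 1 * G.O 0),
      -F 1 + G.u 0 * (G.u 0 * G.O 1 - G.u 1 * G.O 0),
      F 0 ^ 2 + F 1 ^ 2 - (G.u 0 * G.O 1 - G.u 1 * G.O 0) ^ 2⟩ X := by
      simp only [Quadric.eval, Frame.y, dotp, PiLp.sub_apply]
      linear_combination (-X 0 ^ 2 - X 1 ^ 2) * hu
    rw [this]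

/-! ### Normal forms -/

namespace Frame

variable (F : Frame) {C : Set Plane}

/-- The value of a quadric in the coordinates of a frame. -/
lemma eval_eq (Q : Quadric) (X : Plane) : Q.eval X =
    Q.form F.u F.u * F.x X ^ 2 + 2 * Q.form F.u (rot F.u) * F.x X * F.y X
      + Q.form (rot F.u) (rot F.u) * F.y X ^ 2 + 2 * Q.lin F.O F.u * F.x X
      + 2 * Q.lin F.O (rot F.u) * F.y X + Q.eval F.O := by
  have h : X = F.O + (F.x X • F.u + F.y X • rot F.u) := by
    conv_lhs => rw [← F.pt_x_y X, pt, add_assoc]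
  conv_lhs => rw [h, Quadric.eval_add]
  simp only [Quadric.lin_add_right, Quadric.lin_smul_right, Quadric.form_add_left,
    Quadric.form_add_right, Quadric.form_smul_left, Quadric.form_smul_right,
    Q.form_comm (rot F.u) F.u]
  ring

lemma crs_u_rot : crs F.u (rot F.u) = 1 := by
  have := F.unit; simp only [crs, rot_zero, rot_one]; linarith

lemma det_eq (Q : Quadric) :
    Q.det = Q.form F.u F.u * (Q.form (rot F.u) (rot F.u) * Q.eval F.O - Q.lin F.O (rot F.u) ^ 2)
      - Q.form F.u (rot F.u) * (Q.form F.u (rot F.u) * Q.eval F.O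
        - Q.lin F.O (rot F.u) * Q.lin F.O F.u)
      + Q.lin F.O F.u * (Q.form F.u (rot F.u) * Q.lin F.O (rot F.u)
        - Q.form (rot F.u) (rot F.u) * Q.lin F.O F.u) := by
  rw [Q.det_basis, F.crs_u_rot]; ring

lemma disc_eq (Q : Quadric) :
    Q.disc = Q.form F.u F.u * Q.form (rot F.u) (rot F.u) - Q.form F.u (rot F.u) ^ 2 := by
  rw [Q.disc_basis, F.crs_u_rot]; ring

/-- The ellipse in its principal frame: the foci. -/
lemma isEllipseWith {a b : ℝ} (ha : 0 < a) (hb : 0 < b)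
    (hC : ∀ X, X ∈ C ↔ b ^ 2 * F.x X ^ 2 + a ^ 2 * F.y X ^ 2 = a ^ 2 * b ^ 2) {c : ℝ}
    (hc : c ^ 2 = a ^ 2 - b ^ 2) : IsEllipseWith C (F.pt c 0) (F.pt (-c) 0) (2 * a) := by
  have e1 : F.pt c 0 = F.O + c • F.u := by simp [pt]
  have e2 : F.pt (-c) 0 = F.O - c • F.u := by simp [pt]; abel
  have hcc : dotp (c • F.u) (c • F.u) = c ^ 2 := by
    simp only [dotp, PiLp.smul_apply, smul_eq_mul]; linear_combination c ^ 2 * F.unit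
  rw [e1, e2, isEllipseWith_iff ha, hcc, hc]
  refine ⟨by nlinarith, ?_⟩
  ext X
  rw [hC, Quadric.zeros, mem_ofPred_eq, focalQuadric_eval, hcc, F.dotp_sub]
  have : dotp (X - F.O) (c • F.u) = c * F.x X := by
    simp only [dotp, x, PiLp.smul_apply, smul_eq_mul, PiLp.sub_apply]; ring
  rw [this, x_O, y_O, ← sub_eq_zero]
  have : a ^ 2 * ((F.x X - 0) * (F.x X - 0) + (F.y X - 0) * (F.y X - 0)) - (c * F.x X) ^ 2
      - a ^ 2 * (a ^ 2 - c ^ 2) = b ^ 2 * F.x X ^ 2 + a ^ 2 * F.y X ^ 2 - a ^ 2 * b ^ 2 := by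
    linear_combination (a ^ 2 - F.x X ^ 2) * hc
  rw [this]

/-- The hyperbola in its principal frame: the foci. -/
lemma isHyperbolaWith {a b : ℝ} (ha : 0 < a) (hb : 0 < b)
    (hC : ∀ X, X ∈ C ↔ b ^ 2 * F.x X ^ 2 - a ^ 2 * F.y X ^ 2 = a ^ 2 * b ^ 2) {c : ℝ}
    (hc : c ^ 2 = a ^ 2 + b ^ 2) : IsHyperbolaWith C (F.pt c 0) (F.pt (-c) 0) (2 * a) := by
  have e1 : F.pt c 0 = F.O + c • F.u := by simp [pt]
  have e2 : F.pt (-c) 0 = F.O - c • F.u := by simp [pt]; abel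
  have hcc : dotp (c • F.u) (c • F.u) = c ^ 2 := by
    simp only [dotp, PiLp.smul_apply, smul_eq_mul]; linear_combination c ^ 2 * F.unit
  rw [e1, e2, isHyperbolaWith_iff ha, hcc, hc]
  refine ⟨by nlinarith, ?_⟩
  ext X
  rw [hC, Quadric.zeros, mem_ofPred_eq, focalQuadric_eval, hcc, F.dotp_sub]
  have : dotp (X - F.O) (c • F.u) = c * F.x X := by
    simp only [dotp, x, PiLp.smul_apply, smul_eq_mul, PiLp.sub_apply]; ring
  rw [this, x_O, y_O, ← sub_eq_zero]
  have : -(a ^ 2 * ((F.x X - 0) * (F.x X - 0) + (F.y X - 0) * (F.y X - 0)) - (c * F.x X) ^ 2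
      - a ^ 2 * (a ^ 2 - c ^ 2)) = b ^ 2 * F.x X ^ 2 - a ^ 2 * F.y X ^ 2 - a ^ 2 * b ^ 2 := by
    linear_combination (F.x X ^ 2 - a ^ 2) * hc
  rw [← this, neg_eq_zero]

/-- The equation of a parabola in a frame whose first axis is the axis of the parabola. -/
lemma isParabolaWith_perp_iff {f e : ℝ} :
    IsParabolaWith C (F.pt f 0) (perpThrough (F.pt e 0) F.axis) ↔
      f ≠ e ∧ ∀ X, X ∈ C ↔ (F.x X - f) ^ 2 + F.y X ^ 2 = (F.x X - e) ^ 2 := by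
  obtain ⟨G, hG⟩ : ∃ G : Frame, G.O = F.pt e 0 ∧ G.u = rot F.u :=
    ⟨⟨F.pt e 0, rot F.u, by have := F.unit; simp; linarith⟩, rfl, rfl⟩
  have hGd : perpThrough (F.pt e 0) F.axis = G.axis := by
    rw [axis, perpThrough_ln _ _ F.u_ne_zero, axis, hG.1, hG.2]
  have hGy : ∀ X, G.y X = -(F.x X - e) := by
    intro X
    have : F.x (F.pt e 0) = e := F.x_pt _ _
    rw [← this, ← hG.1]
    simp only [x, y, hG.2, rot_zero, rot_one]; ring
  have hGx : ∀ X, G.x X = F.y X := by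
    intro X
    have : F.y (F.pt e 0) = 0 := F.y_pt _ _
    rw [← sub_zero (F.y X), ← this, ← hG.1]
    simp only [x, y, hG.2, rot_zero, rot_one]; ring
  rw [hGd, G.isParabolaWith_iff]
  simp only [hGy, hGx, x_pt, y_pt]
  refine and_congr (by rw [Ne, neg_eq_zero, sub_eq_zero])
    (forall_congr' fun X => iff_congr Iff.rfl ?_)
  constructor <;> intro h <;> linarith

/-- The parabola in its principal frame: focus and directrix. -/
lemma isParabolaWith {p v : ℝ} (hp : p ≠ 0)
    (hC : ∀ X, X ∈ C ↔ F.y X ^ 2 = 4 * p * (F.x X - v)) :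
    IsParabolaWith C (F.pt (v + p) 0) (perpThrough (F.pt (v - p) 0) F.axis) := by
  rw [isParabolaWith_perp_iff]
  refine ⟨fun h => hp (by linarith), fun X => ?_⟩
  rw [hC]
  constructor <;> intro h <;> linarith

end Frame

/-- A real symmetric form has orthonormal eigenvectors. -/
lemma Quadric.exists_principal_frame (Q : Quadric) (O : Plane) :
    ∃ F : Frame, F.O = O ∧ Q.form F.u (rot F.u) = 0 := by
  suffices h : ∃ v : Plane, v ≠ 0 ∧ Q.form v (rot v) = 0 by
    obtain ⟨v, hv, h⟩ := h
    obtain ⟨u, hu, r, hr, rfl⟩ := exists_unit hv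
    refine ⟨⟨O, u, hu⟩, rfl, ?_⟩
    have : Q.form (r • u) (rot (r • u)) = r ^ 2 * Q.form u (rot u) := by
      simp [form]; ring
    rw [this] at h
    exact (mul_eq_zero.1 h).resolve_left (by positivity)
  by_cases hb : Q.b = 0
  · refine ⟨!₂[1, 0], ?_, by simp [form, hb]⟩
    intro h; rw [plane_ext_iff] at h; simp at h
  · set r := √(((Q.a - Q.c) / 2) ^ 2 + Q.b ^ 2) with hr
    have hr2 : r ^ 2 = ((Q.a - Q.c) / 2) ^ 2 + Q.b ^ 2 := Real.sq_sqrt (by positivity)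
    -- an eigenvector for the greater eigenvalue `(a + c) / 2 + r`
    refine ⟨!₂[Q.b, (Q.c - Q.a) / 2 + r], ?_, ?_⟩
    · intro h; rw [plane_ext_iff] at h; simp [hb] at h
    · simp [form]
      linear_combination (-Q.b) * hr2

/-- A nonempty central conic in principal coordinates: the signs of `γ` and `k` decide between the
types and, together with the sizes of `α` and `γ`, determine which axis carries the foci. -/
lemma Frame.isConic_of_normal_form (F : Frame) {C : Set Plane} {α γ k : ℝ} (hα : 0 < α) (hγ : γ ≠ 0)
    (hk : k ≠ 0) (hne : C.Nonempty)
    (hC : ∀ X, X ∈ C ↔ α * F.x X ^ 2 + γ * F.y X ^ 2 + k = 0) : IsConic C := by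
  rcases lt_or_gt_of_ne hγ with hγ | hγ
  · right; right
    rcases lt_or_gt_of_ne hk with hk | hk
    · have h1 : 0 < -k / α := div_pos (by linarith) hα
      have h2 : 0 < k / γ := div_pos_of_neg_of_neg hk hγ
      refine ⟨_, _, _, F.isHyperbolaWith (a := √(-k / α)) (b := √(k / γ)) (Real.sqrt_pos.2 h1)
        (Real.sqrt_pos.2 h2) (fun X => ?_) (Real.sq_sqrt (by positivity))⟩
      rw [hC, Real.sq_sqrt h1.le, Real.sq_sqrt h2.le]
      have : k / γ * F.x X ^ 2 - -k / α * F.y X ^ 2 - -k / α * (k / γ) =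
        k / (α * γ) * (α * F.x X ^ 2 + γ * F.y X ^ 2 + k) := by field_simp; ring
      rw [← sub_eq_zero (a := k / γ * F.x X ^ 2 - -k / α * F.y X ^ 2), this, mul_eq_zero,
        or_iff_right (div_ne_zero hk.ne (mul_ne_zero hα.ne' hγ.ne))]
    · have h1 : 0 < k / α := div_pos hk hα
      have h2 : 0 < -k / γ := div_pos_of_neg_of_neg (by linarith) hγ
      refine ⟨_, _, _, F.turn.isHyperbolaWith (a := √(-k / γ)) (b := √(k / α)) (Real.sqrt_pos.2 h2)
        (Real.sqrt_pos.2 h1) (fun X => ?_) (Real.sq_sqrt (by positivity))⟩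
      rw [hC, Real.sq_sqrt h1.le, Real.sq_sqrt h2.le, F.x_turn, F.y_turn]
      have : k / α * F.y X ^ 2 - -k / γ * (-F.x X) ^ 2 - -k / γ * (k / α) =
        k / (α * γ) * (α * F.x X ^ 2 + γ * F.y X ^ 2 + k) := by field_simp; ring
      rw [← sub_eq_zero (a := k / α * F.y X ^ 2 - -k / γ * (-F.x X) ^ 2), this, mul_eq_zero,
        or_iff_right (div_ne_zero hk.ne' (mul_ne_zero hα.ne' hγ.ne))]
  · left
    have hk' : k < 0 := by
      obtain ⟨X, hX⟩ := hne
      rw [hC] at hX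
      rcases lt_or_gt_of_ne hk with hk | hk
      · exact hk
      · nlinarith [mul_nonneg hα.le (sq_nonneg (F.x X)), mul_nonneg hγ.le (sq_nonneg (F.y X))]
    have h1 : 0 < -k / α := div_pos (by linarith) hα
    have h2 : 0 < -k / γ := div_pos (by linarith) hγ
    rcases le_total α γ with h | h
    · have hle : -k / γ ≤ -k / α := div_le_div_of_nonneg_left (by linarith) hα h
      refine ⟨_, _, _, F.isEllipseWith (a := √(-k / α)) (b := √(-k / γ)) (Real.sqrt_pos.2 h1)
        (Real.sqrt_pos.2 h2) (fun X => ?_) (Real.sq_sqrt ?_)⟩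
      · rw [hC, Real.sq_sqrt h1.le, Real.sq_sqrt h2.le]
        have : -k / γ * F.x X ^ 2 + -k / α * F.y X ^ 2 - -k / α * (-k / γ) =
          -k / (α * γ) * (α * F.x X ^ 2 + γ * F.y X ^ 2 + k) := by field_simp; ring
        rw [← sub_eq_zero (a := -k / γ * F.x X ^ 2 + -k / α * F.y X ^ 2), this, mul_eq_zero,
          or_iff_right (div_ne_zero (neg_ne_zero.2 hk) (mul_ne_zero hα.ne' hγ.ne'))]
      · rw [Real.sq_sqrt h1.le, Real.sq_sqrt h2.le]; linarith
    · have hle : -k / α ≤ -k / γ := div_le_div_of_nonneg_left (by linarith) hγ h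
      refine ⟨_, _, _, F.turn.isEllipseWith (a := √(-k / γ)) (b := √(-k / α)) (Real.sqrt_pos.2 h2)
        (Real.sqrt_pos.2 h1) (fun X => ?_) (Real.sq_sqrt ?_)⟩
      · rw [hC, Real.sq_sqrt h1.le, Real.sq_sqrt h2.le, F.x_turn, F.y_turn]
        have : -k / α * F.y X ^ 2 + -k / γ * (-F.x X) ^ 2 - -k / γ * (-k / α) =
          -k / (α * γ) * (α * F.x X ^ 2 + γ * F.y X ^ 2 + k) := by field_simp; ring
        rw [← sub_eq_zero (a := -k / α * F.y X ^ 2 + -k / γ * (-F.x X) ^ 2), this, mul_eq_zero,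
          or_iff_right (div_ne_zero (neg_ne_zero.2 hk) (mul_ne_zero hα.ne' hγ.ne'))]
      · rw [Real.sq_sqrt h1.le, Real.sq_sqrt h2.le]; linarith

/-- A nondegenerate quadric with real points is a conic in the sense of the focal definitions. -/
lemma Quadric.isConic_zeros {Q : Quadric} (hQ : Q.det ≠ 0) (hne : Q.zeros.Nonempty) :
    IsConic Q.zeros := by
  obtain ⟨F₀, -, hF₀⟩ := Q.exists_principal_frame 0
  -- after a turn by a right angle the eigenvalue of the second axis is not zero
  obtain ⟨F, hF, hγ⟩ : ∃ F : Frame, Q.form F.u (rot F.u) = 0 ∧ Q.form (rot F.u) (rot F.u) ≠ 0 := by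
    by_cases h : Q.form (rot F₀.u) (rot F₀.u) = 0
    · refine ⟨F₀.turn, ?_, ?_⟩
      · have : Q.form F₀.turn.u (rot F₀.turn.u) = -Q.form F₀.u (rot F₀.u) := by
          simp [form, Frame.turn]; ring
        rw [this, hF₀, neg_zero]
      · have : Q.form (rot F₀.turn.u) (rot F₀.turn.u) = Q.form F₀.u F₀.u := by
          simp [form, Frame.turn]
        rw [this]
        intro h0
        apply hQ
        rw [F₀.det_eq, hF₀, h, h0]; ring
    · exact ⟨F₀, hF₀, h⟩
  have hev := F.eval_eq Q
  have hdet := F.det_eq Q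
  simp only [hF] at hev hdet
  generalize Q.form F.u F.u = α at *
  generalize Q.form (rot F.u) (rot F.u) = γ at *
  generalize Q.lin F.O F.u = l at *
  generalize Q.lin F.O (rot F.u) = m at *
  generalize Q.eval F.O = n at *
  by_cases hα : α = 0
  · subst hα
    have hl : l ≠ 0 := by rintro rfl; apply hQ; rw [hdet]; ring
    right; left
    -- the frame is moved along its second axis so that the first axis is the axis of the parabola
    set G : Frame := ⟨F.pt 0 (-m / γ), F.u, F.unit⟩ with hG
    have hx : ∀ X, F.x X = G.x X := fun X => by
      simp only [Frame.x, hG, Frame.pt_zero, Frame.pt_one]; ring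
    have hy : ∀ X, F.y X = G.y X - m / γ := fun X => by
      simp only [Frame.y, hG, Frame.pt_zero, Frame.pt_one]
      linear_combination -(m / γ) * F.unit
    refine ⟨_, _, G.isParabolaWith (p := -l / (2 * γ)) (v := -(n - m ^ 2 / γ) / (2 * l))
      (div_ne_zero (neg_ne_zero.2 hl) (mul_ne_zero two_ne_zero hγ)) (fun X => ?_)⟩
    rw [zeros, mem_ofPred_eq, hev, hx, hy, ← sub_eq_zero (a := G.y X ^ 2)]
    have : G.y X ^ 2 - 4 * (-l / (2 * γ)) * (G.x X - -(n - m ^ 2 / γ) / (2 * l)) =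
      1 / γ * (0 * G.x X ^ 2 + 2 * 0 * G.x X * (G.y X - m / γ) + γ * (G.y X - m / γ) ^ 2 +
        2 * l * G.x X + 2 * m * (G.y X - m / γ) + n) := by field_simp; ring
    rw [this, mul_eq_zero, or_iff_right (one_div_ne_zero hγ)]
  -- the frame is moved to the centre
  · set G : Frame := ⟨F.pt (-l / α) (-m / γ), F.u, F.unit⟩ with hG
    have hx : ∀ X, F.x X = G.x X - l / α := fun X => by
      simp only [Frame.x, hG, Frame.pt_zero, Frame.pt_one]
      linear_combination -(l / α) * F.unit
    have hy : ∀ X, F.y X = G.y X - m / γ := fun X => by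
      simp only [Frame.y, hG, Frame.pt_zero, Frame.pt_one]
      linear_combination -(m / γ) * F.unit
    set k := n - l ^ 2 / α - m ^ 2 / γ with hk
    have hk0 : k ≠ 0 := by
      intro h0
      apply hQ
      have : Q.det = α * γ * k := by rw [hdet, hk]; field_simp; ring
      rw [this, h0, mul_zero]
    have hC : ∀ X, X ∈ Q.zeros ↔ α * G.x X ^ 2 + γ * G.y X ^ 2 + k = 0 := fun X => by
      rw [zeros, mem_ofPred_eq, hev, hx, hy]
      have : α * (G.x X - l / α) ^ 2 + 2 * 0 * (G.x X - l / α) * (G.y X - m / γ) +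
        γ * (G.y X - m / γ) ^ 2 + 2 * l * (G.x X - l / α) + 2 * m * (G.y X - m / γ) + n =
          α * G.x X ^ 2 + γ * G.y X ^ 2 + k := by rw [hk]; field_simp; ring
      rw [this]
    rcases lt_or_gt_of_ne hα with h | h
    · refine G.isConic_of_normal_form (α := -α) (γ := -γ) (k := -k) (by linarith)
        (neg_ne_zero.2 hγ) (neg_ne_zero.2 hk0) hne (fun X => ?_)
      rw [hC]; constructor <;> intro h <;> linarith
    · exact G.isConic_of_normal_form h hγ hk0 hne hC

lemma IsConic.exists_quadric {C : Set Plane} (h : IsConic C) :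
    ∃ Q : Quadric, Q.det ≠ 0 ∧ C = Q.zeros := by
  rcases h with h | h | h
  · obtain ⟨Q, h1, -, h2⟩ := h.exists_quadric; exact ⟨Q, h1, h2⟩
  · obtain ⟨Q, h1, -, h2⟩ := h.exists_quadric; exact ⟨Q, h1, h2⟩
  · obtain ⟨Q, h1, -, h2⟩ := h.exists_quadric; exact ⟨Q, h1, h2⟩

/-! ### The conic through five points -/

lemma Quadric.mem_zeros {Q : Quadric} {X : Plane} : X ∈ Q.zeros ↔ Q.eval X = 0 := Iff.rfl

lemma Quadric.zeros_smul (Q : Quadric) {s : ℝ} (hs : s ≠ 0) : (smul s Q).zeros = Q.zeros := by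
  ext X; rw [mem_zeros, mem_zeros, eval_smul, mul_eq_zero, or_iff_right hs]

/-- There is exactly one conic through five points, no three of them collinear. -/
lemma existsUnique_conic {P : Fin 5 → Plane} (hP : General P) :
    ∃! C : Set Plane, IsConic C ∧ ∀ i, P i ∈ C := by
  set Q := pascalConic (P 0) (P 1) (P 2) (P 3) (P 4) with hQ
  have hQP : ∀ i, Q.eval (P i) = 0 := by
    obtain ⟨h0, h1, h2, h3, h4⟩ := pascalConic_eval (A := P 0) (B := P 1) (C := P 2) (D := P 3)
      (E := P 4)
    intro i; fin_cases i <;> assumption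
  have hd : Q.det ≠ 0 := Quadric.det_ne_zero hP hQP <| pascalConic_ne_zero
    (hP 0 1 3 (by decide) (by decide) (by decide)) (hP 2 3 4 (by decide) (by decide) (by decide))
    (hP 0 1 4 (by decide) (by decide) (by decide)) (hP 0 1 2 (by decide) (by decide) (by decide))
  refine ⟨Q.zeros, ⟨Q.isConic_zeros hd ⟨P 0, hQP 0⟩, hQP⟩, ?_⟩
  rintro C ⟨hC, hCP⟩
  obtain ⟨R, hR, rfl⟩ := hC.exists_quadric
  obtain ⟨s, hs, rfl⟩ := Quadric.exists_smul_ne hP hQP hCP hd hR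
  exact Q.zeros_smul hs

namespace Quadric

variable {P : Fin 5 → Plane} {Q : Quadric}

lemma exists_smul_of_zeros_eq (hP : General P) (hQ : ∀ i, P i ∈ Q.zeros) (hd : Q.det ≠ 0)
    {R : Quadric} (hR : R.det ≠ 0) (h : Q.zeros = R.zeros) : ∃ s, s ≠ 0 ∧ R = smul s Q :=
  exists_smul_ne hP hQ (fun i => by have := hQ i; rwa [h] at this) hd hR

lemma isEllipse_imp (hP : General P) (hQ : ∀ i, P i ∈ Q.zeros) (hd : Q.det ≠ 0)
    (h : IsEllipse Q.zeros) : 0 < Q.disc := by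
  obtain ⟨R, h1, h2, h3⟩ := h.exists_quadric
  obtain ⟨s, hs, rfl⟩ := exists_smul_of_zeros_eq hP hQ hd h1 h3
  rw [disc_smul] at h2
  exact (pos_iff_pos_of_mul_pos h2).1 (by positivity)

lemma isHyperbola_imp (hP : General P) (hQ : ∀ i, P i ∈ Q.zeros) (hd : Q.det ≠ 0)
    (h : IsHyperbola Q.zeros) : Q.disc < 0 := by
  obtain ⟨R, h1, h2, h3⟩ := h.exists_quadric
  obtain ⟨s, hs, rfl⟩ := exists_smul_of_zeros_eq hP hQ hd h1 h3
  rw [disc_smul] at h2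
  by_contra! h0
  have : 0 ≤ s ^ 2 * Q.disc := by positivity
  linarith

lemma isParabola_imp (hP : General P) (hQ : ∀ i, P i ∈ Q.zeros) (hd : Q.det ≠ 0)
    (h : IsParabola Q.zeros) : Q.disc = 0 := by
  obtain ⟨R, h1, h2, h3⟩ := h.exists_quadric
  obtain ⟨s, hs, rfl⟩ := exists_smul_of_zeros_eq hP hQ hd h1 h3
  rw [disc_smul] at h2
  exact (mul_eq_zero.1 h2).resolve_left (by positivity)

lemma isEllipse_iff (hP : General P) (hQ : ∀ i, P i ∈ Q.zeros) (hd : Q.det ≠ 0) :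
    IsEllipse Q.zeros ↔ 0 < Q.disc := by
  refine ⟨isEllipse_imp hP hQ hd, fun h => ?_⟩
  rcases Q.isConic_zeros hd ⟨_, hQ 0⟩ with h' | h' | h'
  · exact h'
  · exact absurd (isParabola_imp hP hQ hd h') h.ne'
  · exact absurd (isHyperbola_imp hP hQ hd h') h.not_gt

lemma isHyperbola_iff (hP : General P) (hQ : ∀ i, P i ∈ Q.zeros) (hd : Q.det ≠ 0) :
    IsHyperbola Q.zeros ↔ Q.disc < 0 := by
  refine ⟨isHyperbola_imp hP hQ hd, fun h => ?_⟩
  rcases Q.isConic_zeros hd ⟨_, hQ 0⟩ with h' | h' | h'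
  · exact absurd (isEllipse_imp hP hQ hd h') h.not_gt
  · exact absurd (isParabola_imp hP hQ hd h') h.ne
  · exact h'

lemma isParabola_iff (hP : General P) (hQ : ∀ i, P i ∈ Q.zeros) (hd : Q.det ≠ 0) :
    IsParabola Q.zeros ↔ Q.disc = 0 := by
  refine ⟨isParabola_imp hP hQ hd, fun h => ?_⟩
  rcases Q.isConic_zeros hd ⟨_, hQ 0⟩ with h' | h' | h'
  · exact absurd (isEllipse_imp hP hQ hd h') h.not_gt
  · exact h'
  · exact absurd (isHyperbola_imp hP hQ hd h') h.not_lt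

lemma pascalSixth_iff (hP : General P) (hQ : ∀ i, P i ∈ Q.zeros) (hd : Q.det ≠ 0) {v S : Plane}
    (hv : v ≠ 0) : PascalSixth (P 0) (P 1) (P 2) (P 3) (P 4) (ln (P 0) v) S ↔
      ∃ t : ℝ, S = P 0 + t • v ∧ 2 * Q.lin (P 0) v + t * Q.form v v = 0 := by
  have h012 := hP 0 1 2 (by decide) (by decide) (by decide)
  have h013 := hP 0 1 3 (by decide) (by decide) (by decide)
  have h014 := hP 0 1 4 (by decide) (by decide) (by decide)
  have h234 := hP 2 3 4 (by decide) (by decide) (by decide)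
  rw [FivePointConic.pascalSixth_iff hv h012 h013 (hP 2 3 0 (by decide) (by decide) (by decide))
    (hP 1 2 4 (by decide) (by decide) (by decide)) (hP 3 4 1 (by decide) (by decide) (by decide))
    h234]
  have hW : ∀ i, (pascalConic (P 0) (P 1) (P 2) (P 3) (P 4)).eval (P i) = 0 := by
    obtain ⟨h0, h1, h2, h3, h4⟩ := pascalConic_eval (A := P 0) (B := P 1) (C := P 2) (D := P 3)
      (E := P 4)
    intro i; fin_cases i <;> assumption
  obtain ⟨s, hs, e⟩ := exists_smul_ne hP hQ hW hd (det_ne_zero hP hW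
    (pascalConic_ne_zero h013 h234 h014 h012))
  refine exists_congr fun t => and_congr_right fun _ => ?_
  rw [e, lin_smul, form_smul]
  rw [show 2 * (s * Q.lin (P 0) v) + t * (s * Q.form v v) =
    s * (2 * Q.lin (P 0) v + t * Q.form v v) by ring, mul_eq_zero, or_iff_right hs]

lemma existsUnique_pascalSixth (hP : General P) (hQ : ∀ i, P i ∈ Q.zeros) (hd : Q.det ≠ 0)
    {v : Plane} (hvv : Q.form v v ≠ 0) :
    ∃! S, PascalSixth (P 0) (P 1) (P 2) (P 3) (P 4) (ln (P 0) v) S := by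
  have hv : v ≠ 0 := by rintro rfl; simp [form] at hvv
  simp only [pascalSixth_iff hP hQ hd hv]
  refine ⟨_, ⟨-2 * Q.lin (P 0) v / Q.form v v, rfl, by field_simp; ring⟩, ?_⟩
  rintro S ⟨t, rfl, ht⟩
  have : t = -2 * Q.lin (P 0) v / Q.form v v := by rw [eq_div_iff hvv]; linarith
  rw [this]

/-- The sixth point is the second end of the chord, and the midpoint of the chord lies on the
diameter conjugate to the direction of the chord. -/
lemma pascalSixth_chord (hP : General P) (hQ : ∀ i, P i ∈ Q.zeros) (hd : Q.det ≠ 0)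
    {v S : Plane} (hvv : Q.form v v ≠ 0)
    (h : PascalSixth (P 0) (P 1) (P 2) (P 3) (P 4) (ln (P 0) v) S) :
    (ln (P 0) v : Set Plane) ∩ Q.zeros = {P 0, S} ∧ Q.lin (midpoint ℝ (P 0) S) v = 0 ∧
      S ∈ ln (P 0) v := by
  have hv : v ≠ 0 := by rintro rfl; simp [form] at hvv
  rw [pascalSixth_iff hP hQ hd hv] at h
  obtain ⟨t, rfl, ht⟩ := h
  have h0 : Q.eval (P 0) = 0 := hQ 0
  refine ⟨?_, ?_, mem_ln_iff.2 ⟨t, rfl⟩⟩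
  · ext X
    simp only [mem_inter_iff, SetLike.mem_coe, mem_ln_iff, mem_insert_iff, mem_singleton_iff,
      mem_zeros]
    constructor
    · rintro ⟨⟨r, rfl⟩, hX⟩
      rw [eval_add, lin_smul_right, form_smul_left, form_smul_right, h0] at hX
      have : r * Q.form v v * (r - t) = 0 := by linear_combination hX - r * ht
      rcases mul_eq_zero.1 this with h | h
      · left; rw [(mul_eq_zero.1 h).resolve_right hvv]; simp
      · right; rw [sub_eq_zero.1 h]
    · rintro (rfl | rfl)
      · exact ⟨⟨0, by simp⟩, h0⟩
      · refine ⟨⟨t, rfl⟩, ?_⟩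
        rw [eval_add, lin_smul_right, form_smul_left, form_smul_right, h0]
        linear_combination t * ht
  · have : midpoint ℝ (P 0) (P 0 + t • v) = P 0 + (t / 2) • v := by
      apply plane_ext <;> simp <;> ring
    rw [this, lin_add, form_smul_left]
    linarith

/-! ### Diameters, conjugate directions and the centre -/

/-- A direction vector conjugate to `v`. -/
def conj (Q : Quadric) (v : Plane) : Plane :=
  !₂[-(Q.b * v 0 + Q.c * v 1), Q.a * v 0 + Q.b * v 1]

lemma crs_conj_left (Q : Quadric) (v z : Plane) : crs (Q.conj v) z = -Q.form z v := by
  simp [crs, conj, form]; ring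

lemma crs_conj (Q : Quadric) (v z : Plane) : crs v (Q.conj z) = Q.form v z := by
  simp [crs, conj, form]; ring

lemma form_conj (Q : Quadric) (v : Plane) : Q.form v (Q.conj v) = 0 := by
  simp [conj, form]; ring

lemma form_conj_conj (Q : Quadric) (v : Plane) :
    Q.form (Q.conj v) (Q.conj v) = Q.disc * Q.form v v := by
  simp [conj, form, disc]; ring

lemma crs_conj_conj (Q : Quadric) (v w : Plane) :
    crs (Q.conj v) (Q.conj w) = Q.disc * crs v w := by
  simp [conj, crs, disc]; ring

lemma conj_ne_zero {v : Plane} (h : Q.form v v ≠ 0) : Q.conj v ≠ 0 := by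
  intro h0
  have := Q.crs_conj v v
  rw [h0] at this
  apply h; rw [← this]; simp [crs]

/-- The line of the midpoints of the chords of direction `v`. -/
lemma mem_diameter {v M X : Plane} (h : Q.form v v ≠ 0) (hM : Q.lin M v = 0) :
    X ∈ ln M (Q.conj v) ↔ Q.lin X v = 0 := by
  rw [mem_ln (conj_ne_zero h), crs_conj_left, Q.lin_eq M X v, hM, zero_add, neg_eq_zero]

lemma line_eq_diameter {v M N : Plane} (h : Q.form v v ≠ 0) (hM : Q.lin M v = 0)
    (hN : Q.lin N v = 0) (hMN : M ≠ N) : line[ℝ, M, N] = ln M (Q.conj v) := by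
  rw [line_eq_ln, ln_eq_ln_iff (sub_ne_zero.2 hMN.symm) (conj_ne_zero h)]
  refine ⟨?_, by simp [crs]⟩
  have := (mem_diameter h hM).2 hN
  rw [mem_ln (conj_ne_zero h)] at this
  simp only [crs] at *; linarith

lemma lin_midpoint {X Y : Plane} (hX : Q.eval X = 0) (hY : Q.eval Y = 0) :
    Q.lin (midpoint ℝ X Y) (Y - X) = 0 := by
  have : Q.eval Y - Q.eval X = 2 * Q.lin (midpoint ℝ X Y) (Y - X) := by
    simp [lin, form, eval]; ring
  rw [hX, hY] at this; linarith

lemma isDiameterConj_ln {v M A : Plane} (h : Q.form v v ≠ 0) (hM : Q.lin M v = 0) :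
    IsDiameterConj Q.zeros (ln M (Q.conj v)) (ln A v) := by
  refine ⟨isLine_ln _ (conj_ne_zero h), fun X hX Y hY hXY hv => ?_⟩
  rw [mem_diameter h hM]
  rw [direction_ln, Submodule.mem_span_singleton] at hv
  obtain ⟨r, hr⟩ := hv
  have hr0 : r ≠ 0 := by
    rintro rfl; rw [zero_smul] at hr; exact hXY (sub_eq_zero.1 hr.symm).symm
  have := lin_midpoint hX hY
  rw [← hr, lin_smul_right] at this
  exact (mul_eq_zero.1 this).resolve_left hr0

/-- The point `O` is the centre of the quadric: the first derivative vanishes there. -/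
def IsCtr (Q : Quadric) (O : Plane) : Prop := ∀ v, Q.lin O v = 0

lemma isCtr_of_basis {O v w : Plane} (h : crs v w ≠ 0) (hv : Q.lin O v = 0) (hw : Q.lin O w = 0) :
    Q.IsCtr O := by
  intro z
  rw [eq_basis h z, lin_add_right, lin_smul_right, lin_smul_right, hv, hw]; ring

lemma det_eq_of_basis {O v w : Plane} (h : crs v w ≠ 0) (hv : Q.lin O v = 0)
    (hw : Q.lin O w = 0) : Q.det = Q.disc * Q.eval O := by
  have h1 := Q.det_basis O v w
  have h2 := Q.disc_basis v w
  rw [hv, hw] at h1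
  have h3 : crs v w ^ 2 * (Q.det - Q.disc * Q.eval O) = 0 := by
    linear_combination Q.eval O * h2 - h1
  have := (mul_eq_zero.1 h3).resolve_left (pow_ne_zero 2 h)
  linarith

lemma IsCtr.eval_add {O : Plane} (hO : Q.IsCtr O) (v : Plane) :
    Q.eval (O + v) = Q.eval O + Q.form v v := by
  rw [Quadric.eval_add, hO v]; ring

lemma IsCtr.eval_eq {O : Plane} (hO : Q.IsCtr O) (X : Plane) :
    Q.eval X = Q.eval O + Q.form (X - O) (X - O) := by
  rw [← hO.eval_add, add_sub_cancel]

lemma IsCtr.det_eq {O : Plane} (hO : Q.IsCtr O) : Q.det = Q.disc * Q.eval O :=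
  det_eq_of_basis (v := !₂[1, 0]) (w := !₂[0, 1]) (by simp [crs]) (hO _) (hO _)

lemma IsCtr.eval_ne_zero {O : Plane} (hO : Q.IsCtr O) (hd : Q.det ≠ 0) : Q.eval O ≠ 0 := by
  intro h; apply hd; rw [hO.det_eq, h, mul_zero]

lemma IsCtr.disc_ne_zero {O : Plane} (hO : Q.IsCtr O) (hd : Q.det ≠ 0) : Q.disc ≠ 0 := by
  intro h; apply hd; rw [hO.det_eq, h, zero_mul]

lemma IsCtr.isCenter {O : Plane} (hO : Q.IsCtr O) : IsCenter Q.zeros O := by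
  intro X hX
  rw [mem_zeros, hO.eval_eq] at *
  rw [← hX, pointMirror_eq]
  have : Q.form (O + O - X - O) (O + O - X - O) = Q.form (X - O) (X - O) := by
    simp only [form, PiLp.sub_apply, PiLp.add_apply]; ring
  rw [this]

/-- A nondegenerate form has no nonzero vector orthogonal to a basis. -/
lemma eq_zero_of_form {v w z : Plane} (hd : Q.disc ≠ 0) (h : crs v w ≠ 0) (hv : Q.form v z = 0)
    (hw : Q.form w z = 0) : z = 0 := by
  have h1 : crs (Q.conj v) z = 0 := by rw [crs_conj_left, form_comm, hv, neg_zero]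
  have h2 : crs (Q.conj w) z = 0 := by rw [crs_conj_left, form_comm, hw, neg_zero]
  exact eq_zero_of_crs (by rw [crs_conj_conj]; exact mul_ne_zero hd h) h1 h2

/-- A line through the centre of direction `w` bisects the chords of the conjugate direction `v`. -/
lemma IsCtr.isDiameterConj {O v w A : Plane} (hO : Q.IsCtr O) (hvv : Q.form v v ≠ 0)
    (hvw : Q.form v w = 0) (hw : w ≠ 0) : IsDiameterConj Q.zeros (ln O w) (ln A v) := by
  have : ln O w = ln O (Q.conj v) := by
    rw [ln_eq_ln_iff hw (conj_ne_zero hvv), crs_conj, form_comm]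
    exact ⟨hvw, by simp [crs]⟩
  rw [this]
  exact isDiameterConj_ln hvv (hO v)

lemma IsCtr.isConjugatePair {O v : Plane} (hO : Q.IsCtr O) (hd : Q.det ≠ 0)
    (hvv : Q.form v v ≠ 0) : IsConjugatePair Q.zeros (ln O (Q.conj v)) (ln O v) := by
  have hv : v ≠ 0 := by rintro rfl; simp [form] at hvv
  refine ⟨isDiameterConj_ln hvv (hO v), hO.isDiameterConj ?_ ?_ hv⟩
  · rw [form_conj_conj]; exact mul_ne_zero (hO.disc_ne_zero hd) hvv
  · rw [form_comm, form_conj]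

/-- Two consecutive chords `X Y` and `Y Z` have conjugate directions if and only if `X Z` is a
diameter. -/
lemma IsCtr.form_chords_eq_zero_iff {O X Y Z : Plane} (hO : Q.IsCtr O) (hd : Q.det ≠ 0)
    (hX : Q.eval X = 0) (hY : Q.eval Y = 0) (hZ : Q.eval Z = 0) (h : crs (Y - X) (Z - X) ≠ 0) :
    Q.form (Z - Y) (Y - X) = 0 ↔ midpoint ℝ X Z = O := by
  have h1 := lin_midpoint hX hY
  have h2 := lin_midpoint hY hZ
  rw [Q.lin_eq O, hO, zero_add] at h1 h2
  have e1 : Q.form (midpoint ℝ X Z - O) (Y - X) = Q.form (Z - Y) (Y - X) / 2 := by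
    have : Q.form (midpoint ℝ X Z - O) (Y - X) - Q.form (Z - Y) (Y - X) / 2 =
      Q.form (midpoint ℝ X Y - O) (Y - X) := by simp [form]; ring
    rw [h1] at this; linarith
  have e2 : Q.form (midpoint ℝ X Z - O) (Z - Y) = -Q.form (Z - Y) (Y - X) / 2 := by
    have : Q.form (midpoint ℝ X Z - O) (Z - Y) + Q.form (Z - Y) (Y - X) / 2 =
      Q.form (midpoint ℝ Y Z - O) (Z - Y) := by simp [form]; ring
    rw [h2] at this; linarith
  constructor
  · intro h0
    rw [h0] at e1 e2
    rw [← sub_eq_zero]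
    refine eq_zero_of_form (hO.disc_ne_zero hd) (v := Y - X) (w := Z - Y) ?_
      (by rw [form_comm, e1]; simp) (by rw [form_comm, e2]; simp)
    rw [← sub_ne_zero] at h ⊢
    convert h using 1
    simp [crs]; ring
  · intro h0
    rw [h0, sub_self] at e1
    have : Q.form 0 (Y - X) = 0 := by simp [form]
    rw [this] at e1; linarith

end Quadric

/-! ### Affinities with a given axis -/

/-- The linear map that fixes the unit vector `u` and sends the normal vector `rot u` to
`m u + n rot u`. -/
noncomputable def shear (u : Plane) (m n : ℝ) : Plane →ₗ[ℝ] Plane where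
  toFun v := v + crs u v • (m • u + (n - 1) • rot u)
  map_add' v w := by apply plane_ext <;> simp [crs] <;> ring
  map_smul' r v := by apply plane_ext <;> simp [crs] <;> ring

lemma shear_comp {u : Plane} (hu : u 0 * u 0 + u 1 * u 1 = 1) {m n m' n' : ℝ}
    (h1 : n * n' = 1) (h2 : m' + m * n' = 0) : shear u m n ∘ₗ shear u m' n' = LinearMap.id := by
  have key : ∀ v : Plane, crs u (v + crs u v • (m' • u + (n' - 1) • rot u)) = n' * crs u v := by
    intro v
    simp only [crs, PiLp.add_apply, PiLp.smul_apply, smul_eq_mul, rot_zero, rot_one]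
    linear_combination (n' - 1) * (u 0 * v 1 - u 1 * v 0) * hu
  ext v i
  have : (shear u m n ∘ₗ shear u m' n') v = v + crs u v • (m' • u + (n' - 1) • rot u) +
      crs u (v + crs u v • (m' • u + (n' - 1) • rot u)) • (m • u + (n - 1) • rot u) := rfl
  rw [this, key]
  fin_cases i
  · simp only [PiLp.add_apply, PiLp.smul_apply, smul_eq_mul, rot_zero, LinearMap.id_apply,
      Fin.zero_eta]
    linear_combination crs u v * u 0 * h2 - crs u v * u 1 * h1
  · simp only [PiLp.add_apply, PiLp.smul_apply, smul_eq_mul, rot_one, LinearMap.id_apply,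
      Fin.mk_one]
    linear_combination crs u v * u 1 * h2 + crs u v * u 0 * h1

namespace Frame

variable (F : Frame)

/-- The affinity `(x, y) ↦ (x + m y, n y)` whose axis is the first axis of the frame. -/
noncomputable def affinity (m n : ℝ) (hn : n ≠ 0) : Plane ≃ᵃ[ℝ] Plane :=
  AffineEquiv.mk' (fun X => F.O + shear F.u m n (X - F.O))
    (LinearEquiv.ofLinearMap (shear F.u m n) (shear F.u (-m / n) n⁻¹)
      (shear_comp F.unit (mul_inv_cancel₀ hn) (by field_simp; ring))
      (shear_comp F.unit (inv_mul_cancel₀ hn) (by field_simp; ring))) F.O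
    (fun X => by simp [add_comm])

lemma affinity_apply (m n : ℝ) (hn : n ≠ 0) (X : Plane) :
    F.affinity m n hn X = F.pt (F.x X + m * F.y X) (n * F.y X) := by
  have h : F.affinity m n hn X =
    F.O + ((X - F.O) + crs F.u (X - F.O) • (m • F.u + (n - 1) • rot F.u)) := rfl
  have hu := F.unit
  rw [h]
  apply plane_ext
  · simp only [PiLp.add_apply, PiLp.sub_apply, PiLp.smul_apply, smul_eq_mul, rot_zero, crs, pt_zero,
      x, y]
    linear_combination -(X 0 - F.O 0) * hu
  · simp only [PiLp.add_apply, PiLp.sub_apply, PiLp.smul_apply, smul_eq_mul, rot_one, crs, pt_one,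
      x, y]
    linear_combination -(X 1 - F.O 1) * hu

/-- The form of an affinity whose axis is the first axis of the frame. -/
lemma exists_of_isAffinity {α : Plane ≃ᵃ[ℝ] Plane} (h : IsAffinity F.axis α) :
    ∃ m n : ℝ, n ≠ 0 ∧ ∀ X, α X = F.pt (F.x X + m * F.y X) (n * F.y X) := by
  have hO : α F.O = F.O := h _ (F.mem_axis.2 F.y_O)
  have hu : α.linear F.u = F.u := by
    have := affinity_apply_add α F.O F.u
    have h1 : α (F.O + F.u) = F.O + F.u := by
      apply h; rw [axis, mem_ln_iff]; exact ⟨1, by simp⟩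
    rw [hO, h1] at this
    exact (add_left_cancel this).symm
  have hr : α.linear (rot F.u) =
      F.x (F.O + α.linear (rot F.u)) • F.u + F.y (F.O + α.linear (rot F.u)) • rot F.u := by
    have := F.pt_x_y (F.O + α.linear (rot F.u))
    rw [pt, add_assoc] at this
    exact (add_left_cancel this).symm
  set m := F.x (F.O + α.linear (rot F.u))
  set n := F.y (F.O + α.linear (rot F.u))
  refine ⟨m, n, ?_, fun X => ?_⟩
  · intro hn
    rw [hn, zero_smul, add_zero] at hr
    have h2 : α.linear (rot F.u - m • F.u) = α.linear 0 := by
      rw [map_sub, map_smul, hu, hr, sub_self, map_zero]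
    have h3 := α.linear.injective h2
    have h4 := F.crs_u_rot
    rw [sub_eq_zero.1 h3] at h4
    simp [crs] at h4
    linarith
  · conv_lhs => rw [← F.pt_x_y X, pt, affinity_apply_add, affinity_apply_add, map_smul, map_smul,
      hO, hu, hr]
    simp only [pt, smul_add, add_smul, smul_smul]
    rw [mul_comm (F.y X) m, mul_comm (F.y X) n]
    abel

lemma isAffinity_affinity (m n : ℝ) (hn : n ≠ 0) : IsAffinity F.axis (F.affinity m n hn) := by
  intro X hX
  rw [F.mem_axis] at hX
  rw [affinity_apply, hX, mul_zero, mul_zero, add_zero]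
  conv_rhs => rw [← F.pt_x_y X, hX]

lemma isOrthAffinity_affinity (n : ℝ) (hn : n ≠ 0) : IsOrthAffinity F.axis (F.affinity 0 n hn) := by
  refine ⟨F.isAffinity_affinity 0 n hn, fun X => ?_⟩
  rw [axis, direction_ln, mem_span_orthogonal_iff, F.dotp_u, affinity_apply, x_pt]
  ring

lemma exists_of_isOrthAffinity {α : Plane ≃ᵃ[ℝ] Plane} (h : IsOrthAffinity F.axis α) :
    ∃ n : ℝ, n ≠ 0 ∧ ∀ X, α X = F.pt (F.x X) (n * F.y X) := by
  obtain ⟨m, n, hn, hα⟩ := F.exists_of_isAffinity h.1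
  have hm := h.2 (F.pt 0 1)
  rw [axis, direction_ln, mem_span_orthogonal_iff, F.dotp_u, hα] at hm
  simp at hm
  refine ⟨n, hn, fun X => ?_⟩
  rw [hα, hm]; ring_nf

/-- The frame with origin `A` whose first axis is the perpendicular at `A` to the first axis of
`F`. -/
noncomputable def perpFrame (A : Plane) : Frame where
  O := A
  u := rot F.u
  unit := F.turn.unit

lemma perpFrame_axis (A : Plane) : perpThrough A F.axis = (F.perpFrame A).axis := by
  rw [axis, perpThrough_ln _ _ F.u_ne_zero]; rfl

lemma perpFrame_x (A X : Plane) : (F.perpFrame A).x X = F.y X - F.y A := by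
  simp only [x, y, perpFrame, rot_zero, rot_one]; ring

lemma perpFrame_y (A X : Plane) : (F.perpFrame A).y X = -(F.x X - F.x A) := by
  simp only [x, y, perpFrame, rot_zero, rot_one]; ring

lemma exists_of_isOrthAffinity_perp {α : Plane ≃ᵃ[ℝ] Plane} {A : Plane}
    (h : IsOrthAffinity (perpThrough A F.axis) α) :
    ∃ n : ℝ, n ≠ 0 ∧ ∀ X, F.x (α X) = F.x A + n * (F.x X - F.x A) ∧ F.y (α X) = F.y X := by
  rw [perpFrame_axis] at h
  obtain ⟨n, hn, hα⟩ := (F.perpFrame A).exists_of_isOrthAffinity h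
  refine ⟨n, hn, fun X => ?_⟩
  have h1 := congrArg (F.perpFrame A).x (hα X)
  have h2 := congrArg (F.perpFrame A).y (hα X)
  rw [x_pt, perpFrame_x, perpFrame_x] at h1
  rw [y_pt, perpFrame_y, perpFrame_y] at h2
  constructor <;> linarith

lemma exists_isOrthAffinity_perp (A : Plane) {n : ℝ} (hn : n ≠ 0) :
    ∃ α : Plane ≃ᵃ[ℝ] Plane, IsOrthAffinity (perpThrough A F.axis) α ∧
      ∀ X, F.x (α X) = F.x A + n * (F.x X - F.x A) ∧ F.y (α X) = F.y X := by
  refine ⟨(F.perpFrame A).affinity 0 n hn, ?_, fun X => ?_⟩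
  · rw [perpFrame_axis]; exact isOrthAffinity_affinity _ n hn
  · have h1 := congrArg (F.perpFrame A).x ((F.perpFrame A).affinity_apply 0 n hn X)
    have h2 := congrArg (F.perpFrame A).y ((F.perpFrame A).affinity_apply 0 n hn X)
    rw [x_pt, perpFrame_x, perpFrame_x] at h1
    rw [y_pt, perpFrame_y, perpFrame_y] at h2
    constructor <;> linarith

lemma isMirror_line {A B X Y : Plane} (h : A ≠ B) : IsMirror line[ℝ, A, B] X Y ↔
    (F.x B - F.x A) * ((F.y X + F.y Y) / 2 - F.y A)
      - (F.y B - F.y A) * ((F.x X + F.x Y) / 2 - F.x A) = 0 ∧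
    (F.x B - F.x A) * (F.x Y - F.x X) + (F.y B - F.y A) * (F.y Y - F.y X) = 0 := by
  rw [line_eq_ln, isMirror_ln (sub_ne_zero.2 h.symm), F.crs_sub, F.dotp_sub, x_midpoint, y_midpoint]

end Frame

/-! ### The parabola -/

/-- Among five objects three agree as to the property `p`. -/
lemma exists_three (p : Fin 5 → Prop) : ∃ i j k, i ≠ j ∧ i ≠ k ∧ j ≠ k ∧
    (p i ∧ p j ∧ p k ∨ ¬ p i ∧ ¬ p j ∧ ¬ p k) := by
  by_cases h0 : p 0 <;> by_cases h1 : p 1 <;> by_cases h2 : p 2 <;> by_cases h3 : p 3 <;>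
    by_cases h4 : p 4
  all_goals first
    | exact ⟨0, 1, 2, by decide, by decide, by decide, by tauto⟩
    | exact ⟨0, 1, 3, by decide, by decide, by decide, by tauto⟩
    | exact ⟨0, 1, 4, by decide, by decide, by decide, by tauto⟩
    | exact ⟨0, 2, 3, by decide, by decide, by decide, by tauto⟩
    | exact ⟨0, 2, 4, by decide, by decide, by decide, by tauto⟩
    | exact ⟨0, 3, 4, by decide, by decide, by decide, by tauto⟩
    | exact ⟨1, 2, 3, by decide, by decide, by decide, by tauto⟩
    | exact ⟨1, 2, 4, by decide, by decide, by decide, by tauto⟩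
    | exact ⟨1, 3, 4, by decide, by decide, by decide, by tauto⟩
    | exact ⟨2, 3, 4, by decide, by decide, by decide, by tauto⟩

/-- The equation of a conic in a frame one of whose axes is an axis of symmetry. -/
lemma Frame.form_eq_zero_of_isAxis (F : Frame) {P : Fin 5 → Plane} {Q : Quadric} (hP : General P)
    (hQ : ∀ i, P i ∈ Q.zeros) (h : IsAxis Q.zeros F.axis) :
    Q.form F.u (rot F.u) = 0 ∧ Q.lin F.O (rot F.u) = 0 := by
  have key : ∀ i, F.y (P i) = 0 ∨
      Q.form F.u (rot F.u) * F.x (P i) + Q.lin F.O (rot F.u) = 0 := by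
    intro i
    have h1 : F.pt (F.x (P i)) (-F.y (P i)) ∈ Q.zeros :=
      h.2 _ (hQ i) _ (F.isMirror_axis.2 ⟨by simp, by simp⟩)
    have h2 := hQ i
    rw [Quadric.mem_zeros, F.eval_eq] at h1 h2
    rw [x_pt, y_pt] at h1
    rw [← mul_eq_zero]
    linear_combination h2 / 4 - h1 / 4
  by_contra hne
  obtain ⟨i, j, k, hij, hik, hjk, h3⟩ := exists_three fun i => F.y (P i) = 0
  apply hP i j k hij hik hjk
  rw [F.crs_sub]
  rcases h3 with ⟨h1, h2, h3⟩ | ⟨h1, h2, h3⟩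
  · rw [h1, h2, h3]; ring
  · have e1 := (key i).resolve_left h1
    have e2 := (key j).resolve_left h2
    have e3 := (key k).resolve_left h3
    by_cases hβ : Q.form F.u (rot F.u) = 0
    · rw [hβ] at e1; exact absurd ⟨hβ, by linarith⟩ hne
    · have d1 : F.x (P j) - F.x (P i) = 0 :=
        (mul_eq_zero.1 (by linear_combination e2 - e1 :
          Q.form F.u (rot F.u) * (F.x (P j) - F.x (P i)) = 0)).resolve_left hβ
      have d2 : F.x (P k) - F.x (P i) = 0 :=
        (mul_eq_zero.1 (by linear_combination e3 - e1 :
          Q.form F.u (rot F.u) * (F.x (P k) - F.x (P i)) = 0)).resolve_left hβ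
      rw [d1, d2]; ring

namespace Frame

variable (F : Frame) {C : Set Plane} {p v : ℝ}

lemma parabola_isAxis (hC : ∀ X, X ∈ C ↔ F.y X ^ 2 = 4 * p * (F.x X - v)) : IsAxis C F.axis := by
  refine ⟨F.isLine_axis, fun X hX Y hXY => ?_⟩
  rw [F.isMirror_axis] at hXY
  rw [hC] at *
  rw [hXY.1, hXY.2, neg_sq, hX]

lemma exists_pair_of_general {P : Fin 5 → Plane} (hP : General P) :
    ∃ i j, P i ∉ F.axis ∧ P j ∉ perpThrough (P i) F.axis := by
  simp only [F.mem_axis, F.mem_perpThrough]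
  obtain ⟨i, hi⟩ : ∃ i, F.y (P i) ≠ 0 := by
    by_contra! h
    apply hP 0 1 2 (by decide) (by decide) (by decide)
    rw [F.crs_sub, h, h, h]; ring
  refine ⟨i, ?_⟩
  by_contra! h
  apply hP 0 1 2 (by decide) (by decide) (by decide)
  have := fun j => h j hi
  rw [F.crs_sub, this 0, this 1, this 2]; ring

/-- The construction of focus and directrix of a parabola can be carried out. -/
lemma parabola_exists_steps (hp : p ≠ 0)
    (hC : ∀ X, X ∈ C ↔ F.y X ^ 2 = 4 * p * (F.x X - v)) {A B : Plane} (hA : A ∈ C) (hB : B ∈ C)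
    (hAt : A ∉ F.axis) {F' : Plane} (hF' : F' ∈ F.axis) :
    ∃ d' D' V' Q' α V T R G d, ParabolaSteps F.axis A B F' d' D' V' Q' α V T R G d := by
  rw [F.mem_axis] at hAt hF'
  rw [hC] at hA hB
  have hF'eq : F' = F.pt (F.x F') 0 := by rw [← hF', F.pt_x_y]
  set f := F.x F'
  -- the directrix `x = e` is chosen at the distance `|A F'|` from `A`, so that the auxiliary
  -- parabola `y² = 4 p' (x - v')` passes through `A`
  set e := F.x A + √((F.x A - f) ^ 2 + F.y A ^ 2) with he
  have hsq : (F.x A - e) ^ 2 = (F.x A - f) ^ 2 + F.y A ^ 2 := by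
    rw [he, sub_add_cancel_left, neg_sq, Real.sq_sqrt (by positivity)]
  have hfe : f ≠ e := by
    intro h; rw [← h] at hsq
    exact hAt (pow_eq_zero_iff two_ne_zero |>.1 (by linarith))
  set p' := (f - e) / 2 with hp'
  have hp'0 : p' ≠ 0 := div_ne_zero (sub_ne_zero.2 hfe) two_ne_zero
  set v' := (f + e) / 2 with hv'
  -- the ratio that carries the parabola `x - v' = y² / (4 p')` to `x - v = y² / (4 p)`
  have hk : p' / p ≠ 0 := div_ne_zero hp'0 hp
  obtain ⟨α, hα, hαX⟩ := F.exists_isOrthAffinity_perp A hk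
  have hv : F.x A ≠ v := by
    intro h; rw [h, sub_self, mul_zero] at hA
    exact hAt (pow_eq_zero_iff two_ne_zero |>.1 hA)
  have hA' : F.y A ^ 2 = 4 * p' * (F.x A - v') := by rw [hp', hv']; linarith
  set Q' := F.pt (v' + F.y B ^ 2 / (4 * p')) (F.y B) with hQ'
  set V' := F.pt v' 0 with hV'
  have hVx : F.x (α V') = v := by
    rw [(hαX V').1, hV', x_pt]
    have h1 : F.x A = F.y A ^ 2 / (4 * p') + v' := by rw [hA']; field_simp; ring
    have h2 : F.x A = F.y A ^ 2 / (4 * p) + v := by rw [hA]; field_simp; ring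
    have : v' - F.x A = -(F.y A ^ 2 / (4 * p')) := by linarith
    rw [this, h2]; field_simp; ring
  have hVy : F.y (α V') = 0 := by rw [(hαX V').2, hV', y_pt]
  refine ⟨perpThrough (F.pt e 0) F.axis, {X | F.y X ^ 2 = 4 * p' * (F.x X - v')}, V', Q', α, α V',
    F.pt (F.x A) 0, F.pt v (F.y A / 2), F.pt (v + p) 0,
    perpThrough (pointMirror (α V') (F.pt (v + p) 0)) F.axis, ?_⟩
  have hRA : F.pt v (F.y A / 2) ≠ A := by
    intro h; apply hv; rw [← h, x_pt]
  constructor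
  · rw [F.mem_axis, hF']
  · rw [perpFrame_axis, axis, axis, perp_ln_iff]
    simp [perpFrame, dotp]; ring
  · rw [hF'eq, F.isParabolaWith_perp_iff]
    refine ⟨hfe, fun X => ?_⟩
    rw [mem_ofPred_eq, hp', hv']
    constructor <;> intro h <;> linarith
  · exact hA'
  · refine ⟨?_, ?_⟩
    · rw [mem_ofPred_eq, hV', x_pt, y_pt]; ring
    · rw [F.mem_axis, hV', y_pt]
  · refine ⟨?_, ?_⟩
    · rw [mem_ofPred_eq, hQ', x_pt, y_pt]; field_simp; ring
    · rw [F.mem_parallelThrough, hQ', y_pt]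
  · exact hα
  · apply F.ext_xy
    · rw [(hαX Q').1, hQ', x_pt]
      have h1 : F.x A = F.y A ^ 2 / (4 * p') + v' := by rw [hA']; field_simp; ring
      have h2 : F.x A = F.y A ^ 2 / (4 * p) + v := by rw [hA]; field_simp; ring
      have h3 : F.x B = F.y B ^ 2 / (4 * p) + v := by rw [hB]; field_simp; ring
      have : v' + F.y B ^ 2 / (4 * p') - F.x A = (F.y B ^ 2 - F.y A ^ 2) / (4 * p') := by
        rw [h1]; ring
      rw [this, h2, h3]; field_simp; ring
    · rw [(hαX Q').2, hQ', y_pt]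
  · rfl
  · refine ⟨?_, ?_⟩
    · rw [F.mem_axis, y_pt]
    · rw [F.mem_perpThrough, x_pt]
  · refine ⟨?_, ?_⟩
    · rw [F.mem_perpThrough, x_pt, hVx]
    · rw [F.mem_parallelThrough, y_pt, y_midpoint, y_pt, add_zero]
  -- `R A` is the tangent at `A`, which is the perpendicular bisector of the focus and of the foot
  -- of `A` on the directrix
  · refine ⟨by rw [F.mem_axis, y_pt], F.pt (v - p) (F.y A), ?_, ?_⟩
    · rw [F.mem_parallelThrough, y_pt]
    · rw [F.isMirror_line hRA]
      simp only [x_pt, y_pt]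
      constructor
      · ring
      · linear_combination -hA / 2
  · rfl

/-- Every way of carrying out the construction gives the focus and the directrix. -/
lemma parabola_of_steps (hp : p ≠ 0)
    (hC : ∀ X, X ∈ C ↔ F.y X ^ 2 = 4 * p * (F.x X - v)) {A B : Plane} (hA : A ∈ C) (hB : B ∈ C)
    (hAt : A ∉ F.axis) (hAB : B ∉ perpThrough A F.axis) {F' : Plane} {d' : Sub} {D' : Set Plane}
    {V' Q' : Plane} {α : Plane ≃ᵃ[ℝ] Plane} {V T R G : Plane} {d : Sub}
    (h : ParabolaSteps F.axis A B F' d' D' V' Q' α V T R G d) :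
    α '' D' = C ∧ V ∈ C ∧ IsParabolaWith C G d := by
  rw [F.mem_axis] at hAt
  rw [F.mem_perpThrough] at hAB
  rw [hC] at hA hB
  obtain ⟨hF', hd't, hpar, hAD, ⟨hV'D, hV't⟩, ⟨hQ'D, hQ'⟩, hα, hαQ, rfl, ⟨hT, hTA⟩, ⟨hR1, hR2⟩,
    ⟨hG, X, hX, hmir⟩, rfl⟩ := h
  rw [F.mem_axis] at hF' hV't hT hG
  rw [F.mem_parallelThrough] at hQ' hR2 hX
  rw [F.mem_perpThrough] at hTA hR1
  -- the directrix of the auxiliary parabola is the line `x = e`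
  obtain ⟨e, rfl⟩ : ∃ e, d' = perpThrough (F.pt e 0) F.axis := by
    obtain ⟨E, w, hw, rfl⟩ := hpar.1.exists_eq
    refine ⟨F.x E, ?_⟩
    rw [axis, perp_ln_iff] at hd't
    rw [axis, perpThrough_ln _ _ F.u_ne_zero, ln_eq_ln_iff hw (rot_ne_zero F.u_ne_zero)]
    refine ⟨?_, ?_⟩
    · simp only [crs, dotp, rot_zero, rot_one] at *; linarith
    · have hw' : dotp F.u w = 0 := by simp only [dotp] at *; linarith
      obtain ⟨r, rfl⟩ := (dotp_eq_zero_iff F.u_ne_zero).1 hw'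
      have h1 : crs (r • rot F.u) (F.pt (F.x E) 0 - E) =
        -r * dotp F.u (F.pt (F.x E) 0 - E) := by
        simp only [crs, dotp, PiLp.smul_apply, rot_zero, rot_one, smul_eq_mul]; ring
      rw [h1, F.dotp_u, x_pt, sub_self, mul_zero]
  have hF'eq : F' = F.pt (F.x F') 0 := by rw [← hF', F.pt_x_y]
  rw [hF'eq, F.isParabolaWith_perp_iff] at hpar
  obtain ⟨hfe, hD⟩ := hpar
  rw [hD] at hAD hV'D hQ'D
  generalize F.x F' = f at *
  obtain ⟨k, hk, hαX⟩ := F.exists_of_isOrthAffinity_perp hα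
  have hfe' := sub_ne_zero.2 hfe
  have hQx := (hαX Q').1
  rw [hαQ] at hQx
  have hxA : F.x A - v ≠ 0 := by
    intro h; rw [h, mul_zero] at hA
    exact hAt (pow_eq_zero_iff two_ne_zero |>.1 hA)
  rw [hQ'] at hQ'D
  -- comparison of the two parabolas along the two common parallels
  have hkp : f - e = 2 * p * k := by
    have h1 : F.x B - F.x A ≠ 0 := sub_ne_zero.2 hAB
    have h2 : (F.x Q' - F.x A) * (f - e - 2 * p * k) = 0 := by
      linear_combination -(hQ'D - hAD) / 2 + (hB - hA) / 2 + 2 * p * hQx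
    have h3 : F.x Q' - F.x A ≠ 0 := by
      intro h0; rw [h0] at hQx; apply h1; linarith
    have := (mul_eq_zero.1 h2).resolve_left h3
    linarith
  have hV'x : F.x V' = (f + e) / 2 := by
    rw [hV't] at hV'D
    have : (f - e) * (f + e - 2 * F.x V') = 0 := by linear_combination hV'D
    have := (mul_eq_zero.1 this).resolve_left hfe'
    linarith
  have hVx : F.x (α V') = v := by
    rw [(hαX V').1, hV'x]
    have : p * (F.x A + k * ((f + e) / 2 - F.x A) - v) = 0 := by
      linear_combination ((f + e) / 4 - F.x A / 2) * -hkp + hAD / 4 - hA / 4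
    have := (mul_eq_zero.1 this).resolve_left hp
    linarith
  have hVy : F.y (α V') = 0 := by rw [(hαX V').2, hV't]
  have hiff : ∀ X, X ∈ D' ↔ α X ∈ C := by
    intro X
    rw [hD, hC, (hαX X).1, (hαX X).2]
    have : F.y X ^ 2 - 4 * p * (F.x A + k * (F.x X - F.x A) - v) =
      (F.x X - f) ^ 2 + F.y X ^ 2 - (F.x X - e) ^ 2 := by
      linear_combination 2 * (F.x X - F.x A) * hkp + hA - hAD
    rw [← sub_eq_zero (a := F.y X ^ 2), this, sub_eq_zero]
  refine ⟨?_, ?_, ?_⟩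
  · ext X
    constructor
    · rintro ⟨Y, hY, rfl⟩; exact (hiff Y).1 hY
    · intro hX
      refine ⟨α.symm X, ?_, by simp⟩
      rw [hiff]; simpa using hX
  · rw [hC, hVx, hVy]; ring
  · rw [hVx] at hR1
    rw [y_midpoint, hT, add_zero] at hR2
    have hRA : R ≠ A := by
      rintro rfl; apply hAt; linarith
    rw [F.isMirror_line hRA, hR1, hR2, hX, hG] at hmir
    obtain ⟨m1, m2⟩ := hmir
    -- the mirror images determine `X` as the foot of `A` on the directrix, and the focus
    have g1 : F.x X + F.x G = 2 * v := by
      have : F.y A * (F.x X + F.x G - 2 * v) = 0 := by linear_combination -4 * m1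
      have := (mul_eq_zero.1 this).resolve_left hAt
      linarith
    have g2 : F.x G - F.x X = 2 * p := by
      have : (F.x A - v) * (F.x G - F.x X - 2 * p) = 0 := by linear_combination m2 + hA / 2
      have := (mul_eq_zero.1 this).resolve_left hxA
      linarith
    have hGeq : G = F.pt (v + p) 0 := by
      apply F.ext_xy
      · rw [x_pt]; linarith
      · rw [y_pt, hG]
    have hMeq : pointMirror (α V') G = F.pt (v - p) 0 := by
      apply F.ext_xy
      · rw [x_pt, x_pointMirror, hVx]; linarith
      · rw [y_pt, y_pointMirror, hVy, hG]; ring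
    rw [hMeq, hGeq]
    exact F.isParabolaWith hp hC

end Frame

/-- The converse of `Frame.form_eq_zero_of_isAxis`. -/
lemma Frame.isAxis_of_form (F : Frame) {Q : Quadric} (h1 : Q.form F.u (rot F.u) = 0)
    (h2 : Q.lin F.O (rot F.u) = 0) : IsAxis Q.zeros F.axis := by
  refine ⟨F.isLine_axis, fun X hX Y hXY => ?_⟩
  rw [F.isMirror_axis] at hXY
  rw [Quadric.mem_zeros, F.eval_eq, h1, h2] at *
  rw [hXY.1, hXY.2]
  linear_combination hX

namespace Quadric

variable {P : Fin 5 → Plane} {Q : Quadric}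

/-- If the discriminant vanishes, conjugate directions lie in the kernel of the form. -/
lemma form_conj_eq_zero (h : Q.disc = 0) (v z : Plane) : Q.form z (Q.conj v) = 0 := by
  have h1 := Q.crs_conj_conj z v
  rw [h, zero_mul, crs_conj_left, form_comm] at h1
  linarith

/-- The parabola: axis, focus and directrix. -/
lemma parabola_part (hP : General P) (hQ : ∀ i, P i ∈ Q.zeros) (hd : Q.det ≠ 0)
    (hdisc : Q.disc = 0) {v M : Plane} (hvv : Q.form v v ≠ 0) :
    (∃! R₆, PascalSixth (P 0) (P 1) (P 2) (P 3) (P 4)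
      (perpThrough (P 0) (ln M (Q.conj v))) R₆) ∧
    ∀ R₆, PascalSixth (P 0) (P 1) (P 2) (P 3) (P 4) (perpThrough (P 0) (ln M (Q.conj v))) R₆ →
    ∀ t : Sub, t = parallelThrough (midpoint ℝ (P 0) R₆) (ln M (Q.conj v)) →
      (perpThrough (P 0) (ln M (Q.conj v)) : Set Plane) ∩ Q.zeros = {P 0, R₆} ∧
      (R₆ ≠ P 0 → t = AffineSubspace.perpBisector (P 0) R₆) ∧
      (∀ L, IsAxis Q.zeros L ↔ L = t) ∧
      (∃ i j, P i ∉ t ∧ P j ∉ perpThrough (P i) t) ∧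
      ∀ i j, P i ∉ t → P j ∉ perpThrough (P i) t →
        (∀ F' ∈ t, ∃ d' D' V' Q' α V T R F d,
          ParabolaSteps t (P i) (P j) F' d' D' V' Q' α V T R F d) ∧
        ∀ F' d' D' V' Q' α V T R F d,
          ParabolaSteps t (P i) (P j) F' d' D' V' Q' α V T R F d →
          α '' D' = Q.zeros ∧ V ∈ Q.zeros ∧ IsParabolaWith Q.zeros F d := by
  set g := Q.conj v with hg
  have hg0 : g ≠ 0 := conj_ne_zero hvv
  have hgz : ∀ z, Q.form z g = 0 := fun z => form_conj_eq_zero hdisc v z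
  have hrr : Q.form (rot g) (rot g) ≠ 0 := by
    intro h0
    have := Q.det_basis M g (rot g)
    rw [hgz, h0, form_comm, hgz] at this
    have hc : crs g (rot g) ≠ 0 := by
      have : crs g (rot g) = dotp g g := by simp [crs, dotp]
      rw [this]; exact (dotp_self_pos hg0).ne'
    refine mul_ne_zero (pow_ne_zero 2 hc) hd ?_
    rw [← this]; ring
  rw [perpThrough_ln _ _ hg0]
  refine ⟨existsUnique_pascalSixth hP hQ hd hrr, fun R hR t ht => ?_⟩
  obtain ⟨hint, hmid, hRmem⟩ := pascalSixth_chord hP hQ hd hrr hR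
  rw [parallelThrough_ln] at ht
  obtain ⟨F, hFO, hF⟩ := exists_frame_ln (midpoint ℝ (P 0) R) hg0
  rw [hF] at ht
  rw [Frame.axis, ln_eq_ln_iff hg0 F.u_ne_zero] at hF
  obtain ⟨r, hr⟩ := (crs_eq_zero_iff F.u_ne_zero).1
    (show crs F.u g = 0 by have := hF.1; simp only [crs] at *; linarith)
  have hr0 : r ≠ 0 := by rintro rfl; rw [zero_smul] at hr; exact hg0 hr
  have hrot : rot g = r • rot F.u := by rw [hr]; apply plane_ext <;> simp
  have huz : ∀ z, Q.form z F.u = 0 := fun z => by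
    have := hgz z
    rw [hr, form_smul_right] at this
    exact (mul_eq_zero.1 this).resolve_left hr0
  have hγ : Q.form (rot F.u) (rot F.u) ≠ 0 := by
    rw [hrot, form_smul_left, form_smul_right] at hrr
    exact right_ne_zero_of_mul (right_ne_zero_of_mul hrr)
  have hlr : Q.lin F.O (rot F.u) = 0 := by
    rw [← hFO, hrot, lin_smul_right] at hmid
    exact (mul_eq_zero.1 hmid).resolve_left hr0
  have hev := F.eval_eq Q
  have hdet := F.det_eq Q
  have hur : Q.form F.u (rot F.u) = 0 := by rw [form_comm, huz]
  rw [hlr, hur, huz] at hdet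
  have hl : Q.lin F.O F.u ≠ 0 := by
    intro h0; rw [h0] at hdet; apply hd; rw [hdet]; ring
  simp only [hlr, hur, huz] at hev
  have hC : ∀ X, X ∈ Q.zeros ↔ F.y X ^ 2 = 4 * (-Q.lin F.O F.u /
      (2 * Q.form (rot F.u) (rot F.u))) * (F.x X - -Q.eval F.O / (2 * Q.lin F.O F.u)) := by
    intro X
    rw [mem_zeros, hev, ← sub_eq_zero (a := F.y X ^ 2)]
    clear hdet hev
    generalize Q.form (rot F.u) (rot F.u) = γ at *
    generalize Q.lin F.O F.u = l at *
    have : F.y X ^ 2 - 4 * (-l / (2 * γ)) * (F.x X - -Q.eval F.O / (2 * l)) =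
      1 / γ * (γ * F.y X ^ 2 + 2 * l * F.x X + Q.eval F.O) := by field_simp; ring
    rw [this, mul_eq_zero, or_iff_right (one_div_ne_zero hγ)]
    constructor <;> intro h <;> linarith
  have hp : -Q.lin F.O F.u / (2 * Q.form (rot F.u) (rot F.u)) ≠ 0 :=
    div_ne_zero (neg_ne_zero.2 hl) (mul_ne_zero two_ne_zero hγ)
  subst ht
  refine ⟨hint, fun hne => ?_, fun L => ⟨fun hL => ?_, ?_⟩, F.exists_pair_of_general hP,
    fun i j hi hj => ⟨fun F' hF' => F.parabola_exists_steps hp hC (hQ i) (hQ j) hi hF',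
      fun F' d' D' V' Q' α V T R G d h => F.parabola_of_steps hp hC (hQ i) (hQ j) hi hj h⟩⟩
  · obtain ⟨s, hs⟩ := mem_ln_iff.1 hRmem
    have hs0 : s ≠ 0 := by rintro rfl; apply hne; rw [hs]; simp
    ext X
    rw [AffineSubspace.mem_perpBisector_iff_inner_eq_zero, F.mem_axis]
    simp only [vsub_eq_sub]
    have e1 : R - P 0 = (s * r) • rot F.u := by rw [hs, hrot, smul_smul]; abel
    have e2 : dotp (X - F.O) ((s * r) • rot F.u) = s * r * F.y X := by
      simp [dotp, Frame.y]; ring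
    rw [inner_eq_dotp, ← hFO, e1, e2, mul_eq_zero, or_iff_right (mul_ne_zero hs0 hr0)]
  · obtain ⟨G, -, rfl⟩ := hL.1.exists_frame hL.1.1.some_mem
    -- another axis has the direction of the kernel of the form and passes through the midpoint of a
    -- chord orthogonal to this direction
    obtain ⟨k1, k2⟩ := G.form_eq_zero_of_isAxis hP hQ hL
    have hform : ∀ z w, Q.form z w = Q.form (rot F.u) (rot F.u) * crs F.u z * crs F.u w := by
      intro z w
      have hc : crs F.u (rot F.u) ≠ 0 := by rw [F.crs_u_rot]; exact one_ne_zero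
      conv_lhs => rw [eq_basis hc z, eq_basis hc w]
      simp only [form_add_left, form_add_right, form_smul_left, form_smul_right, huz, hur,
        F.crs_u_rot]
      ring
    have hG1 := G.det_eq Q
    have hG2 := G.disc_eq Q
    rw [k1, k2] at hG1
    rw [k1, hdisc] at hG2
    have hGr : Q.form (rot G.u) (rot G.u) ≠ 0 := by
      intro h0; rw [h0] at hG1; apply hd; rw [hG1]; ring
    have hGu : Q.form G.u G.u = 0 :=
      (mul_eq_zero.1 (by linarith : Q.form G.u G.u * Q.form (rot G.u) (rot G.u) = 0)).resolve_right
        hGr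
    have hcr : crs F.u G.u = 0 := by
      rw [hform, mul_assoc] at hGu
      simpa using (mul_eq_zero.1 hGu).resolve_left hγ
    obtain ⟨q, hq⟩ := (crs_eq_zero_iff F.u_ne_zero).1 hcr
    have hq0 : q ≠ 0 := by rintro rfl; rw [zero_smul] at hq; exact G.u_ne_zero hq
    have hqr : rot G.u = q • rot F.u := by rw [hq]; apply plane_ext <;> simp
    rw [hqr, lin_smul_right, Q.lin_eq F.O, hlr, hform, F.crs_u_rot] at k2
    have k3 : crs F.u (G.O - F.O) = 0 := by
      have := (mul_eq_zero.1 k2).resolve_left hq0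
      rw [zero_add, mul_one] at this
      exact (mul_eq_zero.1 this).resolve_left hγ
    rw [Frame.axis, Frame.axis, eq_comm, ln_eq_ln_iff F.u_ne_zero G.u_ne_zero]
    exact ⟨hcr, k3⟩
  · rintro rfl
    exact F.parabola_isAxis hC

/-! ### Separation of conjugate pairs -/

/-- For `τ = 1` both sides are zero by the convention `x / 0 = 0`. -/
lemma signedRatio_lineMap {A A' : Plane} (h : A ≠ A') (τ : ℝ) :
    signedRatio A A' (AffineMap.lineMap A A' τ) = τ / (1 - τ) := by
  have hd := dotp_self_pos (sub_ne_zero.2 h.symm)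
  have e1 : (AffineMap.lineMap A A' τ : Plane) - A = τ • (A' - A) := by
    rw [AffineMap.lineMap_apply]; simp
  have e2 : A' - (AffineMap.lineMap A A' τ : Plane) = (1 - τ) • (A' - A) := by
    rw [AffineMap.lineMap_apply, sub_smul, one_smul]; simp; abel
  rw [signedRatio, e1, e2, inner_smul_left, inner_smul_right, inner_smul_left, inner_smul_right,
    inner_eq_dotp]
  simp only [conj_trivial]
  by_cases hτ : 1 - τ = 0
  · rw [hτ]; simp
  · field_simp

/-- The cross-ratio and the separation of two pairs of points of a line, in terms of the
parameters of the second pair. -/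
lemma separate_iff {A A' : Plane} (h : A ≠ A') {τ τ' : ℝ} (h0 : τ ≠ 0) (h1 : 1 - τ ≠ 0)
    (h0' : τ' ≠ 0) (h1' : 1 - τ' ≠ 0) :
    (Separate A A' (AffineMap.lineMap A A' τ) (AffineMap.lineMap A A' τ') ↔
      τ * τ' * (1 - τ) * (1 - τ') < 0) ∧
    (crossRatio A A' (AffineMap.lineMap A A' τ) (AffineMap.lineMap A A' τ') < 0 ↔
      τ * τ' * (1 - τ) * (1 - τ') < 0) ∧
    (0 < crossRatio A A' (AffineMap.lineMap A A' τ) (AffineMap.lineMap A A' τ') ↔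
      0 < τ * τ' * (1 - τ) * (1 - τ')) := by
  have hcr : τ * τ' * (1 - τ) * (1 - τ') = crossRatio A A' (AffineMap.lineMap A A' τ)
      (AffineMap.lineMap A A' τ') * ((1 - τ) * τ') ^ 2 := by
    rw [crossRatio, signedRatio_lineMap h, signedRatio_lineMap h]; field_simp
  have hsq : 0 < ((1 - τ) * τ') ^ 2 := by positivity
  have aux : ∀ r : ℝ, r ≠ 0 → 1 - r ≠ 0 → (r ∈ Ioo (0 : ℝ) 1 ↔ 0 < r * (1 - r)) := by
    intro r h0 h1
    rw [mem_Ioo]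
    constructor
    · rintro ⟨a, b⟩; exact mul_pos a (by linarith)
    · intro hpos
      rcases lt_or_gt_of_ne h0 with h | h
      · nlinarith
      · exact ⟨h, by have := (pos_iff_pos_of_mul_pos hpos).1 h; linarith⟩
  refine ⟨?_, ?_, ?_⟩
  · rw [Separate, sbtw_lineMap_iff, sbtw_lineMap_iff, aux τ h0 h1, aux τ' h0' h1']
    simp only [h, ne_eq, not_false_iff, true_and]
    have e : τ * τ' * (1 - τ) * (1 - τ') = τ * (1 - τ) * (τ' * (1 - τ')) := by ring
    rw [e, mul_neg_iff]
    have n1 : τ * (1 - τ) ≠ 0 := mul_ne_zero h0 h1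
    have n2 : τ' * (1 - τ') ≠ 0 := mul_ne_zero h0' h1'
    rw [Xor, not_lt, not_lt]
    constructor
    · rintro (⟨a, b⟩ | ⟨a, b⟩)
      · exact Or.inl ⟨a, lt_of_le_of_ne b n2⟩
      · exact Or.inr ⟨lt_of_le_of_ne b n1, a⟩
    · rintro (⟨a, b⟩ | ⟨a, b⟩)
      · exact Or.inl ⟨a, b.le⟩
      · exact Or.inr ⟨b, a.le⟩
  · rw [hcr, mul_neg_iff]
    simp [hsq, hsq.not_gt]
  · rw [hcr, mul_pos_iff_of_pos_right hsq]

/-- Ellipse and hyperbola are distinguished by the position of two pairs of conjugate diameters. -/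
lemma separation_part (hP : General P) (hQ : ∀ i, P i ∈ Q.zeros) (hd : Q.det ≠ 0) {O v w : Plane}
    (hO : Q.IsCtr O) (hvv : Q.form v v ≠ 0) (hvw : Q.form v w ≠ 0)
    (hc : crs v w ≠ 0) {t : Sub} (ht : IsLine t) (hOt : O ∉ t) {A A' B B' : Plane}
    (hA : A ∈ t) (hA1 : A ∈ ln O (Q.conj v)) (hA' : A' ∈ t) (hA'1 : A' ∈ ln O v)
    (hB : B ∈ t) (hB1 : B ∈ ln O (Q.conj w)) (hB' : B' ∈ t) (hB'1 : B' ∈ ln O w) :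
    (IsEllipse Q.zeros ↔ Separate A A' B B') ∧ (IsEllipse Q.zeros ↔ crossRatio A A' B B' < 0) ∧
    (IsHyperbola Q.zeros ↔ ¬ Separate A A' B B') ∧
    (IsHyperbola Q.zeros ↔ 0 < crossRatio A A' B B') := by
  obtain ⟨a, rfl⟩ := mem_ln_iff.1 hA1
  obtain ⟨a', rfl⟩ := mem_ln_iff.1 hA'1
  obtain ⟨b, rfl⟩ := mem_ln_iff.1 hB1
  obtain ⟨b', rfl⟩ := mem_ln_iff.1 hB'1
  have hdisc := hO.disc_ne_zero hd
  have ha : a ≠ 0 := by rintro rfl; simp at hA; exact hOt hA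
  have ha' : a' ≠ 0 := by rintro rfl; simp at hA'; exact hOt hA'
  have hb : b ≠ 0 := by rintro rfl; simp at hB; exact hOt hB
  have hb' : b' ≠ 0 := by rintro rfl; simp at hB'; exact hOt hB'
  have crs_smul : ∀ (r s : ℝ) (x y : Plane), crs (r • x) (s • y) = r * s * crs x y := by
    intro r s x y; simp [crs]; ring
  have cAA' : crs (a • Q.conj v) (a' • v) ≠ 0 := by
    rw [crs_smul, crs_conj_left]; exact mul_ne_zero (mul_ne_zero ha ha') (neg_ne_zero.2 hvv)
  have cAB : crs (a • Q.conj v) (b • Q.conj w) ≠ 0 := by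
    rw [crs_smul, crs_conj_conj]
    exact mul_ne_zero (mul_ne_zero ha hb) (mul_ne_zero hdisc hc)
  have cA'B : crs (a' • v) (b • Q.conj w) ≠ 0 := by
    rw [crs_smul, crs_conj]; exact mul_ne_zero (mul_ne_zero ha' hb) hvw
  have cAB' : crs (a • Q.conj v) (b' • w) ≠ 0 := by
    rw [crs_smul, crs_conj_left, form_comm]
    exact mul_ne_zero (mul_ne_zero ha hb') (neg_ne_zero.2 hvw)
  have cA'B' : crs (a' • v) (b' • w) ≠ 0 := by
    rw [crs_smul]; exact mul_ne_zero (mul_ne_zero ha' hb') hc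
  have fA : Q.form (a • Q.conj v) (a' • v) = 0 := by
    rw [form_smul_left, form_smul_right, form_comm, form_conj]; ring
  have fB : Q.form (b • Q.conj w) (b' • w) = 0 := by
    rw [form_smul_left, form_smul_right, form_comm, form_conj]; ring
  generalize a • Q.conj v = A at *
  generalize a' • v = A' at *
  generalize b • Q.conj w = B at *
  generalize b' • w = B' at *
  have crs_self : ∀ x : Plane, crs x x = 0 := fun x => by simp [crs]; ring
  have hAA' : O + A ≠ O + A' := by
    intro h; rw [add_left_cancel h] at cAA'; exact cAA' (crs_self _)
  -- the position of a point of `t` on the segment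
  have key : ∀ X, O + X ∈ t → ∃ τ : ℝ, X = A + τ • (A' - A) ∧
      O + X = AffineMap.lineMap (O + A) (O + A') τ := by
    intro X hX
    obtain ⟨z, hz, rfl⟩ := ht.exists_ln hA
    obtain ⟨r, hr⟩ := mem_ln_iff.1 hA'
    obtain ⟨s, hs⟩ := mem_ln_iff.1 hX
    have hr' : A' - A = r • z := by
      rw [add_assoc] at hr; rw [add_left_cancel hr]; abel
    have hs' : X = A + s • z := by
      rw [add_assoc] at hs; exact add_left_cancel hs
    have hr0 : r ≠ 0 := by
      rintro rfl; apply hAA'; rw [hr]; simp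
    have hX : X = A + (s / r) • (A' - A) := by
      rw [hr', smul_smul, div_mul_cancel₀ _ hr0, hs']
    refine ⟨s / r, hX, ?_⟩
    rw [AffineMap.lineMap_apply, vsub_eq_sub, vadd_eq_add, add_sub_add_left_eq_sub]
    conv_lhs => rw [hX]
    abel
  obtain ⟨τ, hτ, hτ'⟩ := key B hB
  obtain ⟨σ, hσ, hσ'⟩ := key B' hB'
  have t0 : τ ≠ 0 := by rintro rfl; rw [hτ] at cAB; simp [crs_self] at cAB
  have t1 : 1 - τ ≠ 0 := by
    intro h; rw [hτ, show τ = 1 by linarith] at cA'B; simp [crs_self] at cA'B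
  have s0 : σ ≠ 0 := by rintro rfl; rw [hσ] at cAB'; simp [crs_self] at cAB'
  have s1 : 1 - σ ≠ 0 := by
    intro h; rw [hσ, show σ = 1 by linarith] at cA'B'; simp [crs_self] at cA'B'
  obtain ⟨k1, k2, k3⟩ := separate_iff hAA' t0 t1 s0 s1
  rw [← hτ', ← hσ'] at k1 k2 k3
  have hbas := Q.disc_basis A A'
  rw [hτ, hσ] at fB
  simp only [form_add_left, form_add_right, form_smul_left, form_smul_right, form_sub_left,
    form_sub_right, fA, Q.form_comm A' A] at fB
  rw [fA] at hbas
  have hN : Q.form A A ≠ 0 := by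
    intro h0; rw [h0] at hbas
    exact mul_ne_zero (pow_ne_zero 2 cAA') hdisc (by linarith)
  -- in the conjugate basis `A, A'` the form has the diagonal entries `N, N'` with
  -- `N N' = (crs A A')² disc`; the conjugacy of the second pair is
  -- `(1 - τ) (1 - σ) N + τ σ N' = 0`
  have hK : τ * σ * (1 - τ) * (1 - σ) * Q.form A A ^ 2 = -((τ * σ * crs A A') ^ 2 * Q.disc) := by
    linear_combination τ * σ * Q.form A A * fB - (τ * σ) ^ 2 * hbas
  have hN2 : 0 < Q.form A A ^ 2 := by positivity
  have hs2 : 0 < (τ * σ * crs A A') ^ 2 := by positivity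
  have hneg : τ * σ * (1 - τ) * (1 - σ) < 0 ↔ 0 < Q.disc := by
    constructor <;> intro h
    · by_contra! h'
      nlinarith [mul_nonpos_of_nonneg_of_nonpos hs2.le h', mul_neg_of_neg_of_pos h hN2]
    · by_contra! h'
      nlinarith [mul_pos hs2 h, mul_nonneg h' hN2.le]
  have hpos : 0 < τ * σ * (1 - τ) * (1 - σ) ↔ Q.disc < 0 := by
    constructor <;> intro h
    · by_contra! h'
      nlinarith [mul_nonneg hs2.le h', mul_pos h hN2]
    · by_contra! h'
      nlinarith [mul_neg_of_pos_of_neg hs2 h, mul_nonpos_of_nonpos_of_nonneg h' hN2.le]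
  rw [isEllipse_iff hP hQ hd, isHyperbola_iff hP hQ hd, k1, k2, k3, hneg, hpos]
  refine ⟨Iff.rfl, Iff.rfl, ⟨fun h => h.not_gt, fun h => ?_⟩, Iff.rfl⟩
  exact lt_of_le_of_ne (not_lt.1 h) hdisc

end Quadric

/-! ### The ellipse -/

/-- The quadratic form `z ↦ |L z|²` of a linear map of the plane. -/
noncomputable def pullback (L : Plane →ₗ[ℝ] Plane) : Quadric where
  a := dotp (L !₂[1, 0]) (L !₂[1, 0])
  b := dotp (L !₂[1, 0]) (L !₂[0, 1])
  c := dotp (L !₂[0, 1]) (L !₂[0, 1])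
  d := 0
  e := 0
  f := 0

lemma pullback_form (L : Plane →ₗ[ℝ] Plane) (z w : Plane) :
    (pullback L).form z w = dotp (L z) (L w) := by
  have h : ∀ z : Plane, L z = z 0 • L !₂[1, 0] + z 1 • L !₂[0, 1] := by
    intro z
    rw [← map_smul, ← map_smul, ← map_add]
    congr 1
    apply plane_ext <;> simp
  rw [h z, h w]
  simp only [Quadric.form, pullback, dotp, PiLp.add_apply, PiLp.smul_apply, smul_eq_mul]
  ring

namespace Quadric

variable {P : Fin 5 → Plane} {Q : Quadric}

/-- A line through the centre is an axis of symmetry if its direction is conjugate to the orthogonal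
direction. -/
lemma IsCtr.isAxis {O z : Plane} (hO : Q.IsCtr O) (hz : z ≠ 0) (h : Q.form z (rot z) = 0) :
    IsAxis Q.zeros (ln O z) := by
  obtain ⟨u, hu, r, hr, rfl⟩ := exists_unit hz
  have e : ln O (r • u) = (Frame.mk O u hu).axis := by
    have hu0 : u ≠ 0 := by rintro rfl; simp at hz
    rw [Frame.axis, ln_eq_ln_iff hz hu0]
    simp [crs]; ring
  rw [e]
  refine Frame.isAxis_of_form _ ?_ (hO _)
  have : Q.form (r • u) (rot (r • u)) = r ^ 2 * Q.form u (rot u) := by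
    simp [form]; ring
  rw [this] at h
  exact (mul_eq_zero.1 h).resolve_left (by positivity)

/-- Two pairs of conjugate directions determine a form up to a factor. -/
lemma exists_form_eq_smul {S : Quadric} {v w : Plane} (hvv : Q.form v v ≠ 0)
    (hvw : Q.form v w ≠ 0) (hc : crs v w ≠ 0) (h1 : S.form (Q.conj v) v = 0)
    (h2 : S.form (Q.conj w) w = 0) :
    ∃ k, k = S.form v v / Q.form v v ∧ ∀ z z', S.form z z' = k * Q.form z z' := by
  refine ⟨_, rfl, ?_⟩
  set k := S.form v v / Q.form v v with hk
  set T : Quadric := ⟨S.a - k * Q.a, S.b - k * Q.b, S.c - k * Q.c, 0, 0, 0⟩ with hT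
  have hTf : ∀ z z', T.form z z' = S.form z z' - k * Q.form z z' := by
    intro z z'; simp only [form, hT]; ring
  have hb : crs v (Q.conj v) ≠ 0 := by rw [crs_conj]; exact hvv
  have t1 : T.form v v = 0 := by rw [hTf, hk]; field_simp; ring
  have t2 : T.form v (Q.conj v) = 0 := by rw [hTf, form_conj, form_comm, h1]; ring
  have t3 : T.form w (Q.conj w) = 0 := by rw [hTf, form_conj, form_comm, h2]; ring
  have t4 : T.form (Q.conj v) (Q.conj v) = 0 := by
    have e1 := eq_basis hb w
    have e2 := eq_basis hb (Q.conj w)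
    have n1 : crs v w / crs v (Q.conj v) ≠ 0 := div_ne_zero hc hb
    have n2 : crs v (Q.conj w) / crs v (Q.conj v) ≠ 0 := div_ne_zero (by rwa [crs_conj]) hb
    generalize Q.conj w = w' at *
    rw [e1, e2] at t3
    simp only [form_add_left, form_add_right, form_smul_left, form_smul_right, t1, t2,
      T.form_comm (Q.conj v) v] at t3
    have t3' : crs v w / crs v (Q.conj v) * (crs v w' / crs v (Q.conj v) *
      T.form (Q.conj v) (Q.conj v)) = 0 := by linear_combination t3
    exact (mul_eq_zero.1 ((mul_eq_zero.1 t3').resolve_left n1)).resolve_left n2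
  have hT0 := eq_zero_of_basis (Q := T) (O := 0) hb t1 t2 t4 (by simp [lin, form, hT])
    (by simp [lin, form, hT]) (by simp [eval, hT])
  intro z z'
  have := hTf z z'
  rw [hT0] at this
  simp [form] at this
  simp only [form]
  linarith

/-- An affinity `α` sends two directions to orthogonal ones if and only if they are conjugate with
respect to the form `|α z|²`. -/
lemma map_perp_iff {α : Plane ≃ᵃ[ℝ] Plane} {O v w : Plane} :
    Perp ((ln O v).map (α : Plane →ᵃ[ℝ] Plane)) ((ln O w).map (α : Plane →ᵃ[ℝ] Plane)) ↔
      (pullback (α.linear : Plane →ₗ[ℝ] Plane)).form v w = 0 := by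
  rw [map_ln, map_ln, perp_ln_iff, pullback_form]; rfl

/-- The axes of an ellipse from two pairs of conjugate diameters. -/
lemma ellipse_axes_part (hQ : ∀ i, P i ∈ Q.zeros) (hd : Q.det ≠ 0) {O v w : Plane}
    (hO : Q.IsCtr O) (hdisc : 0 < Q.disc) (hvv : Q.form v v ≠ 0) (hvw : Q.form v w ≠ 0)
    (hc : crs v w ≠ 0) {t : Sub} (ht : IsLine t) (hOt : O ∉ t) :
    (∃ α, IsAffinity t α ∧
      Perp ((ln O (Q.conj v)).map (α : Plane →ᵃ[ℝ] Plane))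
        ((ln O v).map (α : Plane →ᵃ[ℝ] Plane)) ∧
      Perp ((ln O (Q.conj w)).map (α : Plane →ᵃ[ℝ] Plane))
        ((ln O w).map (α : Plane →ᵃ[ℝ] Plane))) ∧
    ∀ α, IsAffinity t α →
      Perp ((ln O (Q.conj v)).map (α : Plane →ᵃ[ℝ] Plane))
        ((ln O v).map (α : Plane →ᵃ[ℝ] Plane)) →
      Perp ((ln O (Q.conj w)).map (α : Plane →ᵃ[ℝ] Plane))
        ((ln O w).map (α : Plane →ᵃ[ℝ] Plane)) →
      (∃ r > 0, α '' Q.zeros = Metric.sphere (α O) r) ∧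
      (∀ Z F G : Plane, Z ∈ t → dist Z O = dist Z (α O) →
        F ∈ t → G ∈ t → F ≠ G → dist Z F = dist Z O → dist Z G = dist Z O →
        IsAxis Q.zeros line[ℝ, O, F] ∧ IsAxis Q.zeros line[ℝ, O, G] ∧
        Perp line[ℝ, O, F] line[ℝ, O, G]) ∧
      (α O - O ∉ t.directionᗮ → ∃ Z F G : Plane, Z ∈ t ∧ dist Z O = dist Z (α O) ∧
        F ∈ t ∧ G ∈ t ∧ F ≠ G ∧ dist Z F = dist Z O ∧ dist Z G = dist Z O) ∧
      (α O - O ∈ t.directionᗮ →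
        IsAxis Q.zeros (parallelThrough O t) ∧ IsAxis Q.zeros (perpThrough O t)) := by
  obtain ⟨H, -, rfl⟩ := ht.exists_frame ht.1.some_mem
  rw [H.mem_axis] at hOt
  have hdir : ∀ X : Plane, X - O ∈ H.axis.directionᗮ ↔ H.x X = H.x O := by
    intro X
    rw [Frame.axis, direction_ln, mem_span_orthogonal_iff, H.dotp_u, sub_eq_zero]
  have hu : H.u = H.pt 1 0 - H.pt 0 0 := by apply plane_ext <;> simp
  have hr : rot H.u = H.pt 0 1 - H.pt 0 0 := by apply plane_ext <;> simp
  constructor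
  · -- the linear part is a square root of the form with respect to the frame
    have huu : Q.form H.u H.u ≠ 0 := by
      intro h0
      have := H.disc_eq Q
      rw [h0] at this
      nlinarith [sq_nonneg (Q.form H.u (rot H.u))]
    set m := Q.form H.u (rot H.u) / Q.form H.u H.u with hm
    have hn : √Q.disc / Q.form H.u H.u ≠ 0 := div_ne_zero (Real.sqrt_pos.2 hdisc).ne' huu
    set n := √Q.disc / Q.form H.u H.u with hn'
    have hn2 : Q.form H.u H.u * (m ^ 2 + n ^ 2) = Q.form (rot H.u) (rot H.u) := by
      have h1 := H.disc_eq Q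
      rw [hm, hn', div_pow, div_pow, Real.sq_sqrt hdisc.le, h1]
      field_simp; ring
    set α := H.affinity m n hn with hα
    have key : ∀ z z', Q.form z z' = Q.form H.u H.u *
        (pullback (α.linear : Plane →ₗ[ℝ] Plane)).form z z' := by
      have l1 : α.linear H.u = H.pt 1 0 - H.pt 0 0 := by
        conv_lhs => rw [hu, affinity_linear_sub, hα, H.affinity_apply, H.affinity_apply]
        simp
      have l2 : α.linear (rot H.u) = H.pt m n - H.pt 0 0 := by
        conv_lhs => rw [hr, affinity_linear_sub, hα, H.affinity_apply, H.affinity_apply]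
        simp
      have p1 : (pullback (α.linear : Plane →ₗ[ℝ] Plane)).form H.u H.u = 1 := by
        rw [pullback_form, LinearEquiv.coe_coe, l1, H.dotp_sub]; simp
      have p2 : (pullback (α.linear : Plane →ₗ[ℝ] Plane)).form H.u (rot H.u) = m := by
        rw [pullback_form, LinearEquiv.coe_coe, l1, l2, H.dotp_sub]; simp
      have p3 : (pullback (α.linear : Plane →ₗ[ℝ] Plane)).form (rot H.u) (rot H.u) =
          m ^ 2 + n ^ 2 := by
        rw [pullback_form, LinearEquiv.coe_coe, l2, H.dotp_sub]; simp; ring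
      have hcr : crs H.u (rot H.u) ≠ 0 := by rw [H.crs_u_rot]; exact one_ne_zero
      have hmm : Q.form H.u H.u * m = Q.form H.u (rot H.u) := by rw [hm]; field_simp
      intro z z'
      rw [eq_basis hcr z, eq_basis hcr z']
      simp only [form_add_left, form_add_right, form_smul_left, form_smul_right, p1, p2, p3,
        form_comm _ (rot H.u) H.u, ← hn2, ← hmm]
      ring
    refine ⟨α, H.isAffinity_affinity m n hn, ?_, ?_⟩
    · rw [map_perp_iff]
      have := key (Q.conj v) v
      rw [form_comm, form_conj] at this
      exact (mul_eq_zero.1 this.symm).resolve_left huu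
    · rw [map_perp_iff]
      have := key (Q.conj w) w
      rw [form_comm, form_conj] at this
      exact (mul_eq_zero.1 this.symm).resolve_left huu
  · intro α hα h1 h2
    rw [map_perp_iff] at h1 h2
    obtain ⟨k, hk, hS⟩ := exists_form_eq_smul hvv hvw hc h1 h2
    have hdotp : ∀ X Y X' Y' : Plane,
        dotp (α X - α Y) (α X' - α Y') = k * Q.form (X - Y) (X' - Y') := by
      intro X Y X' Y'
      rw [← hS, pullback_form, LinearEquiv.coe_coe, affinity_linear_sub, affinity_linear_sub]
    have hk0 : k ≠ 0 := by
      rw [hk]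
      refine div_ne_zero ?_ hvv
      rw [pullback_form]
      have hv : v ≠ 0 := ne_zero_left_of_crs hc
      exact (dotp_self_pos (by simpa using hv)).ne'
    obtain ⟨m, n, hn, hαX⟩ := H.exists_of_isAffinity hα
    have hfix : ∀ X, H.y X = 0 → α X = X := fun X hX => hα X (H.mem_axis.2 hX)
    -- `α` sends conjugate vectors to orthogonal vectors
    have haxis : ∀ F : Plane, H.y F = 0 → ∀ G : Plane, H.y G = 0 →
        dotp (F - O) (G - O) = 0 → dotp (F - α O) (G - α O) = 0 → IsAxis Q.zeros line[ℝ, O, F] := by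
      intro F hF G hG hdot hdot'
      have hFO : F - O ≠ 0 := by
        rw [sub_ne_zero]; rintro rfl; exact hOt hF
      have hGO : G - O ≠ 0 := by
        rw [sub_ne_zero]; rintro rfl; exact hOt hG
      rw [line_eq_ln]
      apply hO.isAxis hFO
      have h3 := hdotp F O G O
      rw [hfix F hF, hfix G hG, hdot'] at h3
      obtain ⟨q, hq⟩ := (dotp_eq_zero_iff hFO).1 hdot
      have hq0 : q ≠ 0 := by rintro rfl; rw [zero_smul] at hq; exact hGO hq
      rw [hq, form_smul_right] at h3
      exact (mul_eq_zero.1 ((mul_eq_zero.1 h3.symm).resolve_left hk0)).resolve_left hq0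
    refine ⟨?_, ?_, ?_, ?_⟩
    · have hmem : ∀ X, X ∈ Q.zeros ↔ dist (α X) (α O) = dist (α (P 0)) (α O) := by
        intro X
        have h0 := hQ 0
        rw [mem_zeros, hO.eval_eq] at h0
        rw [← sq_eq_sq₀ dist_nonneg dist_nonneg, dist_sq_eq, dist_sq_eq, hdotp, hdotp, mem_zeros,
          hO.eval_eq, mul_right_inj' hk0]
        constructor <;> intro h <;> linarith
      refine ⟨dist (α (P 0)) (α O), ?_, ?_⟩
      · apply dist_pos.2
        intro h
        have h0 := hQ 0
        rw [α.injective h, mem_zeros] at h0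
        exact hO.eval_ne_zero hd h0
      · ext X
        rw [Metric.mem_sphere]
        constructor
        · rintro ⟨Y, hY, rfl⟩; exact (hmem Y).1 hY
        · intro hX
          refine ⟨α.symm X, ?_, by simp⟩
          rw [hmem]; simpa using hX
    · intro Z F G hZ hZO hF hG hFG hZF hZG
      rw [H.mem_axis] at hZ hF hG
      have hZF' := hZF.trans hZO
      rw [H.dist_eq_iff, hZ, hF] at hZF hZF'
      rw [H.dist_eq_iff, hZ, hG] at hZG
      -- `F` and `G` are opposite points of a circle through `O` and `α O`; so `O F`, `O G` are
      -- orthogonal, and so are their images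
      have hsum : H.x G - H.x Z = -(H.x F - H.x Z) := by
        have hne : H.x F - H.x G ≠ 0 := by
          rw [sub_ne_zero]; intro h; exact hFG (H.ext_xy h (by rw [hF, hG]))
        have : (H.x F - H.x G) * (H.x G - H.x Z + (H.x F - H.x Z)) = 0 := by
          linear_combination hZF - hZG
        have := (mul_eq_zero.1 this).resolve_left hne
        linarith
      have hxG : H.x G = 2 * H.x Z - H.x F := by linarith
      have d1 : dotp (F - O) (G - O) = 0 := by
        rw [H.dotp_sub, hF, hG, hxG]; linear_combination -hZF
      have d2 : dotp (F - α O) (G - α O) = 0 := by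
        rw [H.dotp_sub, hF, hG, hxG]; linear_combination -hZF'
      have comm : ∀ x y : Plane, dotp x y = dotp y x := fun x y => by simp only [dotp]; ring
      refine ⟨haxis F hF G hG d1 d2, haxis G hG F hF (by rw [comm, d1]) (by rw [comm, d2]), ?_⟩
      rw [line_eq_ln, line_eq_ln, perp_ln_iff, d1]
    · intro hne
      rw [hdir] at hne
      -- the centre of the circle is the point of `t` on the perpendicular bisector of `O` and `α O`
      set z := (H.x (α O) ^ 2 + H.y (α O) ^ 2 - H.x O ^ 2 - H.y O ^ 2) /
        (2 * (H.x (α O) - H.x O)) with hz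
      have hz' : 2 * (H.x (α O) - H.x O) * z =
          H.x (α O) ^ 2 + H.y (α O) ^ 2 - H.x O ^ 2 - H.y O ^ 2 := by
        rw [hz, mul_div_cancel₀]; exact mul_ne_zero two_ne_zero (sub_ne_zero.2 hne)
      have hrpos : 0 < (z - H.x O) ^ 2 + H.y O ^ 2 := by positivity
      have hsq := Real.sq_sqrt hrpos.le
      have hspos := Real.sqrt_pos.2 hrpos
      set ρ := √((z - H.x O) ^ 2 + H.y O ^ 2)
      refine ⟨H.pt z 0, H.pt (z + ρ) 0, H.pt (z - ρ) 0, ?_, ?_, ?_, ?_, ?_, ?_, ?_⟩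
      · rw [H.mem_axis, H.y_pt]
      · rw [H.dist_eq_iff, H.x_pt, H.y_pt]; linear_combination hz'
      · rw [H.mem_axis, H.y_pt]
      · rw [H.mem_axis, H.y_pt]
      · intro h
        have := congrArg H.x h
        rw [H.x_pt, H.x_pt] at this
        linarith
      · rw [H.dist_eq_iff, H.x_pt, H.y_pt, H.x_pt, H.y_pt]; linear_combination hsq
      · rw [H.dist_eq_iff, H.x_pt, H.y_pt, H.x_pt, H.y_pt]; linear_combination hsq
    · intro he
      rw [hdir, hαX, H.x_pt] at he
      have hm : m = 0 := (mul_eq_zero.1 (by linarith : m * H.y O = 0)).resolve_right hOt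
      have hform : Q.form H.u (rot H.u) = 0 := by
        have := hdotp (H.pt 1 0) (H.pt 0 0) (H.pt 0 1) (H.pt 0 0)
        rw [← hu, ← hr, hαX, hαX, hαX, H.dotp_sub] at this
        simp [hm] at this
        exact this.resolve_left hk0
      rw [Frame.axis, parallelThrough_ln, perpThrough_ln _ _ H.u_ne_zero]
      refine ⟨hO.isAxis H.u_ne_zero hform, hO.isAxis (rot_ne_zero H.u_ne_zero) ?_⟩
      have : Q.form (rot H.u) (rot (rot H.u)) = -Q.form H.u (rot H.u) := by
        simp [form]; ring
      rw [this, hform, neg_zero]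

end Quadric

namespace Frame

variable (F : Frame) {C : Set Plane} {a b : ℝ}

lemma line_parallel_axis_iff {A B : Plane} (h : A ≠ B) :
    line[ℝ, A, B] ∥ F.axis ↔ F.y A = F.y B := by
  rw [line_eq_ln, axis, parallel_ln_iff (sub_ne_zero.2 h.symm) F.u_ne_zero]
  have : crs (B - A) F.u = -(F.y B - F.y A) := by
    rw [← F.crs_u]; simp only [crs]; ring
  rw [this]
  constructor <;> intro h <;> linarith

/-- If every chord were parallel to the axis or had its midpoint on it, all five points would have
the same distance from the axis, and three of them would lie on a parallel to it. -/
lemma ellipse_exists_pair {P : Fin 5 → Plane} (hP : General P) :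
    ∃ i j, i ≠ j ∧ ¬ line[ℝ, P i, P j] ∥ F.axis ∧ midpoint ℝ (P i) (P j) ∉ F.axis := by
  by_contra! h
  have key : ∀ i j, i ≠ j → F.y (P i) ^ 2 = F.y (P j) ^ 2 := by
    intro i j hij
    by_cases h1 : F.y (P i) = F.y (P j)
    · rw [h1]
    · have := h i j hij (by rwa [F.line_parallel_axis_iff (hP.ne hij)])
      rw [F.mem_axis, y_midpoint] at this
      rw [show F.y (P i) = -F.y (P j) by linarith, neg_sq]
  obtain ⟨i, j, k, hij, hik, hjk, h3⟩ := exists_three fun i => F.y (P i) = F.y (P 0)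
  apply hP i j k hij hik hjk
  rw [F.crs_sub]
  rcases h3 with ⟨h1, h2, h3⟩ | ⟨h1, h2, h3⟩
  · rw [h1, h2, h3]; ring
  · have neg : ∀ l, ¬ F.y (P l) = F.y (P 0) → F.y (P l) = -F.y (P 0) := by
      intro l hl
      have := key l 0 (by rintro rfl; exact hl rfl)
      exact (sq_eq_sq_iff_eq_or_eq_neg.1 this).resolve_left hl
    rw [neg i h1, neg j h2, neg k h3]; ring

/-- The construction of the vertices of an ellipse can be carried out. The affinity is
`(x, y) ↦ (x, (a / b) y)`, which sends the ellipse to the circle with radius `a`. -/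
lemma ellipse_exists_steps (ha : 0 < a) (hb : 0 < b)
    (hC : ∀ X, X ∈ C ↔ b ^ 2 * F.x X ^ 2 + a ^ 2 * F.y X ^ 2 = a ^ 2 * b ^ 2) {A B : Plane}
    (hA : A ∈ C) (hB : B ∈ C) (hAB : F.y A ≠ F.y B) :
    ∃ G F' α V W, EllipseSteps F.O F.axis A B G F' α V W := by
  rw [hC] at hA hB
  have hne : A ≠ B := by rintro rfl; exact hAB rfl
  have hy : F.y B - F.y A ≠ 0 := sub_ne_zero.2 hAB.symm
  have hk : a / b ≠ 0 := (div_pos ha hb).ne'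
  set M := midpoint ℝ A B with hM
  set g := F.x M - (F.x B - F.x A) * F.y M / (F.y B - F.y A) with hg
  have hg' : (F.y B - F.y A) * (F.x M - g) = (F.x B - F.x A) * F.y M := by
    rw [hg]; field_simp; ring
  clear_value g
  have hMx : F.x M = (F.x A + F.x B) / 2 := F.x_midpoint A B
  have hMy : F.y M = (F.y A + F.y B) / 2 := F.y_midpoint A B
  have hconj : b ^ 2 * F.x M * (F.x B - F.x A) + a ^ 2 * F.y M * (F.y B - F.y A) = 0 := by
    rw [hMx, hMy]; linear_combination (hB - hA) / 2
  -- the affine image of the midpoint lies on the circle with the diameter `O G`, as the image of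
  -- the chord is orthogonal to the radius to its midpoint
  have hcirc : b ^ 2 * (F.x M ^ 2 - F.x M * g) + a ^ 2 * F.y M ^ 2 = 0 := by
    apply (mul_eq_zero.1 (_ : (F.y B - F.y A) * _ = 0)).resolve_left hy
    linear_combination b ^ 2 * F.x M * hg' + F.y M * hconj
  have hαx : ∀ X, F.affinity 0 (a / b) hk X = F.pt (F.x X) (a / b * F.y X) := fun X => by
    rw [affinity_apply, zero_mul, add_zero]
  have hαA : dist F.O (F.affinity 0 (a / b) hk A) = a := by
    rw [F.dist_eq_abs_iff ha.le, hαx, x_pt, y_pt, x_O, y_O]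
    field_simp; linear_combination hA
  refine ⟨F.pt g 0, F.pt (F.x M) (a / b * F.y M), F.affinity 0 (a / b) hk, F.pt a 0, F.pt 0 b, ?_⟩
  constructor
  · refine ⟨by rw [F.mem_axis, y_pt], ?_⟩
    rw [F.mem_line hne, x_pt, y_pt]
    rw [hMx, hMy] at hg'
    linear_combination hg'
  · rw [F.mem_perpThrough, x_pt]
  · rw [F.dist_eq_iff]
    simp only [x_pt, y_pt, x_midpoint, y_midpoint, x_O, y_O]
    field_simp
    linear_combination 4 * hcirc
  · exact F.isOrthAffinity_affinity _ hk
  · rw [hαx]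
  · refine ⟨by rw [F.mem_axis, y_pt], ?_⟩
    rw [hαA, F.dist_eq_abs_iff ha.le]; simp
  · refine ⟨by rw [F.mem_perpThrough, x_pt, x_O], ?_⟩
    rw [hαA, F.dist_eq_abs_iff ha.le, hαx]; simp; field_simp

/-- Every way of carrying out the construction gives the vertices and the foci. -/
lemma ellipse_of_steps (ha : 0 < a) (hb : 0 < b)
    (hC : ∀ X, X ∈ C ↔ b ^ 2 * F.x X ^ 2 + a ^ 2 * F.y X ^ 2 = a ^ 2 * b ^ 2) {A B : Plane}
    (hA : A ∈ C) (hB : B ∈ C) (hAB : F.y A ≠ F.y B) (hM : midpoint ℝ A B ∉ F.axis) {G F' : Plane}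
    {α : Plane ≃ᵃ[ℝ] Plane} {V W : Plane} (h : EllipseSteps F.O F.axis A B G F' α V W) :
    dist F.O (α A) = dist F.O (α B) ∧
    α '' C = Metric.sphere F.O (dist F.O (α A)) ∧
    (F.axis : Set Plane) ∩ C = {V, pointMirror F.O V} ∧
    (perpThrough F.O F.axis : Set Plane) ∩ C = {W, pointMirror F.O W} ∧
    (dist F.O W ≤ dist F.O V →
      (∃ E ∈ F.axis, dist E W = dist F.O V) ∧
      ∀ E ∈ F.axis, dist E W = dist F.O V →
        IsEllipseWith C E (pointMirror F.O E) (2 * dist F.O V)) ∧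
    (dist F.O V ≤ dist F.O W →
      (∃ E ∈ perpThrough F.O F.axis, dist E V = dist F.O W) ∧
      ∀ E ∈ perpThrough F.O F.axis, dist E V = dist F.O W →
        IsEllipseWith C E (pointMirror F.O E) (2 * dist F.O W)) := by
  have hne : A ≠ B := by rintro rfl; exact hAB rfl
  have hy : F.y B - F.y A ≠ 0 := sub_ne_zero.2 hAB.symm
  obtain ⟨⟨hG, hGl⟩, hperp, hcirc, hα, hαM, ⟨hV, hVd⟩, ⟨hW, hWd⟩⟩ := h
  rw [hC] at hA hB
  rw [F.mem_axis] at hG hV hM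
  rw [F.mem_perpThrough] at hperp hW
  rw [F.x_O] at hW
  rw [F.mem_line hne, hG] at hGl
  rw [F.dist_eq_iff, hperp] at hcirc
  simp only [x_midpoint, y_midpoint, x_O, y_O, hG] at hcirc hM
  obtain ⟨k, hk, hαX⟩ := F.exists_of_isOrthAffinity hα
  rw [hαX] at hαM
  have hF'y := congrArg F.y hαM
  rw [y_pt, y_midpoint] at hF'y
  rw [← hF'y] at hcirc
  -- the chord and its midpoint have conjugate directions
  have hconj : b ^ 2 * (F.x A + F.x B) * (F.x B - F.x A) +
      a ^ 2 * (F.y A + F.y B) * (F.y B - F.y A) = 0 := by linear_combination hB - hA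
  -- the circle with the diameter `O G` forces the ratio `± a / b` of the affinity
  have hk2 : k ^ 2 * b ^ 2 = a ^ 2 := by
    have h1 : ((F.y A + F.y B) / 2) ^ 2 * (F.y B - F.y A) ≠ 0 := mul_ne_zero (pow_ne_zero 2 hM) hy
    have h2 : ((F.y A + F.y B) / 2) ^ 2 * (F.y B - F.y A) * (k ^ 2 * b ^ 2 - a ^ 2) = 0 := by
      linear_combination b ^ 2 * (F.y B - F.y A) * hcirc - b ^ 2 * (F.x A + F.x B) / 2 * hGl
        - (F.y A + F.y B) / 4 * hconj
    have := (mul_eq_zero.1 h2).resolve_left h1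
    linarith
  have hmem : ∀ X, X ∈ C ↔ dist F.O (α X) = a := by
    intro X
    rw [hC, F.dist_eq_abs_iff ha.le, hαX, x_pt, y_pt, x_O, y_O]
    have : b ^ 2 * ((0 - F.x X) ^ 2 + (0 - k * F.y X) ^ 2) =
      b ^ 2 * F.x X ^ 2 + a ^ 2 * F.y X ^ 2 := by linear_combination F.y X ^ 2 * hk2
    constructor <;> intro h
    · exact (mul_right_inj' (pow_ne_zero 2 hb.ne')).1 (by linear_combination this + h)
    · linear_combination b ^ 2 * h - this
  have hαA := (hmem A).1 ((hC A).2 hA)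
  have hαB := (hmem B).1 ((hC B).2 hB)
  rw [hαA] at hVd hWd
  rw [hVd, hαA, hαB]
  have hVx : F.x V ^ 2 = a ^ 2 := by
    rw [F.dist_eq_abs_iff ha.le, hV, x_O, y_O] at hVd; linarith
  have hWy : F.y W ^ 2 = b ^ 2 := by
    rw [F.dist_eq_abs_iff ha.le, hαX, x_pt, y_pt, x_O, y_O, hW] at hWd
    have h1 : k ^ 2 * (F.y W ^ 2 - b ^ 2) = 0 := by linear_combination hWd - hk2
    have := (mul_eq_zero.1 h1).resolve_left (pow_ne_zero 2 hk)
    linarith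
  have hOW : dist F.O W = b := by
    rw [F.dist_eq_abs_iff hb.le, hW, x_O, y_O]; linarith
  rw [hOW]
  refine ⟨rfl, ?_, ?_, ?_, ?_, ?_⟩
  · ext X
    rw [Metric.mem_sphere, dist_comm]
    constructor
    · rintro ⟨Y, hY, rfl⟩; exact (hmem Y).1 hY
    · intro hX
      refine ⟨α.symm X, ?_, by simp⟩
      rw [hmem]; simpa using hX
  · ext X
    simp only [mem_inter_iff, SetLike.mem_coe, F.mem_axis, hC, mem_insert_iff, mem_singleton_iff,
      F.eq_iff (X := X), x_pointMirror, y_pointMirror, x_O, y_O, hV]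
    constructor
    · rintro ⟨h1, h2⟩
      rw [h1] at h2
      have : F.x X ^ 2 = F.x V ^ 2 := by
        apply mul_left_cancel₀ (pow_ne_zero 2 hb.ne'); rw [hVx]; linarith
      rcases sq_eq_sq_iff_eq_or_eq_neg.1 this with h | h
      · exact Or.inl ⟨h, h1⟩
      · exact Or.inr ⟨by linarith, by linarith⟩
    · rintro (⟨h1, h2⟩ | ⟨h1, h2⟩)
      · exact ⟨h2, by rw [h1, h2, hVx]; ring⟩
      · exact ⟨by linarith, by rw [h1, h2]; linear_combination b ^ 2 * hVx⟩
  · ext X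
    simp only [mem_inter_iff, SetLike.mem_coe, F.mem_perpThrough, hC, mem_insert_iff,
      mem_singleton_iff, F.eq_iff (X := X), x_pointMirror, y_pointMirror, x_O, y_O, hW]
    constructor
    · rintro ⟨h1, h2⟩
      rw [h1] at h2
      have : F.y X ^ 2 = F.y W ^ 2 := by
        apply mul_left_cancel₀ (pow_ne_zero 2 ha.ne'); rw [hWy]; linarith
      rcases sq_eq_sq_iff_eq_or_eq_neg.1 this with h | h
      · exact Or.inl ⟨h1, h⟩
      · exact Or.inr ⟨by linarith, by linarith⟩
    · rintro (⟨h1, h2⟩ | ⟨h1, h2⟩)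
      · exact ⟨h1, by rw [h1, h2, hWy]; ring⟩
      · exact ⟨by linarith, by rw [h1, h2]; linear_combination a ^ 2 * hWy⟩
  · intro hba
    have hab : 0 ≤ a ^ 2 - b ^ 2 := by nlinarith
    refine ⟨⟨F.pt (√(a ^ 2 - b ^ 2)) 0, by rw [F.mem_axis, y_pt], ?_⟩, fun E hE hd => ?_⟩
    · rw [F.dist_eq_abs_iff ha.le, x_pt, y_pt, hW]
      linear_combination Real.sq_sqrt hab + hWy
    · rw [F.mem_axis] at hE
      rw [F.dist_eq_abs_iff ha.le, hE, hW] at hd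
      have e1 : E = F.pt (F.x E) 0 := by rw [← hE, F.pt_x_y]
      have e2 : pointMirror F.O E = F.pt (-F.x E) 0 := by
        apply F.ext_xy
        · simp
        · simp [hE]
      rw [e2]
      nth_rw 1 [e1]
      exact F.isEllipseWith ha hb hC (by linear_combination hd - hWy)
  · intro hab'
    have hab : 0 ≤ b ^ 2 - a ^ 2 := by nlinarith
    refine ⟨⟨F.pt 0 (√(b ^ 2 - a ^ 2)), by rw [F.mem_perpThrough, x_pt, x_O], ?_⟩,
      fun E hE hd => ?_⟩
    · rw [F.dist_eq_abs_iff hb.le, x_pt, y_pt, hV]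
      linear_combination Real.sq_sqrt hab + hVx
    · rw [F.mem_perpThrough, x_O] at hE
      rw [F.dist_eq_abs_iff hb.le, hE, hV] at hd
      have e1 : E = F.turn.pt (F.y E) 0 := by
        apply F.turn.ext_xy
        · simp
        · simp [hE]
      have e2 : pointMirror F.O E = F.turn.pt (-F.y E) 0 := by
        apply F.turn.ext_xy
        · simp
        · simp [hE]
      rw [e2]
      nth_rw 1 [e1]
      refine F.turn.isEllipseWith hb ha (fun X => ?_) (by linear_combination hd - hVx)
      rw [hC, x_turn, y_turn]
      constructor <;> intro h <;> linarith

end Frame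

namespace Quadric

variable {P : Fin 5 → Plane} {Q : Quadric}

/-- An axis of a central conic passes through the centre, and its direction is a principal
direction. -/
lemma IsCtr.exists_frame_of_isAxis (hP : General P) (hQ : ∀ i, P i ∈ Q.zeros) (hd : Q.det ≠ 0)
    {O : Plane} (hO : Q.IsCtr O) {t : Sub} (ht : IsAxis Q.zeros t) :
    ∃ F : Frame, F.O = O ∧ t = F.axis ∧ Q.form F.u (rot F.u) = 0 := by
  have hmem : O ∈ t := by
    obtain ⟨F, -, rfl⟩ := ht.1.exists_frame ht.1.1.some_mem
    obtain ⟨h1, h2⟩ := F.form_eq_zero_of_isAxis hP hQ ht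
    have h3 := hO (rot F.u)
    have hcr : crs F.u (rot F.u) ≠ 0 := by rw [F.crs_u_rot]; exact one_ne_zero
    rw [Q.lin_eq F.O, h2, eq_basis hcr (O - F.O), form_add_left, form_smul_left, form_smul_left, h1,
      F.crs_u, F.crs_u_rot, F.y_O] at h3
    have hrr : Q.form (rot F.u) (rot F.u) ≠ 0 := by
      intro h0
      apply hO.disc_ne_zero hd
      rw [F.disc_eq, h1, h0]; ring
    have := (mul_eq_zero.1 (by linarith :
      F.y O * Q.form (rot F.u) (rot F.u) = 0)).resolve_right hrr
    exact F.mem_axis.2 this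
  obtain ⟨F, hF, rfl⟩ := ht.1.exists_frame hmem
  exact ⟨F, hF, rfl, (F.form_eq_zero_of_isAxis hP hQ ht).1⟩

/-- Vertices and foci of an ellipse from one of its axes. -/
lemma ellipse_foci_part (hP : General P) (hQ : ∀ i, P i ∈ Q.zeros) (hd : Q.det ≠ 0)
    (hdisc : 0 < Q.disc) {O : Plane} (hO : Q.IsCtr O) {t : Sub} (ht : IsAxis Q.zeros t) :
    (∃ i j, i ≠ j ∧ ¬ line[ℝ, P i, P j] ∥ t ∧ midpoint ℝ (P i) (P j) ∉ t) ∧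
    ∀ i j, i ≠ j → ¬ line[ℝ, P i, P j] ∥ t → midpoint ℝ (P i) (P j) ∉ t →
      (∃ G F' α V W, EllipseSteps O t (P i) (P j) G F' α V W) ∧
      ∀ G F' α V W, EllipseSteps O t (P i) (P j) G F' α V W →
        dist O (α (P i)) = dist O (α (P j)) ∧
        α '' Q.zeros = Metric.sphere O (dist O (α (P i))) ∧
        (t : Set Plane) ∩ Q.zeros = {V, pointMirror O V} ∧
        (perpThrough O t : Set Plane) ∩ Q.zeros = {W, pointMirror O W} ∧
        (dist O W ≤ dist O V →
          (∃ F ∈ t, dist F W = dist O V) ∧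
          ∀ F ∈ t, dist F W = dist O V →
            IsEllipseWith Q.zeros F (pointMirror O F) (2 * dist O V)) ∧
        (dist O V ≤ dist O W →
          (∃ F ∈ perpThrough O t, dist F V = dist O W) ∧
          ∀ F ∈ perpThrough O t, dist F V = dist O W →
            IsEllipseWith Q.zeros F (pointMirror O F) (2 * dist O W)) := by
  obtain ⟨F, rfl, rfl, hur⟩ := hO.exists_frame_of_isAxis hP hQ hd ht
  have hk := hO.eval_ne_zero hd
  have hev := F.eval_eq Q
  have hdq := F.disc_eq Q
  simp only [hur, hO F.u, hO (rot F.u)] at hev hdq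
  have hαγ : 0 < Q.form F.u F.u * Q.form (rot F.u) (rot F.u) := by linarith
  obtain ⟨a, b, ha, hb, hC⟩ : ∃ a b : ℝ, 0 < a ∧ 0 < b ∧ ∀ X, X ∈ Q.zeros ↔
      b ^ 2 * F.x X ^ 2 + a ^ 2 * F.y X ^ 2 = a ^ 2 * b ^ 2 := by
    have h0 := hQ 0
    rw [mem_zeros, hev] at h0
    have hz : ∀ X, X ∈ Q.zeros ↔ _ = (0 : ℝ) := fun X => by rw [mem_zeros, hev X]
    simp only [hz]
    clear hz hdq hev
    generalize Q.form F.u F.u = α at *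
    generalize Q.form (rot F.u) (rot F.u) = γ at *
    generalize Q.eval F.O = k at *
    have hα0 : α ≠ 0 := left_ne_zero_of_mul hαγ.ne'
    have hγ0 : γ ≠ 0 := right_ne_zero_of_mul hαγ.ne'
    have h1 : 0 < -k / α ∧ 0 < -k / γ := by
      rcases pos_and_pos_or_neg_and_neg_of_mul_pos hαγ with ⟨p, q⟩ | ⟨p, q⟩
      · have : k < 0 := lt_of_le_of_ne (by
          nlinarith [mul_nonneg p.le (sq_nonneg (F.x (P 0))),
            mul_nonneg q.le (sq_nonneg (F.y (P 0)))]) hk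
        exact ⟨div_pos (by linarith) p, div_pos (by linarith) q⟩
      · have : 0 < k := lt_of_le_of_ne (by
          nlinarith [mul_nonneg (neg_pos.2 p).le (sq_nonneg (F.x (P 0))),
            mul_nonneg (neg_pos.2 q).le (sq_nonneg (F.y (P 0)))]) hk.symm
        exact ⟨div_pos_of_neg_of_neg (by linarith) p, div_pos_of_neg_of_neg (by linarith) q⟩
    refine ⟨√(-k / α), √(-k / γ), Real.sqrt_pos.2 h1.1, Real.sqrt_pos.2 h1.2, fun X => ?_⟩
    rw [Real.sq_sqrt h1.1.le, Real.sq_sqrt h1.2.le]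
    have : -k / γ * F.x X ^ 2 + -k / α * F.y X ^ 2 - -k / α * (-k / γ) =
      -k / (α * γ) * (α * F.x X ^ 2 + 2 * 0 * F.x X * F.y X + γ * F.y X ^ 2 + 2 * 0 * F.x X
        + 2 * 0 * F.y X + k) := by field_simp; ring
    rw [← sub_eq_zero (a := -k / γ * F.x X ^ 2 + -k / α * F.y X ^ 2), this, mul_eq_zero,
      or_iff_right (div_ne_zero (neg_ne_zero.2 hk) hαγ.ne')]
  refine ⟨F.ellipse_exists_pair hP, fun i j hij hpar hmid => ?_⟩
  rw [F.line_parallel_axis_iff (hP.ne hij)] at hpar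
  exact ⟨F.ellipse_exists_steps ha hb hC (hQ i) (hQ j) hpar,
    fun G F' α V W h => F.ellipse_of_steps ha hb hC (hQ i) (hQ j) hpar hmid h⟩

end Quadric

/-! ### Asymptotes -/

namespace Quadric

variable {P : Fin 5 → Plane} {Q : Quadric}

/-- An asymptote has an isotropic direction, and the derivative of the quadric in this direction
vanishes on it: these are the two leading coefficients of the quadric on points `A + s w + e` with
`s → ∞` and `e → 0`. -/
lemma form_eq_zero_of_isAsymptote {A w : Plane} (hw : w ≠ 0) (h : IsAsymptote Q.zeros (ln A w)) :
    Q.form w w = 0 ∧ Q.lin A w = 0 := by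
  obtain ⟨-, hne, hlim⟩ := h
  have hX : Tendsto (fun n : ℕ => A + ((n : ℝ) + 1) • w) atTop
      (cocompact Plane ⊓ 𝓟 (ln A w : Set Plane)) := by
    rw [tendsto_inf, tendsto_principal]
    refine ⟨?_, Eventually.of_forall fun n => SetLike.mem_coe.2 (mem_ln_iff.2 ⟨_, rfl⟩)⟩
    apply tendsto_cocompact_of_tendsto_dist_comp_atTop A
    have : ∀ n : ℕ, dist (A + ((n : ℝ) + 1) • w) A = ((n : ℝ) + 1) * ‖w‖ := by
      intro n
      rw [dist_eq_norm, add_sub_cancel_left, norm_smul, Real.norm_of_nonneg (by positivity)]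
    simp only [this]
    exact (tendsto_natCast_atTop_atTop.atTop_add tendsto_const_nhds).atTop_mul_const
      (norm_pos_iff.2 hw)
  have ht : Tendsto (fun n : ℕ => ((n : ℝ) + 1)⁻¹) atTop (𝓝 0) := by
    simpa only [one_div] using tendsto_one_div_add_atTop_nhds_zero_nat (𝕜 := ℝ)
  have hY : ∀ n : ℕ, ∃ e : Plane, A + ((n : ℝ) + 1) • w + e ∈ Q.zeros ∧
      ‖e‖ < Metric.infDist (A + ((n : ℝ) + 1) • w) Q.zeros + ((n : ℝ) + 1)⁻¹ := by
    intro n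
    obtain ⟨Y, hY, hd⟩ := (Metric.infDist_lt_iff (x := A + ((n : ℝ) + 1) • w) hne).1
      (lt_add_of_pos_right _ (by positivity : 0 < ((n : ℝ) + 1)⁻¹))
    refine ⟨Y - (A + ((n : ℝ) + 1) • w), by rwa [add_sub_cancel], ?_⟩
    rwa [← dist_eq_norm, dist_comm]
  choose e hmem hlt using hY
  have he : Tendsto e atTop (𝓝 0) := by
    rw [tendsto_zero_iff_norm_tendsto_zero]
    refine squeeze_zero (fun _ => norm_nonneg _) (fun n => (hlt n).le) ?_
    simpa using (hlim.comp hX).add ht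
  have key : ∀ f : ℝ × Plane → ℝ, Continuous f →
      (∀ n : ℕ, f (((n : ℝ) + 1)⁻¹, e n) = 0) → f (0, 0) = 0 := by
    intro f hf h0
    have h1 := (hf.tendsto (0, 0)).comp (ht.prodMk_nhds he)
    have h2 : f ∘ (fun n : ℕ => (((n : ℝ) + 1)⁻¹, e n)) = fun _ => 0 := funext h0
    rw [h2] at h1
    exact tendsto_nhds_unique h1 tendsto_const_nhds
  have hev : ∀ n : ℕ, Q.eval A + 2 * (((n : ℝ) + 1) * Q.lin A w + Q.lin A (e n)) +
      (((n : ℝ) + 1) ^ 2 * Q.form w w + 2 * ((n : ℝ) + 1) * Q.form w (e n)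
        + Q.form (e n) (e n)) = 0 := by
    intro n
    have := hmem n
    rw [mem_zeros, add_assoc, eval_add, lin_add_right, lin_smul_right] at this
    simp only [form_add_left, form_add_right, form_smul_left, form_smul_right,
      Q.form_comm (e n) w] at this
    linear_combination this
  have h1 : Q.form w w = 0 := by
    have := key (fun p => p.1 ^ 2 * Q.eval A + 2 * (p.1 * Q.lin A w + p.1 ^ 2 * Q.lin A p.2) +
      (Q.form w w + 2 * p.1 * Q.form w p.2 + p.1 ^ 2 * Q.form p.2 p.2))
      (by simp only [form, lin]; fun_prop) (fun n => by
        have hn : (n : ℝ) + 1 ≠ 0 := by positivity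
        have := hev n
        field_simp
        linear_combination this)
    simpa using this
  refine ⟨h1, ?_⟩
  have := key (fun p => p.1 * Q.eval A + 2 * (Q.lin A w + p.1 * Q.lin A p.2) +
    (2 * Q.form w p.2 + p.1 * Q.form p.2 p.2))
    (by simp only [form, lin]; fun_prop) (fun n => by
      have hn : (n : ℝ) + 1 ≠ 0 := by positivity
      have := hev n
      rw [h1] at this
      field_simp
      linear_combination this)
  simpa [form] using this

/-- The asymptotes of a central conic pass through the centre. -/
lemma IsCtr.exists_of_isAsymptote {O : Plane} (hO : Q.IsCtr O) (hd : Q.det ≠ 0) {L : Sub}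
    (h : IsAsymptote Q.zeros L) : ∃ w, w ≠ 0 ∧ Q.form w w = 0 ∧ L = ln O w := by
  obtain ⟨A, w, hw, rfl⟩ := h.1.exists_eq
  obtain ⟨h1, h2⟩ := form_eq_zero_of_isAsymptote hw h
  refine ⟨w, hw, h1, ?_⟩
  have hO' : O ∈ ln A w := by
    rw [Q.lin_eq O, hO, zero_add] at h2
    rw [mem_ln hw]
    by_contra hc
    refine hw (eq_zero_of_form (hO.disc_ne_zero hd) hc h1 ?_)
    rw [← neg_eq_zero, ← h2]
    simp only [form, PiLp.sub_apply]; ring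
  obtain ⟨r, hr⟩ := mem_ln_iff.1 hO'
  rw [ln_eq_ln_iff hw hw]
  exact ⟨by simp only [crs]; ring, (mem_ln hw).1 hO'⟩

/-- Two different isotropic lines through the centre are asymptotes. -/
lemma IsCtr.isAsymptote_ln {O : Plane} (hO : Q.IsCtr O) (hd : Q.det ≠ 0) (hne : Q.zeros.Nonempty)
    {u v : Plane} (hc : crs u v ≠ 0) (hu : Q.form u u = 0) (hv : Q.form v v = 0) :
    IsAsymptote Q.zeros (ln O u) := by
  have hu0 : u ≠ 0 := ne_zero_left_of_crs hc
  have huv : Q.form u v ≠ 0 := fun h0 =>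
    hu0 (eq_zero_of_form (hO.disc_ne_zero hd) hc hu (by rw [form_comm, h0]))
  refine ⟨isLine_ln O hu0, hne, ?_⟩
  -- the point `O + s u` has the distance `K / |s|` from a point of the conic in the direction `v`
  set c := -Q.eval O / (2 * Q.form u v) with hcdef
  have hbound : ∀ X ∈ ln O u, X ≠ O → Metric.infDist X Q.zeros ≤ |c| * ‖v‖ * ‖u‖ / dist O X := by
    intro X hX hXO
    obtain ⟨s, rfl⟩ := mem_ln_iff.1 hX
    have hs : s ≠ 0 := by rintro rfl; simp at hXO
    have hm : O + s • u + (c / s) • v ∈ Q.zeros := by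
      rw [mem_zeros, add_assoc, hO.eval_add]
      simp only [form_add_left, form_add_right, form_smul_left, form_smul_right, hu, hv,
        Q.form_comm v u]
      rw [hcdef]; field_simp; ring
    refine (Metric.infDist_le_dist_of_mem hm).trans (le_of_eq ?_)
    have hsu : |s| ≠ 0 := abs_ne_zero.2 hs
    have hun : ‖u‖ ≠ 0 := norm_ne_zero_iff.2 hu0
    rw [dist_eq_norm, dist_eq_norm, sub_add_cancel_left, sub_add_cancel_left, norm_neg, norm_neg,
      norm_smul, norm_smul, Real.norm_eq_abs, Real.norm_eq_abs, abs_div]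
    field_simp
  have hdist : Tendsto (dist O) (cocompact Plane ⊓ 𝓟 (ln O u : Set Plane)) atTop :=
    (tendsto_dist_left_cocompact_atTop O).mono_left inf_le_left
  refine tendsto_of_tendsto_of_tendsto_of_le_of_le' tendsto_const_nhds
    (hdist.const_div_atTop (|c| * ‖v‖ * ‖u‖))
    (Eventually.of_forall fun _ => Metric.infDist_nonneg) ?_
  filter_upwards [hdist.eventually_gt_atTop 0, mem_inf_of_right (mem_principal_self _)] with X h1 h2
  exact hbound X h2 (dist_pos.1 h1).symm

/-- The asymptotes of a central conic are its two isotropic lines through the centre. -/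
lemma IsCtr.isAsymptote_iff {O : Plane} (hO : Q.IsCtr O) (hd : Q.det ≠ 0) (hne : Q.zeros.Nonempty)
    {u v : Plane} (hc : crs u v ≠ 0) (hu : Q.form u u = 0) (hv : Q.form v v = 0) {L : Sub} :
    IsAsymptote Q.zeros L ↔ L = ln O u ∨ L = ln O v := by
  have hu0 : u ≠ 0 := ne_zero_left_of_crs hc
  have hv0 : v ≠ 0 := ne_zero_right_of_crs hc
  constructor
  · intro h
    obtain ⟨w, hw, hww, rfl⟩ := hO.exists_of_isAsymptote hd h
    have huv : Q.form u v ≠ 0 := fun h0 =>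
      hu0 (eq_zero_of_form (hO.disc_ne_zero hd) hc hu (by rw [form_comm, h0]))
    have hb := eq_basis hc w
    rw [hb] at hww
    simp only [form_add_left, form_add_right, form_smul_left, form_smul_right, hu, hv,
      Q.form_comm v u] at hww
    have : crs w v * crs u w = 0 := by
      have h2 : (2 * Q.form u v) * (crs w v * crs u w) = 0 := by
        field_simp at hww
        linear_combination hww
      exact (mul_eq_zero.1 h2).resolve_left (mul_ne_zero two_ne_zero huv)
    rcases mul_eq_zero.1 this with h | h
    · right
      rw [ln_eq_ln_iff hw hv0]
      exact ⟨h, by simp [crs]⟩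
    · left
      rw [ln_eq_ln_iff hw hu0]
      exact ⟨by simp only [crs] at *; linarith, by simp [crs]⟩
  · rintro (rfl | rfl)
    · exact hO.isAsymptote_ln hd hne hc hu hv
    · refine hO.isAsymptote_ln hd hne (v := u) ?_ hv hu
      contrapose! hc
      simp only [crs] at *; linarith

end Quadric

/-! ### Asymptotes from three points -/

namespace Frame

variable (F : Frame)

section

variable {l m p r dx dy : ℝ}

/-- If the chord with midpoint `(p, r)` and direction `(dx, dy)` of a hyperbola `l x² + m y² = k` is
not parallel to an axis and not a diameter, all of these coordinates are different from zero. -/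
lemma chord_coords_ne_zero (hlm : l * m < 0) (h : l * p * dx + m * r * dy = 0) (hdy : dy ≠ 0)
    (hpr : ¬ (p = 0 ∧ r = 0)) (hdr : ¬ (dx = 0 ∧ r = 0)) : dx ≠ 0 ∧ p ≠ 0 ∧ r ≠ 0 := by
  have hl : l ≠ 0 := left_ne_zero_of_mul hlm.ne
  have hm : m ≠ 0 := right_ne_zero_of_mul hlm.ne
  have hr : r ≠ 0 := by
    rintro rfl
    have : l * (p * dx) = 0 := by linear_combination h
    rcases mul_eq_zero.1 ((mul_eq_zero.1 this).resolve_left hl) with h | h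
    · exact hpr ⟨h, rfl⟩
    · exact hdr ⟨h, rfl⟩
  have hne : l * p * dx ≠ 0 := by
    intro h0
    exact mul_ne_zero (mul_ne_zero hm hr) hdy (by linarith)
  exact ⟨right_ne_zero_of_mul hne, right_ne_zero_of_mul (left_ne_zero_of_mul hne), hr⟩

variable {Q R : Plane} (hxQ : F.x Q = p - dx / 2) (hyQ : F.y Q = r - dy / 2)
  (hxR : F.x R = p + dx / 2) (hyR : F.y R = r + dy / 2)
include hxQ hyQ hxR hyR

lemma mem_bisector {X : Plane} : X ∈ perpThrough (midpoint ℝ Q R) line[ℝ, Q, R] ↔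
    dx * (F.x X - p) + dy * (F.y X - r) = 0 := by
  rw [line_eq_ln, mem_perpThrough_ln, F.dotp_sub, x_midpoint, y_midpoint, hxQ, hyQ, hxR, hyR]
  constructor <;> intro h <;> linear_combination h

lemma mem_chord {X : Plane} (hdy : dy ≠ 0) : X ∈ line[ℝ, Q, R] ↔
    dx * (F.y X - r) - dy * (F.x X - p) = 0 := by
  have hne : Q ≠ R := by
    rintro rfl; apply hdy; linarith
  rw [F.mem_line hne, hxQ, hyQ, hxR, hyR]
  constructor <;> intro h <;> linear_combination h

/-- The bisector of a chord of a hyperbola meets the axis in `M`; the circle around the common point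
of this bisector and the bisector of `O M` meets the line of the chord in two points. -/
lemma exists_asymptote_points (hlm : l * m < 0) (h : l * p * dx + m * r * dy = 0) (hdx : dx ≠ 0)
    (hdy : dy ≠ 0) (hp : p ≠ 0) (hr : r ≠ 0) :
    ∃ M N A B : Plane, (M ∈ F.axis ∧ M ∈ perpThrough (midpoint ℝ Q R) line[ℝ, Q, R]) ∧
      (dist N F.O = dist N M ∧ N ∈ perpThrough (midpoint ℝ Q R) line[ℝ, Q, R]) ∧ A ≠ B ∧
      (A ∈ line[ℝ, Q, R] ∧ dist N A = dist N F.O) ∧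
      (B ∈ line[ℝ, Q, R] ∧ dist N B = dist N F.O) := by
  -- on the line `(p + s dx, r + s dy)` of the chord both the asymptotes and the circle are given by
  -- `s² = p r / (dx dy)`
  have hpos : 0 < p * r / (dx * dy) := by
    have h1 : 0 < p * r * (dx * dy) := by
      have h2 : l ^ 2 * (p * r * (dx * dy)) = -(l * m) * (r * dy) ^ 2 := by
        linear_combination l * r * dy * h
      have h3 : 0 < -(l * m) * (r * dy) ^ 2 := mul_pos (by linarith) (by positivity)
      rw [← h2] at h3
      exact pos_of_mul_pos_right h3 (sq_nonneg l)
    have : p * r / (dx * dy) = p * r * (dx * dy) / (dx * dy) ^ 2 := by field_simp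
    rw [this]; positivity
  have hs := Real.sq_sqrt hpos.le
  have hs0 := Real.sqrt_pos.2 hpos
  set s := √(p * r / (dx * dy))
  have hs' : s ^ 2 * (dx * dy) = p * r := by rw [hs]; field_simp
  clear_value s
  have hcirc : ∀ s : ℝ, s ^ 2 * (dx * dy) = p * r →
      dist (F.pt ((p + r * dy / dx) / 2) (r / 2 + p * dx / (2 * dy)))
        (F.pt (p + s * dx) (r + s * dy)) =
      dist (F.pt ((p + r * dy / dx) / 2) (r / 2 + p * dx / (2 * dy))) F.O := by
    intro s hs
    rw [F.dist_eq_iff]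
    simp only [x_pt, y_pt, x_O, y_O]
    rw [← sub_eq_zero]
    have : ((p + r * dy / dx) / 2 - (p + s * dx)) ^ 2 +
        (r / 2 + p * dx / (2 * dy) - (r + s * dy)) ^ 2 - (((p + r * dy / dx) / 2 - 0) ^ 2 +
        (r / 2 + p * dx / (2 * dy) - 0) ^ 2) =
        (dx ^ 2 + dy ^ 2) / (dx * dy) * (s ^ 2 * (dx * dy) - p * r) := by
      field_simp; ring
    rw [this, hs, sub_self, mul_zero]
  refine ⟨F.pt (p + r * dy / dx) 0, F.pt ((p + r * dy / dx) / 2) (r / 2 + p * dx / (2 * dy)),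
    F.pt (p + s * dx) (r + s * dy), F.pt (p + (-s) * dx) (r + (-s) * dy), ⟨?_, ?_⟩, ⟨?_, ?_⟩, ?_,
    ⟨?_, hcirc s hs'⟩, ⟨?_, hcirc (-s) (by rw [neg_sq, hs'])⟩⟩
  · rw [F.mem_axis, y_pt]
  · rw [F.mem_bisector hxQ hyQ hxR hyR, x_pt, y_pt]; field_simp; ring
  · rw [F.dist_eq_iff]; simp only [x_pt, y_pt, x_O, y_O]; ring
  · rw [F.mem_bisector hxQ hyQ hxR hyR, x_pt, y_pt]; field_simp; ring
  · intro h
    have := congrArg F.x h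
    rw [x_pt, x_pt] at this
    exact mul_ne_zero hs0.ne' hdx (by linarith)
  · rw [F.mem_chord hxQ hyQ hxR hyR hdy, x_pt, y_pt]; ring
  · rw [F.mem_chord hxQ hyQ hxR hyR hdy, x_pt, y_pt]; ring

/-- The points found by the circle are points of the asymptotes, i.e. they have isotropic position
vectors. -/
lemma asymptote_points (hlm : l * m < 0) (h : l * p * dx + m * r * dy = 0) (hdx : dx ≠ 0)
    (hdy : dy ≠ 0) (hr : r ≠ 0) (hk : l * F.x Q ^ 2 + m * F.y Q ^ 2 ≠ 0)
    {M N A B : Plane} (hM : M ∈ F.axis ∧ M ∈ perpThrough (midpoint ℝ Q R) line[ℝ, Q, R])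
    (hN : dist N F.O = dist N M ∧ N ∈ perpThrough (midpoint ℝ Q R) line[ℝ, Q, R]) (hAB : A ≠ B)
    (hA : A ∈ line[ℝ, Q, R] ∧ dist N A = dist N F.O)
    (hB : B ∈ line[ℝ, Q, R] ∧ dist N B = dist N F.O) :
    l * F.x A ^ 2 + m * F.y A ^ 2 = 0 ∧ l * F.x B ^ 2 + m * F.y B ^ 2 = 0 ∧
      F.x A * F.y B - F.y A * F.x B ≠ 0 := by
  rw [F.mem_axis, F.mem_bisector hxQ hyQ hxR hyR] at hM
  rw [F.mem_bisector hxQ hyQ hxR hyR, F.dist_eq_iff, x_O, y_O, hM.1] at hN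
  obtain ⟨hM0, hM1⟩ := hM
  obtain ⟨hN0, hN1⟩ := hN
  rw [hM0] at hM1
  -- otherwise the bisector of the chord passes through the centre, and the chord is parallel to an
  -- axis or a diameter
  have hMx : F.x M ≠ 0 := by
    intro h0
    rw [h0] at hM1
    have h1 : (l - m) * (r * dy) = 0 := by linear_combination -l * hM1 - h
    have h2 : l - m ≠ 0 := by
      intro h2
      have : l = m := by linarith
      rw [this] at hlm
      nlinarith [mul_self_nonneg m]
    exact mul_ne_zero h2 (mul_ne_zero hr hdy) h1
  have hNx : F.x N = F.x M / 2 := by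
    have : F.x M * (2 * F.x N - F.x M) = 0 := by linear_combination hN0
    have := (mul_eq_zero.1 this).resolve_left hMx
    linarith
  have key : ∀ X, X ∈ line[ℝ, Q, R] ∧ dist N X = dist N F.O →
      ∃ s : ℝ, F.x X = p + s * dx ∧ F.y X = r + s * dy ∧ l * F.x X ^ 2 + m * F.y X ^ 2 = 0 := by
    rintro X ⟨h1, h2⟩
    rw [F.mem_chord hxQ hyQ hxR hyR hdy] at h1
    rw [F.dist_eq_iff, x_O, y_O] at h2
    obtain ⟨s, hs⟩ : ∃ s, F.x X = p + s * dx := ⟨(F.x X - p) / dx, by field_simp; ring⟩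
    have hs' : F.y X = r + s * dy := by
      apply mul_left_cancel₀ hdx
      rw [hs] at h1
      linear_combination h1
    rw [hs, hs'] at h2
    rw [hs, hs']
    refine ⟨s, rfl, rfl, ?_⟩
    rw [hNx] at hN1 h2
    -- the position on the circle determines `s²`
    have hss : s ^ 2 * (dx * dy) = p * r := by
      have h3 : (dx ^ 2 + dy ^ 2) * (s ^ 2 * (dx * dy) - p * r) = 0 := by
        linear_combination dx * dy * h2 + (2 * s * dx * dy + 2 * r * dx) * hN1
          + (p * dy - r * dx) * hM1
      have := (mul_eq_zero.1 h3).resolve_left (by positivity)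
      linarith
    apply (mul_eq_zero.1 (_ : dx * dy * _ = 0)).resolve_left (mul_ne_zero hdx hdy)
    linear_combination (p * dy + r * dx + 2 * s * dx * dy) * h + (l * dx ^ 2 + m * dy ^ 2) * hss
  obtain ⟨s, hs1, hs2, hs3⟩ := key A hA
  obtain ⟨s', hs1', hs2', hs3'⟩ := key B hB
  refine ⟨hs3, hs3', ?_⟩
  have e : F.x A * F.y B - F.y A * F.x B = (s' - s) * (p * dy - r * dx) := by
    rw [hs1, hs2, hs1', hs2']; ring
  rw [e]
  refine mul_ne_zero (sub_ne_zero.2 ?_) ?_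
  · rintro rfl
    exact hAB (F.ext_xy (by rw [hs1, hs1']) (by rw [hs2, hs2']))
  · -- otherwise the line of the chord passes through the centre and is isotropic
    intro h0
    apply hk
    obtain ⟨t, ht⟩ : ∃ t, p = t * dx := ⟨p / dx, by field_simp⟩
    have ht' : r = t * dy := by
      apply mul_left_cancel₀ hdx
      rw [ht] at h0
      linear_combination -h0
    have ht0 : t ≠ 0 := by rintro rfl; apply hr; rw [ht', zero_mul]
    have hiso : l * dx ^ 2 + m * dy ^ 2 = 0 := by
      apply (mul_eq_zero.1 (_ : t * _ = 0)).resolve_left ht0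
      rw [ht, ht'] at h
      linear_combination h
    rw [hxQ, hyQ, ht, ht']
    linear_combination (t - 1 / 2) ^ 2 * hiso

end

end Frame

namespace Quadric

variable {P : Fin 5 → Plane} {Q : Quadric}

/-- Being the ends of a diameter is a partial matching of the five points, so three of them are
pairwise not related. -/
lemma exists_three_midpoint_ne (hP : General P) (O : Plane) :
    ∃ i j k : Fin 5, i ≠ j ∧ i ≠ k ∧ j ≠ k ∧ midpoint ℝ (P i) (P j) ≠ O ∧
      midpoint ℝ (P i) (P k) ≠ O ∧ midpoint ℝ (P j) (P k) ≠ O := by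
  have hs : ∀ i j, midpoint ℝ (P i) (P j) = O → midpoint ℝ (P j) (P i) = O := fun i j h => by
    rwa [midpoint_comm]
  have hu : ∀ i j k, j ≠ k → midpoint ℝ (P i) (P j) = O → midpoint ℝ (P i) (P k) ≠ O := by
    intro i j k hjk h1 h2
    apply hP.ne hjk
    rw [midpoint_eq_iff] at h1 h2
    rw [← h1, ← h2]
  by_cases h01 : midpoint ℝ (P 0) (P 1) = O
  · have h02 := hu 0 1 2 (by decide) h01
    by_cases h23 : midpoint ℝ (P 2) (P 3) = O
    · exact ⟨0, 2, 4, by decide, by decide, by decide, h02, hu 0 1 4 (by decide) h01,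
        hu 2 3 4 (by decide) h23⟩
    · exact ⟨0, 2, 3, by decide, by decide, by decide, h02, hu 0 1 3 (by decide) h01, h23⟩
  by_cases h02 : midpoint ℝ (P 0) (P 2) = O
  · have h03 := hu 0 2 3 (by decide) h02
    by_cases h13 : midpoint ℝ (P 1) (P 3) = O
    · exact ⟨0, 1, 4, by decide, by decide, by decide, h01, hu 0 2 4 (by decide) h02,
        hu 1 3 4 (by decide) h13⟩
    · exact ⟨0, 1, 3, by decide, by decide, by decide, h01, h03, h13⟩
  by_cases h12 : midpoint ℝ (P 1) (P 2) = O
  · have h13 := hu 1 2 3 (by decide) h12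
    by_cases h03 : midpoint ℝ (P 0) (P 3) = O
    · exact ⟨0, 1, 4, by decide, by decide, by decide, h01, hu 0 3 4 (by decide) h03,
        hu 1 2 4 (by decide) h12⟩
    · exact ⟨0, 1, 3, by decide, by decide, by decide, h01, h03, h13⟩
  exact ⟨0, 1, 2, by decide, by decide, by decide, h01, h02, h12⟩

/-- The asymptotes of a hyperbola from its centre and three of its points. -/
lemma asymptotes_part (hP : General P) (hQ : ∀ i, P i ∈ Q.zeros) (hd : Q.det ≠ 0) {O : Plane}
    (hO : Q.IsCtr O) (hdisc : Q.disc < 0) :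
    (∃ i j k, i ≠ j ∧ i ≠ k ∧ j ≠ k ∧ midpoint ℝ (P i) (P j) ≠ O ∧
      midpoint ℝ (P j) (P k) ≠ O ∧
      ¬ line[ℝ, P j, P k] ∥ line[ℝ, O, midpoint ℝ (P i) (P j)]) ∧
    ∀ i j k, i ≠ j → i ≠ k → j ≠ k → midpoint ℝ (P i) (P j) ≠ O →
      midpoint ℝ (P j) (P k) ≠ O →
      ¬ line[ℝ, P j, P k] ∥ line[ℝ, O, midpoint ℝ (P i) (P j)] →
      (∃ α M N A B, AsymptoteSteps O (P i) (P j) (P k) α M N A B) ∧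
      ∀ α M N A B, AsymptoteSteps O (P i) (P j) (P k) α M N A B →
        line[ℝ, O, A] ≠ line[ℝ, O, B] ∧
        ∀ L, IsAsymptote Q.zeros L ↔ L = line[ℝ, O, A] ∨ L = line[ℝ, O, B] := by
  constructor
  · obtain ⟨i, j, k, hij, hik, hjk, h1, h2, h3⟩ := exists_three_midpoint_ne hP O
    refine ⟨i, j, k, hij, hik, hjk, h1, h3, fun hpar => h2 ?_⟩
    rw [← hO.form_chords_eq_zero_iff hd (hQ i) (hQ j) (hQ k) (hP i j k hij hik hjk)]
    rw [line_eq_ln, line_eq_ln, parallel_ln_iff (sub_ne_zero.2 (hP.ne hjk).symm)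
      (sub_ne_zero.2 h1)] at hpar
    -- the line from the centre to the midpoint of a chord is conjugate to the chord
    have hc := lin_midpoint (hQ i) (hQ j)
    rw [Q.lin_eq O, hO, zero_add] at hc
    obtain ⟨r, hr⟩ := (crs_eq_zero_iff (sub_ne_zero.2 (hP.ne hjk).symm)).1 hpar
    have hr0 : r ≠ 0 := by
      rintro rfl; rw [zero_smul] at hr; exact h1 (sub_eq_zero.1 hr)
    rw [hr, form_smul_left] at hc
    exact (mul_eq_zero.1 hc).resolve_left hr0
  · intro i j k hij hik hjk h1 h2 h3
    obtain ⟨F, rfl, hax⟩ := (isLine_line h1.symm).exists_frame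
      (left_mem_affineSpan_pair ℝ O (midpoint ℝ (P i) (P j)))
    rw [hax, F.line_parallel_axis_iff (hP.ne hjk)] at h3
    have hyD : F.y (P j) = -F.y (P i) := by
      have := F.mem_axis.1 (hax ▸ right_mem_affineSpan_pair ℝ F.O (midpoint ℝ (P i) (P j)))
      rw [F.y_midpoint] at this
      linarith
    have hxD : F.x (P i) + F.x (P j) ≠ 0 := by
      intro h
      apply h1
      apply F.ext_xy
      · rw [F.x_midpoint, h, F.x_O, zero_div]
      · rw [F.y_midpoint, hyD, F.y_O]; ring
    have hk0 := hO.eval_ne_zero hd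
    have hev : ∀ X, Q.form (X - F.O) (X - F.O) = Q.form F.u F.u * F.x X ^ 2 +
        2 * Q.form F.u (rot F.u) * F.x X * F.y X + Q.form (rot F.u) (rot F.u) * F.y X ^ 2 := by
      intro X
      have h1 := F.eval_eq Q X
      have h2 := hO.eval_eq X
      rw [hO F.u, hO (rot F.u)] at h1
      linarith
    have hz : ∀ i, Q.form (P i - F.O) (P i - F.O) = -Q.eval F.O := by
      intro i
      have h1 := hO.eval_eq (P i)
      rw [hQ i] at h1
      linarith
    rw [F.disc_eq] at hdisc
    set a := Q.form F.u F.u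
    set b := Q.form F.u (rot F.u)
    set c := Q.form (rot F.u) (rot F.u)
    -- the chord `P i P j` has a direction conjugate to the axis, which passes through its midpoint
    have hconj : a * (F.x (P j) - F.x (P i)) = 2 * b * F.y (P i) := by
      have e1 := (hev _).symm.trans (hz i)
      have e2 := (hev _).symm.trans (hz j)
      rw [hyD] at e2
      apply mul_left_cancel₀ hxD
      linear_combination e2 - e1
    -- otherwise the axis is isotropic and contains points of the conic and the centre
    have hyi : F.y (P i) ≠ 0 := by
      intro h0
      rw [h0, mul_zero] at hconj
      have ha : a = 0 := by
        refine (mul_eq_zero.1 hconj).resolve_right fun h => hP.ne hij ?_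
        exact F.ext_xy (by linarith) (by rw [hyD, h0, neg_zero])
      have e1 := (hev _).symm.trans (hz i)
      rw [ha, h0] at e1
      exact hk0 (by linarith)
    -- the affinity makes the conjugate directions of `P i P j` and of the axis orthogonal, so that
    -- the form is diagonal in the coordinates of the image points
    have core : ∀ (α : Plane ≃ᵃ[ℝ] Plane) (m n : ℝ), n ≠ 0 →
        (∀ X, α X = F.pt (F.x X + m * F.y X) (n * F.y X)) →
        F.x (P j) - F.x (P i) = 2 * m * F.y (P i) →
        ∃ l μ p r dx dy : ℝ, F.x (α (P j)) = p - dx / 2 ∧ F.y (α (P j)) = r - dy / 2 ∧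
          F.x (α (P k)) = p + dx / 2 ∧ F.y (α (P k)) = r + dy / 2 ∧ l * μ < 0 ∧
          l * p * dx + μ * r * dy = 0 ∧ dx ≠ 0 ∧ dy ≠ 0 ∧ p ≠ 0 ∧ r ≠ 0 ∧
          ∀ X, Q.form (X - F.O) (X - F.O) = l * F.x (α X) ^ 2 + μ * F.y (α X) ^ 2 := by
      intro α m n hn hα hm
      have hb : b = a * m := by
        rw [hm] at hconj
        apply mul_left_cancel₀ hyi
        linear_combination -hconj / 2
      have hform : ∀ X, Q.form (X - F.O) (X - F.O) =
          a * F.x (α X) ^ 2 + (c - a * m ^ 2) / n ^ 2 * F.y (α X) ^ 2 := by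
        intro X
        rw [hev, hα, F.x_pt, F.y_pt, hb]
        field_simp; ring
      have hlμ : a * ((c - a * m ^ 2) / n ^ 2) < 0 := by
        rw [← mul_div_assoc]
        apply div_neg_of_neg_of_pos _ (by positivity)
        rw [hb] at hdisc
        linarith
      have hjk' := (hform (P k)).symm.trans ((hz k).trans ((hz j).symm.trans (hform (P j))))
      have hdy : F.y (α (P k)) - F.y (α (P j)) ≠ 0 := by
        rw [hα, hα, F.y_pt, F.y_pt, ← mul_sub]
        exact mul_ne_zero hn (sub_ne_zero.2 (Ne.symm h3))
      have hH : a * ((F.x (α (P j)) + F.x (α (P k))) / 2) * (F.x (α (P k)) - F.x (α (P j))) +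
          (c - a * m ^ 2) / n ^ 2 * ((F.y (α (P j)) + F.y (α (P k))) / 2) *
            (F.y (α (P k)) - F.y (α (P j))) = 0 := by
        linear_combination hjk' / 2
      have hne := Frame.chord_coords_ne_zero hlμ hH hdy ?_ ?_
      · exact ⟨a, _, _, _, _, _, by ring, by ring, by ring, by ring, hlμ, hH, hne.1, hdy, hne.2.1,
          hne.2.2, hform⟩
      · rintro ⟨e1, e2⟩
        simp only [hα, F.x_pt, F.y_pt] at e1 e2
        have e3 : F.y (P j) + F.y (P k) = 0 :=
          (mul_eq_zero.1 (by linarith : n * (F.y (P j) + F.y (P k)) = 0)).resolve_left hn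
        apply h2
        apply F.ext_xy
        · rw [F.x_midpoint, F.x_O]; linear_combination e1 - m / 2 * e3
        · rw [F.y_midpoint, F.y_O, e3, zero_div]
      · rintro ⟨e1, e2⟩
        simp only [hα, F.x_pt, F.y_pt] at e1 e2
        have e3 : F.y (P j) + F.y (P k) = 0 :=
          (mul_eq_zero.1 (by linarith : n * (F.y (P j) + F.y (P k)) = 0)).resolve_left hn
        apply hP.ne hik
        apply F.ext_xy
        · linear_combination -e1 - hm + m * (e3 - 2 * hyD)
        · linarith
    -- the condition that the image of the chord `P i P j` is perpendicular to the axis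
    have hperp : ∀ (α : Plane ≃ᵃ[ℝ] Plane) (m n : ℝ),
        (∀ X, α X = F.pt (F.x X + m * F.y X) (n * F.y X)) →
        (Perp line[ℝ, α (P i), α (P j)] F.axis ↔
          F.x (P j) - F.x (P i) = 2 * m * F.y (P i)) := by
      intro α m n hα
      have comm : ∀ x y : Plane, dotp x y = dotp y x := fun x y => by simp only [dotp]; ring
      rw [line_eq_ln, Frame.axis, perp_ln_iff, comm, F.dotp_u, hα, hα, F.x_pt, F.x_pt, hyD]
      constructor <;> intro h <;> linear_combination h
    constructor
    · set m := (F.x (P j) - F.x (P i)) / (2 * F.y (P i)) with hmdef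
      have hm : F.x (P j) - F.x (P i) = 2 * m * F.y (P i) := by rw [hmdef]; field_simp
      have hα := F.affinity_apply m 1 one_ne_zero
      obtain ⟨l, μ, p, r, dx, dy, c1, c2, c3, c4, hlμ, hH, hdx, hdy, hp, hr, -⟩ :=
        core _ m 1 one_ne_zero hα hm
      obtain ⟨M, N, A, B, hM, hN, hAB, hA, hB⟩ :=
        F.exists_asymptote_points c1 c2 c3 c4 hlμ hH hdx hdy hp hr
      set α := F.affinity m 1 one_ne_zero with hαdef
      refine ⟨α, M, N, α.symm A, α.symm B, ?_⟩
      constructor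
      · rw [hax]; exact F.isAffinity_affinity _ _ _
      · rw [hax]; exact (hperp α m 1 hα).2 hm
      · rw [hax]; exact hM
      · exact hN
      · exact fun h => hAB (α.symm.injective h)
      · rw [AffineEquiv.apply_symm_apply]; exact hA
      · rw [AffineEquiv.apply_symm_apply]; exact hB
    · rintro α M N A B ⟨hα, hαp, hM, hN, hAB, hA, hB⟩
      rw [hax] at hα hαp hM
      obtain ⟨m, n, hn, hα⟩ := F.exists_of_isAffinity hα
      rw [hperp α m n hα] at hαp
      obtain ⟨l, μ, p, r, dx, dy, c1, c2, c3, c4, hlμ, hH, hdx, hdy, hp, hr, hform⟩ :=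
        core α m n hn hα hαp
      obtain ⟨hA', hB', hcr⟩ := F.asymptote_points c1 c2 c3 c4 hlμ hH hdx hdy hr
        (by rw [← hform, hz]; exact neg_ne_zero.2 hk0) hM hN (fun h => hAB (α.injective h)) hA hB
      rw [← hform] at hA' hB'
      have hcr' : crs (A - F.O) (B - F.O) ≠ 0 := by
        intro h0
        apply hcr
        rw [F.crs_sub] at h0
        simp only [F.x_O, F.y_O, sub_zero] at h0
        simp only [hα, F.x_pt, F.y_pt]
        linear_combination n * h0
      rw [line_eq_ln, line_eq_ln]
      refine ⟨fun h => hcr' ?_, fun L => hO.isAsymptote_iff hd ⟨_, hQ 0⟩ hcr' hA' hB'⟩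
      exact ((ln_eq_ln_iff (ne_zero_left_of_crs hcr') (ne_zero_right_of_crs hcr')).1 h).1

end Quadric

/-! ### Vertices and foci of the hyperbola -/

namespace Quadric

variable {P : Fin 5 → Plane} {Q : Quadric}

/-- The bisector of the angle of the asymptotic unit vectors `u`, `v` in which the hyperbola lies is
its transverse axis, and `O + g (u + v)` is a vertex if it lies on the hyperbola. -/
lemma IsCtr.exists_frame_of_isotropic {O u v : Plane} (hO : Q.IsCtr O) (hd : Q.det ≠ 0)
    (hu : Q.form u u = 0) (hv : Q.form v v = 0) (hu1 : dotp u u = 1) (hv1 : dotp v v = 1)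
    (hc : crs u v ≠ 0) {g : ℝ} (hg : 0 < g) (hgk : 2 * g ^ 2 * Q.form u v = -Q.eval O) :
    ∃ (F : Frame) (a b : ℝ), F.O = O ∧ 0 < a ∧ 0 < b ∧ Q.form F.u (rot F.u) = 0 ∧
      O + g • u + g • v = F.pt a 0 ∧ a ^ 2 + b ^ 2 = 4 * g ^ 2 ∧
      ∀ X, X ∈ Q.zeros ↔ b ^ 2 * F.x X ^ 2 - a ^ 2 * F.y X ^ 2 = a ^ 2 * b ^ 2 := by
  have hk := hO.eval_ne_zero hd
  have hf : Q.form u v ≠ 0 := by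
    intro h0; rw [h0, mul_zero] at hgk; exact hk (by linarith)
  have hlag : crs u v ^ 2 + dotp u v ^ 2 = 1 := by
    have : crs u v ^ 2 + dotp u v ^ 2 = dotp u u * dotp v v := by simp only [crs, dotp]; ring
    rw [this, hu1, hv1, one_mul]
  have hlt : dotp u v ^ 2 < 1 := by have := pow_pos (abs_pos.2 hc) 2; rw [sq_abs] at this; linarith
  have hlt1 := abs_lt.1 (sq_lt_one_iff_abs_lt_one _ |>.1 hlt)
  have huv : u + v ≠ 0 := by
    intro h
    apply hc
    rw [eq_neg_of_add_eq_zero_left h]; simp only [crs, PiLp.neg_apply]; ring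
  obtain ⟨e, he, ρ, hρ, heq⟩ := exists_unit huv
  have hρ2 : ρ ^ 2 = 2 + 2 * dotp u v := by
    have h1 : dotp (u + v) (u + v) = 2 + 2 * dotp u v := by
      rw [show dotp (u + v) (u + v) = dotp u u + dotp v v + 2 * dotp u v by
        simp only [dotp, PiLp.add_apply]; ring, hu1, hv1]; ring
    rw [← h1, heq]
    simp only [dotp, PiLp.smul_apply, smul_eq_mul]
    linear_combination -ρ ^ 2 * he
  -- `ρ` is the length of `u + v`, and `4 - ρ²` is the square of the length of `u - v`; the
  -- semi-axes are `g |u + v|` and `g |u - v|`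
  have hσ : 0 < 4 - ρ ^ 2 := by linarith
  set F : Frame := ⟨O, e, he⟩ with hF
  have hFu : F.u = e := rfl
  -- `u + v` and `u - v` are both orthogonal and conjugate
  have hform : Q.form F.u (rot F.u) = 0 := by
    have h1 : dotp (u + v) (u - v) = 0 := by
      rw [show dotp (u + v) (u - v) = dotp u u - dotp v v by
        simp only [dotp, PiLp.add_apply, PiLp.sub_apply]; ring, hu1, hv1, sub_self]
    obtain ⟨q, hq⟩ := (dotp_eq_zero_iff huv).1 h1
    have hq0 : q ≠ 0 := by
      rintro rfl
      rw [zero_smul] at hq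
      apply hc
      rw [sub_eq_zero.1 hq]; simp only [crs]; ring
    have h2 : Q.form (u + v) (u - v) = 0 := by
      rw [show Q.form (u + v) (u - v) = Q.form u u - Q.form v v by
        simp only [form, PiLp.add_apply, PiLp.sub_apply]; ring, hu, hv, sub_self]
    rw [hq, heq] at h2
    have h3 : Q.form (ρ • e) (q • rot (ρ • e)) = q * ρ ^ 2 * Q.form e (rot e) := by
      simp [form]; ring
    rw [h3] at h2
    exact (mul_eq_zero.1 h2).resolve_left (by positivity)
  have hee : ρ ^ 2 * Q.form F.u F.u = 2 * Q.form u v := by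
    have h1 : Q.form (u + v) (u + v) = 2 * Q.form u v := by
      rw [form_add_left, form_add_right, form_add_right, hu, hv, Q.form_comm v u]; ring
    rw [← h1, heq, form_smul_left, form_smul_right]; ring
  have hrr : (4 - ρ ^ 2) * Q.form (rot F.u) (rot F.u) = -(2 * Q.form u v) := by
    have h1 := F.disc_eq Q
    have h2 := Q.disc_basis u v
    rw [hform] at h1
    rw [hu, hv, h1] at h2
    apply mul_left_cancel₀ (mul_ne_zero two_ne_zero hf)
    linear_combination -4 * h2 - (4 - ρ ^ 2) * Q.form (rot F.u) (rot F.u) * hee -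
      Q.form F.u F.u * Q.form (rot F.u) (rot F.u) *
        (4 * hlag + (ρ ^ 2 - 2 + 2 * dotp u v) * hρ2)
  have hb : √(4 - ρ ^ 2) ^ 2 = 4 - ρ ^ 2 := Real.sq_sqrt hσ.le
  refine ⟨F, g * ρ, g * √(4 - ρ ^ 2), rfl, by positivity, by positivity, hform, ?_, ?_, ?_⟩
  · have : F.pt (g * ρ) 0 = O + g • (ρ • e) := by
      rw [Frame.pt, zero_smul, add_zero, mul_smul]
    rw [this, ← heq, smul_add, add_assoc]
  · rw [mul_pow, mul_pow, hb]; ring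
  · intro X
    rw [mem_zeros, F.eval_eq, hform, hO, hO, mul_pow, mul_pow, hb]
    have hOO : F.O = O := rfl
    have hO' : Q.eval F.O = -(2 * g ^ 2 * Q.form u v) := by rw [hOO]; linarith
    rw [hO']
    constructor <;> intro h
    · apply mul_left_cancel₀ (mul_ne_zero two_ne_zero hf)
      linear_combination g ^ 2 * ρ ^ 2 * (4 - ρ ^ 2) * h
        - g ^ 2 * (4 - ρ ^ 2) * F.x X ^ 2 * hee - g ^ 2 * ρ ^ 2 * F.y X ^ 2 * hrr
    · apply mul_left_cancel₀ (by positivity : g ^ 2 * ρ ^ 2 * (4 - ρ ^ 2) ≠ 0)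
      linear_combination 2 * Q.form u v * h
        + g ^ 2 * (4 - ρ ^ 2) * F.x X ^ 2 * hee + g ^ 2 * ρ ^ 2 * F.y X ^ 2 * hrr

/-- The vertices, axes and foci of a hyperbola from its asymptotes and one of its points. -/
lemma hyperbola_foci_part (hQ : ∀ i, P i ∈ Q.zeros) (hd : Q.det ≠ 0) {O : Plane}
    (hO : Q.IsCtr O) {L₁ L₂ : Sub} (hne : L₁ ≠ L₂) (h₁ : IsAsymptote Q.zeros L₁)
    (h₂ : IsAsymptote Q.zeros L₂) (i : Fin 5) :
    (∃ u v x y B T F, HyperbolaSteps O L₁ L₂ (P i) u v x y B T F) ∧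
    ∀ u v x y B T F, HyperbolaSteps O L₁ L₂ (P i) u v x y B T F →
      (line[ℝ, O, B] : Set Plane) ∩ Q.zeros = {B, pointMirror O B} ∧
      IsAxis Q.zeros line[ℝ, O, B] ∧ IsAxis Q.zeros (perpThrough O line[ℝ, O, B]) ∧
      IsHyperbolaWith Q.zeros F (pointMirror O F) (2 * dist O B) := by
  obtain ⟨w₁, hw₁, hf₁, rfl⟩ := hO.exists_of_isAsymptote hd h₁
  obtain ⟨w₂, hw₂, hf₂, rfl⟩ := hO.exists_of_isAsymptote hd h₂
  have hc : crs w₁ w₂ ≠ 0 := by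
    intro h
    apply hne
    rw [ln_eq_ln_iff hw₁ hw₂]
    exact ⟨h, by simp [crs]⟩
  have hk := hO.eval_ne_zero hd
  have hPi := hO.eval_eq (P i)
  rw [hQ i] at hPi
  have hunit : ∀ {w : Plane}, w ≠ 0 → ‖‖w‖⁻¹ • w‖ = 1 := fun hw => by
    rw [norm_smul, norm_inv, norm_norm, inv_mul_cancel₀ (norm_ne_zero_iff.2 hw)]
  constructor
  · have hb := eq_basis hc (P i - O)
    set s := crs (P i - O) w₂ / crs w₁ w₂
    set t := crs w₁ (P i - O) / crs w₁ w₂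
    -- the point is not on an asymptote
    have hst : s * t ≠ 0 := by
      intro h0
      rw [hb] at hPi
      simp only [form_add_left, form_add_right, form_smul_left, form_smul_right, hf₁, hf₂,
        Q.form_comm w₂ w₁] at hPi
      apply hk
      linear_combination -hPi - 2 * Q.form w₁ w₂ * h0
    have hs : s • w₁ ≠ 0 := smul_ne_zero (left_ne_zero_of_mul hst) hw₁
    have ht : t • w₂ ≠ 0 := smul_ne_zero (right_ne_zero_of_mul hst) hw₂
    have hx : 0 < ‖s • w₁‖ := norm_pos_iff.2 hs
    have hy : 0 < ‖t • w₂‖ := norm_pos_iff.2 ht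
    set x := ‖s • w₁‖ with hxdef
    set y := ‖t • w₂‖ with hydef
    have hu1 := hunit hs
    have hv1 := hunit ht
    rw [← hxdef] at hu1
    rw [← hydef] at hv1
    have hu2 : dotp (x⁻¹ • s • w₁) (x⁻¹ • s • w₁) = 1 := by rw [← norm_sq_eq_dotp, hu1, one_pow]
    have hv2 : dotp (y⁻¹ • t • w₂) (y⁻¹ • t • w₂) = 1 := by rw [← norm_sq_eq_dotp, hv1, one_pow]
    have hux : x • x⁻¹ • s • w₁ = s • w₁ := by rw [smul_smul, mul_inv_cancel₀ hx.ne', one_smul]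
    have hvy : y • y⁻¹ • t • w₂ = t • w₂ := by rw [smul_smul, mul_inv_cancel₀ hy.ne', one_smul]
    have hum : x⁻¹ • s • w₁ ∈ (ln O w₁).direction := by
      rw [direction_ln, smul_smul]
      exact Submodule.smul_mem _ _ (Submodule.mem_span_singleton_self _)
    have hvm : y⁻¹ • t • w₂ ∈ (ln O w₂).direction := by
      rw [direction_ln, smul_smul]
      exact Submodule.smul_mem _ _ (Submodule.mem_span_singleton_self _)
    have hcuv : crs (x⁻¹ • s • w₁) (y⁻¹ • t • w₂) ≠ 0 := by
      have : crs (x⁻¹ • s • w₁) (y⁻¹ • t • w₂) = x⁻¹ * y⁻¹ * (s * t) * crs w₁ w₂ := by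
        simp only [crs, PiLp.smul_apply, smul_eq_mul]; ring
      rw [this]
      exact mul_ne_zero (mul_ne_zero (by positivity) hst) hc
    have hTm : O + (2 * √(x * y)) • x⁻¹ • s • w₁ ∈ ln O w₁ := by
      rw [mem_ln_iff]; exact ⟨_, by rw [smul_smul, smul_smul]⟩
    generalize x⁻¹ • s • w₁ = u at *
    generalize y⁻¹ • t • w₂ = v at *
    have huv : u + v ≠ 0 := by
      intro h
      apply hcuv
      rw [eq_neg_of_add_eq_zero_left h]; simp only [crs, PiLp.neg_apply]; ring
    refine ⟨u, v, x, y, O + √(x * y) • u + √(x * y) • v, O + (2 * √(x * y)) • u,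
      O + (2 * √(x * y) / ‖u + v‖) • (u + v), ⟨hum, hu1⟩, ⟨hvm, hv1⟩, ⟨hx, hy⟩, ?_, rfl,
      ⟨hTm, ?_⟩, ?_, ?_⟩
    · rw [hux, hvy, add_assoc, ← hb, add_sub_cancel]
    · rw [line_eq_ln, mem_perpThrough_ln]
      have : dotp (O + √(x * y) • u + √(x * y) • v - O)
          (O + (2 * √(x * y)) • u - (O + √(x * y) • u + √(x * y) • v)) =
          √(x * y) ^ 2 * (dotp u u - dotp v v) := by
        simp only [dotp, PiLp.add_apply, PiLp.sub_apply, PiLp.smul_apply, smul_eq_mul]; ring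
      rw [this, hu2, hv2, sub_self, mul_zero]
    · rw [line_eq_ln, mem_ln_iff]
      have hg : √(x * y) ≠ 0 := (Real.sqrt_pos.2 (mul_pos hx hy)).ne'
      refine ⟨2 / ‖u + v‖, ?_⟩
      have : O + √(x * y) • u + √(x * y) • v - O = √(x * y) • (u + v) := by
        rw [smul_add]; abel
      rw [this, smul_smul]
      congr 2
      ring
    · rw [dist_eq_norm, dist_eq_norm, sub_add_cancel_left, sub_add_cancel_left, norm_neg, norm_neg,
        norm_smul, norm_smul, hu1, norm_div, norm_norm, div_mul_cancel₀ _ (norm_ne_zero_iff.2 huv),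
        mul_one]
  · rintro u v x y B T E ⟨⟨hu, hu1⟩, ⟨hv, hv1⟩, ⟨hx, hy⟩, hPt, hB, ⟨hT, hTp⟩, hE, hd'⟩
    rw [direction_ln, Submodule.mem_span_singleton] at hu hv
    obtain ⟨s, hs⟩ := hu
    obtain ⟨t, ht⟩ := hv
    have hs0 : s ≠ 0 := by rintro rfl; rw [← hs] at hu1; simp at hu1
    have ht0 : t ≠ 0 := by rintro rfl; rw [← ht] at hv1; simp at hv1
    have hu2 : dotp u u = 1 := by rw [← norm_sq_eq_dotp, hu1, one_pow]
    have hv2 : dotp v v = 1 := by rw [← norm_sq_eq_dotp, hv1, one_pow]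
    have hfu : Q.form u u = 0 := by rw [← hs, form_smul_left, form_smul_right, hf₁]; ring
    have hfv : Q.form v v = 0 := by rw [← ht, form_smul_left, form_smul_right, hf₂]; ring
    have hcuv : crs u v ≠ 0 := by
      have : crs u v = s * t * crs w₁ w₂ := by
        rw [← hs, ← ht]; simp only [crs, PiLp.smul_apply, smul_eq_mul]; ring
      rw [this]; exact mul_ne_zero (mul_ne_zero hs0 ht0) hc
    have hxy : 0 < x * y := mul_pos hx hy
    have hg := Real.sqrt_pos.2 hxy
    have hg2 := Real.sq_sqrt hxy.le
    set g := √(x * y)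
    have hgk : 2 * g ^ 2 * Q.form u v = -Q.eval O := by
      have : P i - O = x • u + y • v := by rw [hPt]; abel
      rw [this] at hPi
      simp only [form_add_left, form_add_right, form_smul_left, form_smul_right, hfu, hfv,
        Q.form_comm v u] at hPi
      rw [hg2]
      linear_combination -hPi
    obtain ⟨F, a, b, rfl, ha, hb, hform, hBa, hab, hC⟩ :=
      hO.exists_frame_of_isotropic hd hfu hfv hu2 hv2 hcuv hg hgk
    rw [hBa] at hB
    have hax : line[ℝ, F.O, B] = F.axis := by
      have : B - F.O = a • F.u := by rw [hB, Frame.pt, zero_smul, add_zero, add_sub_cancel_left]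
      rw [line_eq_ln, this, Frame.axis, ln_eq_ln_iff (smul_ne_zero ha.ne' F.u_ne_zero) F.u_ne_zero]
      exact ⟨by simp only [crs, PiLp.smul_apply, smul_eq_mul]; ring, by simp [crs]⟩
    have hOB : dist F.O B = a := by
      rw [hB, F.dist_eq_abs_iff ha.le, F.x_pt, F.y_pt, F.x_O, F.y_O]; ring
    -- the point on the asymptote has the distance `2 g` from the centre
    have hOT : dist F.O T = 2 * g := by
      obtain ⟨q, rfl⟩ := mem_ln_iff.1 hT
      rw [line_eq_ln, mem_perpThrough_ln, hB, ← hBa] at hTp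
      have hq : F.O + q • w₁ = F.O + (q / s) • u := by
        rw [← hs, smul_smul, div_mul_cancel₀ _ hs0]
      rw [hq] at hTp ⊢
      have h1 : dotp (F.O + g • u + g • v - F.O) (F.O + (q / s) • u - (F.O + g • u + g • v)) =
          g * ((q / s - g) * dotp u u + (q / s - 2 * g) * dotp u v - g * dotp v v) := by
        simp only [dotp, PiLp.add_apply, PiLp.sub_apply, PiLp.smul_apply, smul_eq_mul]; ring
      rw [h1, hu2, hv2] at hTp
      have h2 : (1 + dotp u v) * (q / s - 2 * g) = 0 := by
        have := (mul_eq_zero.1 hTp).resolve_left hg.ne'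
        linear_combination this
      have h3 : 1 + dotp u v ≠ 0 := by
        intro h0
        have : crs u v ^ 2 + dotp u v ^ 2 = dotp u u * dotp v v := by simp only [crs, dotp]; ring
        rw [hu2, hv2, show dotp u v = -1 by linarith] at this
        exact hcuv (pow_eq_zero_iff two_ne_zero |>.1 (by linarith))
      have h4 := (mul_eq_zero.1 h2).resolve_left h3
      rw [sub_eq_zero.1 h4, dist_eq_norm, sub_add_cancel_left, norm_neg, norm_smul, hu1, mul_one,
        Real.norm_of_nonneg (by positivity)]
    rw [hOT, F.dist_eq_abs_iff (by positivity), F.x_O, F.y_O] at hd'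
    rw [hax, F.mem_axis] at hE
    rw [hE] at hd'
    rw [hax, hOB]
    refine ⟨?_, F.isAxis_of_form hform (hO _), ?_, ?_⟩
    · ext X
      simp only [mem_inter_iff, SetLike.mem_coe, F.mem_axis, hC, mem_insert_iff, mem_singleton_iff,
        F.eq_iff (X := X), F.x_pointMirror, F.y_pointMirror, F.x_O, F.y_O, hB, F.x_pt, F.y_pt]
      constructor
      · rintro ⟨h1, h2⟩
        rw [h1] at h2
        have : F.x X ^ 2 = a ^ 2 := by
          apply mul_left_cancel₀ (pow_ne_zero 2 hb.ne'); linarith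
        rcases sq_eq_sq_iff_eq_or_eq_neg.1 this with h | h
        · exact Or.inl ⟨h, h1⟩
        · exact Or.inr ⟨by linarith, by linarith⟩
      · rintro (⟨h1, h2⟩ | ⟨h1, h2⟩)
        · exact ⟨h2, by rw [h1, h2]; ring⟩
        · exact ⟨by linarith, by rw [h1, h2]; ring⟩
    · rw [F.perpThrough_O]
      refine F.turn.isAxis_of_form ?_ (hO _)
      have : Q.form F.turn.u (rot F.turn.u) = -Q.form F.u (rot F.u) := by
        simp [form, Frame.turn]; ring
      rw [this, hform, neg_zero]
    · have e1 : E = F.pt (F.x E) 0 := by rw [← hE, F.pt_x_y]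
      have e2 : pointMirror F.O E = F.pt (-F.x E) 0 := by
        apply F.ext_xy
        · simp
        · simp [hE]
      rw [e2]
      nth_rw 1 [e1]
      exact F.isHyperbolaWith ha hb hC (by linear_combination hd' - hab)

end Quadric

/-! ### Diameters through the midpoints of parallel chords -/

namespace Quadric

variable {P : Fin 5 → Plane} {Q : Quadric}

/-- The line joining the midpoints of the parallel chords `A S` and `X Y` is the diameter conjugate
to their direction. -/
lemma line_midpoints_eq {A S X Y : Plane} (hvv : Q.form (Y - X) (Y - X) ≠ 0) (hX : Q.eval X = 0)
    (hY : Q.eval Y = 0) (hA : crs (Y - X) (A - X) ≠ 0) (hS : S ∈ ln A (Y - X))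
    (hM : Q.lin (midpoint ℝ A S) (Y - X) = 0) :
    line[ℝ, midpoint ℝ A S, midpoint ℝ X Y] = ln (midpoint ℝ A S) (Q.conj (Y - X)) := by
  refine line_eq_diameter hvv hM (lin_midpoint hX hY) fun h => hA ?_
  obtain ⟨r, rfl⟩ := mem_ln_iff.1 hS
  have h0 := congrArg (fun Z : Plane => Z 0) h
  have h1 := congrArg (fun Z : Plane => Z 1) h
  simp only [midpoint_zero, midpoint_one, PiLp.add_apply, PiLp.smul_apply, PiLp.sub_apply,
    smul_eq_mul] at h0 h1
  simp only [crs, PiLp.sub_apply]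
  linear_combination (Y 0 - X 0) * h1 - (Y 1 - X 1) * h0

/-- If the diameters conjugate to two independent directions coincide, the derivative of the quadric
vanishes at one of its points and the form is degenerate, so that the determinant is zero. -/
lemma diameter_ne {v w M N : Plane} (hd : Q.det ≠ 0) (hc : crs v w ≠ 0) (hvv : Q.form v v ≠ 0)
    (hww : Q.form w w ≠ 0) (hM : Q.lin M v = 0) (hN : Q.lin N w = 0) :
    ln M (Q.conj v) ≠ ln N (Q.conj w) := by
  intro h
  have h1 := ((ln_eq_ln_iff (conj_ne_zero hvv) (conj_ne_zero hww)).1 h).1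
  rw [crs_conj_conj] at h1
  have hMw : Q.lin M w = 0 := (mem_diameter hww hN).1 (h ▸ self_mem_ln M (Q.conj v))
  apply hd
  rw [det_eq_of_basis hc hM hMw, (mul_eq_zero.1 h1).resolve_right hc, zero_mul]

lemma diameter_parallel_iff {v w M N : Plane} (hc : crs v w ≠ 0) (hvv : Q.form v v ≠ 0)
    (hww : Q.form w w ≠ 0) : ln M (Q.conj v) ∥ ln N (Q.conj w) ↔ Q.disc = 0 := by
  rw [parallel_ln_iff (conj_ne_zero hvv) (conj_ne_zero hww), crs_conj_conj, mul_eq_zero,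
    or_iff_left hc]

/-- Two intersecting diameters meet in the centre. -/
lemma exists_isCtr {v w M N : Plane} (hdisc : Q.disc ≠ 0) (hc : crs v w ≠ 0)
    (hvv : Q.form v v ≠ 0) (hww : Q.form w w ≠ 0) (hM : Q.lin M v = 0) (hN : Q.lin N w = 0) :
    ∃ O, Q.IsCtr O ∧ (ln M (Q.conj v) : Set Plane) ∩ ln N (Q.conj w) = {O} ∧
      ln M (Q.conj v) = ln O (Q.conj v) ∧ ln N (Q.conj w) = ln O (Q.conj w) := by
  have hb : Q.form (Q.conj v) w ≠ 0 := by
    rw [← crs_conj, crs_conj_conj]; exact mul_ne_zero hdisc hc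
  set O := M + (-Q.lin M w / Q.form (Q.conj v) w) • Q.conj v with hOdef
  have hOv : Q.lin O v = 0 := (mem_diameter hvv hM).1 (mem_ln_iff.2 ⟨_, rfl⟩)
  have hOw : Q.lin O w = 0 := by
    rw [hOdef, lin_add, form_smul_left, div_mul_cancel₀ _ hb]; ring
  have hO := isCtr_of_basis hc hOv hOw
  refine ⟨O, hO, ?_, ?_, ?_⟩
  · ext X
    rw [mem_inter_iff, SetLike.mem_coe, SetLike.mem_coe, mem_diameter hvv hM, mem_diameter hww hN,
      mem_singleton_iff]
    constructor
    · rintro ⟨h1, h2⟩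
      rw [Q.lin_eq O, hO, zero_add, form_comm] at h1 h2
      exact sub_eq_zero.1 (eq_zero_of_form hdisc hc h1 h2)
    · rintro rfl; exact ⟨hOv, hOw⟩
  · have := (mem_diameter hvv hM).2 hOv
    rw [mem_ln (conj_ne_zero hvv)] at this
    rw [ln_eq_ln_iff (conj_ne_zero hvv) (conj_ne_zero hvv)]
    exact ⟨by simp only [crs]; ring, this⟩
  · have := (mem_diameter hww hN).2 hOw
    rw [mem_ln (conj_ne_zero hww)] at this
    rw [ln_eq_ln_iff (conj_ne_zero hww) (conj_ne_zero hww)]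
    exact ⟨by simp only [crs]; ring, this⟩

end Quadric

end FivePointConic

theorem mainTheorem2 (P : Fin 5 → Plane)
    (hP : ∀ i j k, i ≠ j → i ≠ k → j ≠ k → ¬ Collinear ℝ {P i, P j, P k}) :
    -- the conic defined by the five points
    (∃! C : Set Plane, IsConic C ∧ ∀ i, P i ∈ C) ∧
    -- the sixth points of the two Pascal constructions
    (∃! P₆, PascalSixth (P 0) (P 1) (P 2) (P 3) (P 4)
      (parallelThrough (P 0) line[ℝ, P 1, P 2]) P₆) ∧
    (∃! Q₆, PascalSixth (P 4) (P 0) (P 1) (P 2) (P 3)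
      (parallelThrough (P 4) line[ℝ, P 0, P 1]) Q₆) ∧
    ∀ C : Set Plane, IsConic C → (∀ i, P i ∈ C) →
    ∀ P₆ Q₆ : Plane,
      PascalSixth (P 0) (P 1) (P 2) (P 3) (P 4)
        (parallelThrough (P 0) line[ℝ, P 1, P 2]) P₆ →
      PascalSixth (P 4) (P 0) (P 1) (P 2) (P 3)
        (parallelThrough (P 4) line[ℝ, P 0, P 1]) Q₆ →
    ∀ d₁ d₂ : Sub,
      d₁ = line[ℝ, midpoint ℝ (P 0) P₆, midpoint ℝ (P 1) (P 2)] →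
      d₂ = line[ℝ, midpoint ℝ (P 4) Q₆, midpoint ℝ (P 0) (P 1)] →
    -- two pairs of parallel chords
    (parallelThrough (P 0) line[ℝ, P 1, P 2] : Set Plane) ∩ C = {P 0, P₆} ∧
    (parallelThrough (P 4) line[ℝ, P 0, P 1] : Set Plane) ∩ C = {P 4, Q₆} ∧
    -- two diameters
    IsDiameterConj C d₁ line[ℝ, P 1, P 2] ∧
    IsDiameterConj C d₂ line[ℝ, P 0, P 1] ∧
    d₁ ≠ d₂ ∧
    -- parallel diameters: the parabola
    (IsParabola C ↔ d₁ ∥ d₂) ∧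
    (d₁ ∥ d₂ →
      (∃! R₆, PascalSixth (P 0) (P 1) (P 2) (P 3) (P 4) (perpThrough (P 0) d₁) R₆) ∧
      ∀ R₆, PascalSixth (P 0) (P 1) (P 2) (P 3) (P 4) (perpThrough (P 0) d₁) R₆ →
      ∀ t : Sub, t = parallelThrough (midpoint ℝ (P 0) R₆) d₁ →
        (perpThrough (P 0) d₁ : Set Plane) ∩ C = {P 0, R₆} ∧
        (R₆ ≠ P 0 → t = AffineSubspace.perpBisector (P 0) R₆) ∧
        (∀ L, IsAxis C L ↔ L = t) ∧
        (∃ i j, P i ∉ t ∧ P j ∉ perpThrough (P i) t) ∧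
        ∀ i j, P i ∉ t → P j ∉ perpThrough (P i) t →
          (∀ F' ∈ t, ∃ d' D' V' Q' α V T R F d,
            ParabolaSteps t (P i) (P j) F' d' D' V' Q' α V T R F d) ∧
          ∀ F' d' D' V' Q' α V T R F d,
            ParabolaSteps t (P i) (P j) F' d' D' V' Q' α V T R F d →
            α '' D' = C ∧ V ∈ C ∧ IsParabolaWith C F d) ∧
    -- intersecting diameters: the central conics
    (¬ d₁ ∥ d₂ →
      ∃ O : Plane, (d₁ : Set Plane) ∩ d₂ = {O} ∧ IsCenter C O ∧
      ∀ d₁' d₂' : Sub,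
        d₁' = parallelThrough O line[ℝ, P 1, P 2] →
        d₂' = parallelThrough O line[ℝ, P 0, P 1] →
      IsConjugatePair C d₁ d₁' ∧ IsConjugatePair C d₂ d₂' ∧
      -- ellipse and hyperbola are distinguished by separation
      (midpoint ℝ (P 0) (P 2) ≠ O →
        ∀ t : Sub, IsLine t → O ∉ t → ∀ A A' B B' : Plane,
          A ∈ t → A ∈ d₁ → A' ∈ t → A' ∈ d₁' → B ∈ t → B ∈ d₂ → B' ∈ t → B' ∈ d₂' →
          (IsEllipse C ↔ Separate A A' B B') ∧ (IsEllipse C ↔ crossRatio A A' B B' < 0) ∧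
          (IsHyperbola C ↔ ¬ Separate A A' B B') ∧
          (IsHyperbola C ↔ 0 < crossRatio A A' B B')) ∧
      -- the axes of the ellipse
      (IsEllipse C → midpoint ℝ (P 0) (P 2) ≠ O →
        ∀ t : Sub, IsLine t → O ∉ t →
          (∃ α, IsAffinity t α ∧
            Perp (d₁.map (α : Plane →ᵃ[ℝ] Plane)) (d₁'.map (α : Plane →ᵃ[ℝ] Plane)) ∧
            Perp (d₂.map (α : Plane →ᵃ[ℝ] Plane)) (d₂'.map (α : Plane →ᵃ[ℝ] Plane))) ∧
          ∀ α, IsAffinity t α →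
            Perp (d₁.map (α : Plane →ᵃ[ℝ] Plane)) (d₁'.map (α : Plane →ᵃ[ℝ] Plane)) →
            Perp (d₂.map (α : Plane →ᵃ[ℝ] Plane)) (d₂'.map (α : Plane →ᵃ[ℝ] Plane)) →
            (∃ r > 0, α '' C = Metric.sphere (α O) r) ∧
            (∀ Z F G : Plane, Z ∈ t → dist Z O = dist Z (α O) →
              F ∈ t → G ∈ t → F ≠ G → dist Z F = dist Z O → dist Z G = dist Z O →
              IsAxis C line[ℝ, O, F] ∧ IsAxis C line[ℝ, O, G] ∧
              Perp line[ℝ, O, F] line[ℝ, O, G]) ∧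
            (α O - O ∉ t.directionᗮ → ∃ Z F G : Plane, Z ∈ t ∧ dist Z O = dist Z (α O) ∧
              F ∈ t ∧ G ∈ t ∧ F ≠ G ∧ dist Z F = dist Z O ∧ dist Z G = dist Z O) ∧
            (α O - O ∈ t.directionᗮ →
              IsAxis C (parallelThrough O t) ∧ IsAxis C (perpThrough O t))) ∧
      -- the vertices and foci of the ellipse from an axis
      (IsEllipse C → ∀ t, IsAxis C t →
        (∃ i j, i ≠ j ∧ ¬ line[ℝ, P i, P j] ∥ t ∧ midpoint ℝ (P i) (P j) ∉ t) ∧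
        ∀ i j, i ≠ j → ¬ line[ℝ, P i, P j] ∥ t → midpoint ℝ (P i) (P j) ∉ t →
          (∃ G F' α V W, EllipseSteps O t (P i) (P j) G F' α V W) ∧
          ∀ G F' α V W, EllipseSteps O t (P i) (P j) G F' α V W →
            dist O (α (P i)) = dist O (α (P j)) ∧
            α '' C = Metric.sphere O (dist O (α (P i))) ∧
            (t : Set Plane) ∩ C = {V, pointMirror O V} ∧
            (perpThrough O t : Set Plane) ∩ C = {W, pointMirror O W} ∧
            (dist O W ≤ dist O V →
              (∃ F ∈ t, dist F W = dist O V) ∧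
              ∀ F ∈ t, dist F W = dist O V →
                IsEllipseWith C F (pointMirror O F) (2 * dist O V)) ∧
            (dist O V ≤ dist O W →
              (∃ F ∈ perpThrough O t, dist F V = dist O W) ∧
              ∀ F ∈ perpThrough O t, dist F V = dist O W →
                IsEllipseWith C F (pointMirror O F) (2 * dist O W))) ∧
      -- the asymptotes of the hyperbola
      (IsHyperbola C →
        (∃ i j k, i ≠ j ∧ i ≠ k ∧ j ≠ k ∧ midpoint ℝ (P i) (P j) ≠ O ∧
          midpoint ℝ (P j) (P k) ≠ O ∧
          ¬ line[ℝ, P j, P k] ∥ line[ℝ, O, midpoint ℝ (P i) (P j)]) ∧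
        ∀ i j k, i ≠ j → i ≠ k → j ≠ k → midpoint ℝ (P i) (P j) ≠ O →
          midpoint ℝ (P j) (P k) ≠ O →
          ¬ line[ℝ, P j, P k] ∥ line[ℝ, O, midpoint ℝ (P i) (P j)] →
          (∃ α M N A B, AsymptoteSteps O (P i) (P j) (P k) α M N A B) ∧
          ∀ α M N A B, AsymptoteSteps O (P i) (P j) (P k) α M N A B →
            line[ℝ, O, A] ≠ line[ℝ, O, B] ∧
            ∀ L, IsAsymptote C L ↔ L = line[ℝ, O, A] ∨ L = line[ℝ, O, B]) ∧
      -- the vertices, axes and foci of the hyperbola from the asymptotes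
      (IsHyperbola C → ∀ L₁ L₂, L₁ ≠ L₂ → IsAsymptote C L₁ → IsAsymptote C L₂ → ∀ i,
        (∃ u v x y B T F, HyperbolaSteps O L₁ L₂ (P i) u v x y B T F) ∧
        ∀ u v x y B T F, HyperbolaSteps O L₁ L₂ (P i) u v x y B T F →
          (line[ℝ, O, B] : Set Plane) ∩ C = {B, pointMirror O B} ∧
          IsAxis C line[ℝ, O, B] ∧ IsAxis C (perpThrough O line[ℝ, O, B]) ∧
          IsHyperbolaWith C F (pointMirror O F) (2 * dist O B))) := by
  have hG : General P := fun i j k h1 h2 h3 => crs_ne_zero_of_not_collinear (hP i j k h1 h2 h3)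
  -- the second construction is the first one for the points `P 4, P 0, P 1, P 2, P 3`
  set σ : Fin 5 → Fin 5 := ![4, 0, 1, 2, 3] with hσ
  have hG' : General (P ∘ σ) := hG.comp (by decide)
  have hC := existsUnique_conic hG
  have hv := hG.ne (by decide : (1 : Fin 5) ≠ 2)
  have hw := hG.ne (by decide : (0 : Fin 5) ≠ 1)
  have hcr : crs (P 2 - P 1) (P 1 - P 0) ≠ 0 := by
    have := hG 1 2 0 (by decide) (by decide) (by decide)
    simp only [crs, PiLp.sub_apply] at *
    contrapose! this
    linarith
  have pascal₁ : ∀ {Q : Quadric}, Q.det ≠ 0 → (∀ i, P i ∈ Q.zeros) →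
      Q.form (P 2 - P 1) (P 2 - P 1) ≠ 0 := fun hd hQ =>
    Quadric.form_chord_ne_zero hd hv (hQ 1) (hQ 2)
  have pascal₂ : ∀ {Q : Quadric}, Q.det ≠ 0 → (∀ i, P i ∈ Q.zeros) →
      Q.form (P 1 - P 0) (P 1 - P 0) ≠ 0 := fun hd hQ =>
    Quadric.form_chord_ne_zero hd hw (hQ 0) (hQ 1)
  simp only [parallelThrough_line]
  obtain ⟨C₀, hC₀, -⟩ := hC
  obtain ⟨Q₀, hd₀, rfl⟩ := hC₀.1.exists_quadric
  refine ⟨existsUnique_conic hG,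
    Quadric.existsUnique_pascalSixth hG hC₀.2 hd₀ (pascal₁ hd₀ hC₀.2),
    Quadric.existsUnique_pascalSixth hG' (fun i => hC₀.2 (σ i)) hd₀ (pascal₂ hd₀ hC₀.2), ?_⟩
  clear hC₀ hd₀ Q₀
  intro C hCc hCP P₆ Q₆ hP₆ hQ₆ d₁ d₂ hd₁ hd₂
  obtain ⟨Q, hd, rfl⟩ := hCc.exists_quadric
  have hvv := pascal₁ hd hCP
  have hww := pascal₂ hd hCP
  obtain ⟨c₁, m₁, s₁⟩ := Quadric.pascalSixth_chord hG hCP hd hvv hP₆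
  obtain ⟨c₂, m₂, s₂⟩ := Quadric.pascalSixth_chord hG' (fun i => hCP (σ i)) hd hww hQ₆
  change Q.lin (midpoint ℝ (P 4) Q₆) _ = 0 at m₂
  rw [Quadric.line_midpoints_eq hvv (hCP 1) (hCP 2)
    (hG 1 2 0 (by decide) (by decide) (by decide)) s₁ m₁] at hd₁
  rw [Quadric.line_midpoints_eq hww (hCP 0) (hCP 1)
    (hG 0 1 4 (by decide) (by decide) (by decide)) s₂ m₂] at hd₂
  have hpar : d₁ ∥ d₂ ↔ Q.disc = 0 := by
    rw [hd₁, hd₂]; exact Quadric.diameter_parallel_iff hcr hvv hww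
  refine ⟨c₁, c₂, ?_, ?_, ?_, ?_, ?_, ?_⟩
  · rw [hd₁, line_eq_ln]; exact Quadric.isDiameterConj_ln hvv m₁
  · rw [hd₂, line_eq_ln]; exact Quadric.isDiameterConj_ln hww m₂
  · rw [hd₁, hd₂]; exact Quadric.diameter_ne hd hcr hvv hww m₁ m₂
  · rw [hpar, Quadric.isParabola_iff hG hCP hd]
  · intro h
    rw [hd₁]
    exact Quadric.parabola_part hG hCP hd (hpar.1 h) hvv
  · intro h
    have hdisc : Q.disc ≠ 0 := fun h0 => h (hpar.2 h0)
    obtain ⟨O, hO, hint, e₁, e₂⟩ := Quadric.exists_isCtr hdisc hcr hvv hww m₁ m₂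
    refine ⟨O, by rw [hd₁, hd₂, hint], hO.isCenter, ?_⟩
    rw [e₁] at hd₁
    rw [e₂] at hd₂
    rintro d₁' d₂' rfl rfl
    subst hd₁ hd₂
    have hvw : midpoint ℝ (P 0) (P 2) ≠ O → Q.form (P 2 - P 1) (P 1 - P 0) ≠ 0 := fun hm h0 =>
      hm ((hO.form_chords_eq_zero_iff hd (hCP 0) (hCP 1) (hCP 2)
        (hG 0 1 2 (by decide) (by decide) (by decide))).1 h0)
    refine ⟨hO.isConjugatePair hd hvv, hO.isConjugatePair hd hww, ?_, ?_, ?_, ?_, ?_⟩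
    · intro hm t ht hOt A A' B B' hA hA1 hA' hA'1 hB hB1 hB' hB'1
      exact Quadric.separation_part hG hCP hd hO hvv (hvw hm) hcr ht hOt hA hA1 hA' hA'1 hB hB1 hB'
        hB'1
    · intro hE hm t ht hOt
      exact Quadric.ellipse_axes_part hCP hd hO ((Quadric.isEllipse_iff hG hCP hd).1 hE) hvv
        (hvw hm) hcr ht hOt
    · intro hE t ht
      exact Quadric.ellipse_foci_part hG hCP hd ((Quadric.isEllipse_iff hG hCP hd).1 hE) hO ht
    · intro hH
      exact Quadric.asymptotes_part hG hCP hd hO ((Quadric.isHyperbola_iff hG hCP hd).1 hH)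
    · intro _ L₁ L₂ hne h₁ h₂ i
      exact Quadric.hyperbola_foci_part hCP hd hO hne h₁ h₂ i
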